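/- Let $k$ be a field and let $\Delta$ be a quiver with a finite set of vertices $\Delta_0$. Write $\Delta_m$ for the set of paths of length $m$ (vertices are the paths of length $0$; $o(p)$ and $t(p)$ are the source and the end of a path $p$, $|p|$ is its length), $k\Delta_m$ for the vector space with basis $\Delta_m$, and $k\Delta=\bigoplus_m k\Delta_m$ for the path algebra, with concatenation of paths as product. Let $I$ be the two-sided ideal of $k\Delta$ generated by the arrows, $N\ge 1$ an integer, $A=k\Delta/I^N$ the truncated quiver algebra, and $A_+\subset A$ the ideal spanned by the paths of positive length. All tensor products below are over $k\Delta_0$, bimodules are $k$-central, and $A^e=A\otimes_k A^{op}$. **The reduced bar resolution.** $\mathbf Q_n=A\otimes A_+^{\otimes n}\otimes A$, with elements $\alpha[\alpha_1|\dots|\alpha_n]\beta$, augmentation $\epsilon:\mathbf Q_0=A\otimes A\to A$, $\alpha[\,]\beta\mapsto\alpha\beta$, and, for $n\ge1$, $$b_n(\alpha[\alpha_1|\dots|\alpha_n]\beta)=\alpha\alpha_1[\alpha_2|\dots|\alpha_n]\beta+\sum_{i=1}^{n-1}(-1)^i\alpha[\alpha_1|\dots|\alpha_i\alpha_{i+1}|\dots|\alpha_n]\beta+(-1)^n\alpha[\alpha_1|\dots|\alpha_{n-1}]\alpha_n\beta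 .$$ **The minimal resolution.** $\mathbf P_{2k}=A\otimes k\Delta_{kN}\otimes A$ and $\mathbf P_{2k+1}=A\otimes k\Delta_{kN+1}\otimes A$, with augmentation $\epsilon:\mathbf P_0=A\otimes k\Delta_0\otimes A\to A$, $\alpha\otimes x\otimes\beta\mapsto\alpha x\beta$, and, for arrows $v_i$ forming a path, $$d_{2k}(\alpha\otimes v_1\cdots v_{kN}\otimes\beta)=\sum_{j=0}^{N-1}\alpha v_1\cdots v_j\otimes v_{j+1}\cdots v_{j+(k-1)N+1}\otimes v_{j+(k-1)N+2}\cdots v_{kN}\beta\quad(k\ge1),$$ $$d_{2k+1}(\alpha\otimes v_1\cdots v_{kN+1}\otimes\beta)=\alpha v_1\otimes v_2\cdots v_{kN+1}\otimes\beta-\alpha\otimes v_1\cdots v_{kN}\otimes v_{kN+1}\beta\quad(k\ge0).$$ **The map $\mathbf F:\mathbf P\to\mathbf Q$.** $\mathbf F_n$ is the $A$-bimodule extension of the map sending $1\otimes p\otimes 1$, for a path $p$ of length $kN$ (if $n=2k$) or $kN+1$ (if $n=2k+1$), to $$\sum_{x}1[p_1|\dots|p_n]p_{n+1},$$ where $x=(x_1,\dots,x_k)$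 runs over all $k$-tuples of integers with $1\le x_i<N$, and $p=p_1\cdots p_np_{n+1}$ is the decomposition of $p$ into consecutive subpaths such that $(|p_1|,\dots,|p_n|)$ is $(x_1,1,x_2,1,\dots,x_k,1)$ if $n=2k$, and $(1,x_1,1,x_2,1,\dots,x_k,1)$ if $n=2k+1$. (For $n=0$ this is $1\otimes v\otimes1\mapsto 1[\,]v$, the identification $\mathbf P_0=A\otimes A=\mathbf Q_0$.) **The map $\mathbf G:\mathbf Q\to\mathbf P$.** $\mathbf G_n$ is the $A$-bimodule extension of the following map, defined on the elements $q=o(\alpha_1)[\alpha_1|\dots|\alpha_n]t(\alpha_n)$ (equal to $1[\alpha_1|\dots|\alpha_n]1$), where $\alpha_1,\dots,\alpha_n$ are composable paths with $1\le|\alpha_i|<N$; let $v_1\cdots v_L$ be the path $\alpha_1\cdots\alpha_n$ of $\Delta$. If $n=2k\ge2$, $$\mathbf G_{2k}(q)=1\otimes v_1\cdots v_{kN}\otimes v_{kN+1}\cdots v_L\ \text{ if }\alpha_{2i-1}\alpha_{2i}=0\text{ in }A\text{ for }1\le i\le k,\qquad \mathbf G_{2k}(q)=0\text{ otherwise.}$$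 If $n=2k+1$, $$\mathbf G_{2k+1}(q)=\sum_{j=1}^{|\alpha_1|}v_1\cdots v_{j-1}\otimes v_j\cdots v_{kN+j}\otimes v_{kN+j+1}\cdots v_L\ \text{ if }\alpha_{2i}\alpha_{2i+1}=0\text{ in }A\text{ for }1\le i\le k,\qquad \mathbf G_{2k+1}(q)=0\text{ otherwise.}$$ For $n=0$, $\mathbf G_0$ is the identification $\mathbf Q_0=A\otimes A=\mathbf P_0$, i.e. $v[\,]v\mapsto1\otimes v\otimes 1$ for every vertex $v$. **Theorem.** The elements on which $\mathbf F_n$ and $\mathbf G_n$ are prescribed generate the bimodules $\mathbf P_n$ and $\mathbf Q_n$, and the $A$-bimodule maps $\epsilon$, $d_n$, $b_n$, $\mathbf F_n$, $\mathbf G_n$ above are well defined. With the augmentations $\epsilon$, $(\mathbf P,d)$ and $(\mathbf Q,b)$ are projective resolutions of $A$ as an $A^e$-module, and for all $n\ge0$ $$b_{n+1}\mathbf F_{n+1}=\mathbf F_nd_{n+1},\qquad d_{n+1}\mathbf G_{n+1}=\mathbf G_nb_{n+1},\qquad \epsilon\mathbf F_0=\epsilon,\qquad \epsilon\mathbf G_0=\epsilon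 .$$ Hence $\mathbf F:\mathbf P\to\mathbf Q$ and $\mathbf G:\mathbf Q\to\mathbf P$ are comparison morphisms, i.e. morphisms of chain complexes lifting the identity of $A$, between the projective resolutions $\mathbf P$ and $\mathbf Q$ of $A$. -/

import Mathlib

open scoped TensorProduct

noncomputable section

namespace TruncQuiver

universe u v w

/-! ### Paths -/

section Paths

variable (V : Type v) [Quiver.{w} V]

/-- The set of all paths of the quiver; `⟨a, b, p⟩` has source `a` and end `b`.
The vertices are the paths of length zero. -/
abbrev Pth : Type (max v w) := Σ a b : V, Quiver.Path a b

variable {V}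

/-- The length of a path, i.e. its number of arrows. -/
def len (p : Pth V) : ℕ := p.2.2.length

/-- The vertex `a`, as a path of length zero. -/
def vtx (a : V) : Pth V := ⟨a, a, Quiver.Path.nil⟩

/-- The first `j` arrows of a path (the whole path if `j` exceeds its length). -/
def takeP {a : V} : ∀ {b : V}, Quiver.Path a b → ℕ → Pth V
  | _, .nil, _ => ⟨a, a, .nil⟩
  | b, .cons p e, j => if p.length + 1 ≤ j then ⟨a, b, p.cons e⟩ else takeP p j

/-- What is left of a path after removing its first `j` arrows (the end vertex if `j` exceeds
the length). -/
def dropP {a : V} : ∀ {b : V}, Quiver.Path a b → ℕ → Σ c : V, Quiver.Path c b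
  | _, .nil, _ => ⟨a, .nil⟩
  | b, .cons p e, j =>
      if p.length + 1 ≤ j then ⟨b, .nil⟩ else ⟨(dropP p j).1, (dropP p j).2.cons e⟩

/-- For `p = v_1 … v_m`, the subpath `v_{i+1} … v_{i+l}` of length `l`. -/
def seg (p : Pth V) (i l : ℕ) : Pth V := takeP (dropP p.2.2 i).2 l

/-- For `p = v_1 … v_m`, the final subpath `v_{i+1} … v_m`. -/
def rest (p : Pth V) (i : ℕ) : Pth V := ⟨_, _, (dropP p.2.2 i).2⟩

end Paths

/-! ### The path algebra -/

section Algebra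

variable (k : Type u) [Field k] (V : Type v) [Quiver.{w} V]

/-- The path algebra `kΔ`: the vector space with basis the set of paths. -/
def PathAlg : Type (max u v w) := Pth V →₀ k

instance : AddCommGroup (PathAlg k V) := inferInstanceAs (AddCommGroup (Pth V →₀ k))
instance : Module k (PathAlg k V) := inferInstanceAs (Module k (Pth V →₀ k))

variable {V}

/-- A path, as an element of the path algebra. -/
def ofPath (p : Pth V) : PathAlg k V := Finsupp.single p (1 : k)

open Classical in
/-- The product of two paths in the path algebra: their concatenation if the first one ends where
the second one starts, and `0` otherwise. -/
def concat (p q : Pth V) : PathAlg k V :=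
  if h : p.2.1 = q.1 then ofPath k ⟨p.1, q.2.1, p.2.2.comp (q.2.2.cast h.symm rfl)⟩ else 0

variable (V)

/-- The bilinear extension of the concatenation of paths. -/
def mulLin : PathAlg k V →ₗ[k] PathAlg k V →ₗ[k] PathAlg k V :=
  Finsupp.linearCombination k fun p : Pth V =>
    (Finsupp.linearCombination k fun q : Pth V => concat k p q :
      (Pth V →₀ k) →ₗ[k] PathAlg k V)

instance : Mul (PathAlg k V) := ⟨fun x y => mulLin k V x y⟩

variable {k V}

theorem mul_def (x y : PathAlg k V) : x * y = mulLin k V x y := rfl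

theorem ofPath_mul_ofPath (p q : Pth V) : ofPath k p * ofPath k q = concat k p q := by
  rw [mul_def, mulLin, ofPath, ofPath]
  erw [Finsupp.linearCombination_single, one_smul, Finsupp.linearCombination_single, one_smul]

theorem concat_mk {a b c : V} (p : Quiver.Path a b) (q : Quiver.Path b c) :
    concat k ⟨a, b, p⟩ ⟨b, c, q⟩ = ofPath k ⟨a, c, p.comp q⟩ := by
  simp [concat]

theorem concat_ne (p q : Pth V) (h : p.2.1 ≠ q.1) : concat k p q = 0 := by
  simp [concat, h]

theorem lhom_ext {M : Type*} [AddCommGroup M] [Module k M] {f g : PathAlg k V →ₗ[k] M}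
    (h : ∀ p, f (ofPath k p) = g (ofPath k p)) : f = g :=
  Finsupp.lhom_ext' fun p => LinearMap.ext_ring (h p)

theorem ofPath_assoc (p q r : Pth V) :
    ofPath k p * ofPath k q * ofPath k r = ofPath k p * (ofPath k q * ofPath k r) := by
  obtain ⟨a, b, p⟩ := p
  obtain ⟨c, d, q⟩ := q
  obtain ⟨e, f, r⟩ := r
  have z1 : ∀ x : PathAlg k V, 0 * x = 0 := fun x => by simp [mul_def]
  have z2 : ∀ x : PathAlg k V, x * 0 = 0 := fun x => by simp [mul_def]
  by_cases h1 : b = c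
  · subst h1
    by_cases h2 : d = e
    · subst h2
      simp only [ofPath_mul_ofPath, concat_mk, Quiver.Path.comp_assoc]
    · rw [ofPath_mul_ofPath ⟨b, d, q⟩, concat_ne _ _ h2, z2, ofPath_mul_ofPath, concat_mk,
        ofPath_mul_ofPath, concat_ne _ _ h2]
  · rw [ofPath_mul_ofPath ⟨a, b, p⟩ ⟨c, d, q⟩, concat_ne _ _ h1, z1]
    by_cases h2 : d = e
    · subst h2
      rw [ofPath_mul_ofPath ⟨c, d, q⟩, concat_mk, ofPath_mul_ofPath, concat_ne _ _ h1]
    · rw [ofPath_mul_ofPath ⟨c, d, q⟩, concat_ne _ _ h2, z2]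

variable [Fintype V]

/-- The unit of the path algebra is the sum of all vertices. -/
instance : One (PathAlg k V) := ⟨∑ a : V, ofPath k (vtx a)⟩

theorem one_def : (1 : PathAlg k V) = ∑ a : V, ofPath k (vtx a) := rfl

theorem one_mul_ofPath (p : Pth V) : (1 : PathAlg k V) * ofPath k p = ofPath k p := by
  classical
  obtain ⟨a, b, p⟩ := p
  rw [one_def, mul_def, map_sum, LinearMap.sum_apply, Finset.sum_eq_single a]
  · rw [← mul_def, ofPath_mul_ofPath, vtx, concat_mk, Quiver.Path.nil_comp]
  · intro c _ hc
    rw [← mul_def, ofPath_mul_ofPath, concat_ne _ _ hc]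
  · simp

theorem ofPath_mul_one (p : Pth V) : ofPath k p * (1 : PathAlg k V) = ofPath k p := by
  classical
  obtain ⟨a, b, p⟩ := p
  rw [one_def, mul_def, map_sum, Finset.sum_eq_single b]
  · rw [← mul_def, ofPath_mul_ofPath, vtx, concat_mk, Quiver.Path.comp_nil]
  · intro c _ hc
    rw [← mul_def, ofPath_mul_ofPath, concat_ne _ _ (Ne.symm hc)]
  · simp

instance : Ring (PathAlg k V) :=
  { (inferInstance : AddCommGroup (PathAlg k V)),
    (inferInstance : Mul (PathAlg k V)), (inferInstance : One (PathAlg k V)) with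
    left_distrib := fun x y z => by simp [mul_def]
    right_distrib := fun x y z => by simp [mul_def]
    zero_mul := fun x => by simp [mul_def]
    mul_zero := fun x => by simp [mul_def]
    one_mul := fun x => by
      have : mulLin k V 1 = LinearMap.id := lhom_ext fun p => one_mul_ofPath p
      exact LinearMap.congr_fun this x
    mul_one := fun x => by
      have : (mulLin k V).flip 1 = LinearMap.id := lhom_ext fun p => ofPath_mul_one p
      exact LinearMap.congr_fun this x
    mul_assoc := fun x y z => by
      have h : (mulLin k V).compr₂ (mulLin k V) =
          (LinearMap.llcomp k (PathAlg k V) (PathAlg k V) (PathAlg k V) ∘ₗ mulLin k V).compl₂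
            (mulLin k V) := by
        refine lhom_ext fun p => lhom_ext fun q => lhom_ext fun r => ?_
        exact ofPath_assoc p q r
      exact LinearMap.congr_fun (LinearMap.congr_fun (LinearMap.congr_fun h x) y) z }

instance : Algebra k (PathAlg k V) :=
  Algebra.ofModule (fun r x y => by simp [mul_def]) (fun r x y => by simp [mul_def])

end Algebra

/-! ### The truncated quiver algebra -/

section Truncated

variable (k : Type u) [Field k] (V : Type v) [Quiver.{w} V] [Fintype V] (N : ℕ)

/-- The two-sided ideal `I` of the path algebra generated by the arrows. -/
def arrowIdeal : Ideal (PathAlg k V) :=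
  TwoSidedIdeal.asIdeal (TwoSidedIdeal.span {x | ∃ p : Pth V, len p = 1 ∧ x = ofPath k p})

instance : (arrowIdeal k V).IsTwoSided := by
  unfold arrowIdeal; infer_instance

/-- The truncated quiver algebra `A = kΔ / I ^ N`. -/
def TQA : Type (max u v w) := PathAlg k V ⧸ (arrowIdeal k V) ^ N

instance : Ring (TQA k V N) := inferInstanceAs (Ring (PathAlg k V ⧸ (arrowIdeal k V) ^ N))
instance : Algebra k (TQA k V N) :=
  inferInstanceAs (Algebra k (PathAlg k V ⧸ (arrowIdeal k V) ^ N))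

/-- The projection `kΔ → A`. -/
def toA : PathAlg k V →ₐ[k] TQA k V N := Ideal.Quotient.mkₐ k ((arrowIdeal k V) ^ N)

variable {V}

/-- The class in `A` of a path. -/
def pa (p : Pth V) : TQA k V N := toA k V N (ofPath k p)

variable (V)

/-- The enveloping algebra `A ⊗ Aᵒᵖ`.  Its left modules are the `A`-bimodules (over `k`), with
`(a ⊗ b) • m = a m b`. -/
abbrev Env : Type (max u v w) := TQA k V N ⊗[k] (TQA k V N)ᵐᵒᵖ

/-- `A` as a bimodule over itself. -/
instance : Module (Env k V N) (TQA k V N) := TensorProduct.Algebra.module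

variable {k V N}

theorem env_smul (a b x : TQA k V N) :
    ((a ⊗ₜ[k] MulOpposite.op b : Env k V N) • x) = a * x * b := by
  change TensorProduct.Algebra.moduleAux _ _ = _
  simp [TensorProduct.Algebra.moduleAux, ← mul_assoc]

variable (k V N)

/-- The space `kΔ_m` spanned by the paths of length `m`; in particular `gr k V 0` is `kΔ_0`. -/
def gr (m : ℕ) : Submodule k (PathAlg k V) := Finsupp.supported k k {p : Pth V | len p = m}

variable {V}

/-- The component in `kΔ_m` of a path: the path itself if its length is `m` (the case which is
used), and `0` otherwise. -/
def inGr (m : ℕ) (p : Pth V) : gr k V m :=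
  if h : len p = m then ⟨ofPath k p, Finsupp.single_mem_supported k 1 h⟩ else 0

variable (V)

/-- The ideal `A_+` of `A`, spanned by the paths of positive length (those of length at least `N`
are zero in `A`). -/
def Aplus : Submodule k (TQA k V N) :=
  Submodule.span k {x | ∃ p : Pth V, 1 ≤ len p ∧ x = pa k N p}

variable {k V N}

theorem Aplus_mul_mem {x y : TQA k V N} (hx : x ∈ Aplus k V N) (hy : y ∈ Aplus k V N) :
    x * y ∈ Aplus k V N := by
  induction hx using Submodule.span_induction with
  | zero => simp
  | add a b _ _ ha hb => rw [add_mul]; exact add_mem ha hb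
  | smul r a _ ha => rw [smul_mul_assoc]; exact Submodule.smul_mem _ r ha
  | mem x hx =>
    induction hy using Submodule.span_induction with
    | zero => simp
    | add a b _ _ ha hb => rw [mul_add]; exact add_mem ha hb
    | smul r a _ ha => rw [mul_smul_comm]; exact Submodule.smul_mem _ r ha
    | mem y hy =>
      obtain ⟨⟨a, b, p⟩, hp, rfl⟩ := hx
      obtain ⟨⟨c, d, q⟩, _, rfl⟩ := hy
      rw [pa, pa, ← map_mul, ofPath_mul_ofPath]
      by_cases h : b = c
      · subst h
        rw [concat_mk]
        refine Submodule.subset_span ⟨_, ?_, rfl⟩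
        simp only [len, Quiver.Path.length_comp] at hp ⊢
        omega
      · rw [concat_ne _ _ h, map_zero]
        exact zero_mem _

/-- The multiplication of the ideal `A_+`. -/
def mulPlus (x y : Aplus k V N) : Aplus k V N := ⟨x.1 * y.1, Aplus_mul_mem x.2 y.2⟩

variable (k N)

/-- A path of positive length, as an element of `A_+`; a vertex is sent to `0` (this case is not
used). -/
def pathPlus (p : Pth V) : Aplus k V N :=
  if h : 1 ≤ len p then ⟨pa k N p, Submodule.subset_span ⟨p, h, rfl⟩⟩ else 0

end Truncated

/-! ### The bimodules of the minimal resolution -/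

section P

variable (k : Type u) [Field k] (V : Type v) [Quiver.{w} V] [Fintype V] (N : ℕ)

/-- `k N` if `n = 2 k`, and `k N + 1` if `n = 2 k + 1`. -/
def mdeg (n : ℕ) : ℕ := n / 2 * N + n % 2

variable {k V N}

variable (k V N) in
/-- The bimodule `A ⊗_k kΔ_m ⊗_k A`, realized as the left `A ⊗ Aᵒᵖ`-module
`(A ⊗_k Aᵒᵖ) ⊗_k kΔ_m`. -/
def TP (m : ℕ) : Type (max u v w) := Env k V N ⊗[k] gr k V m

instance (m : ℕ) : AddCommGroup (TP k V N m) :=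
  inferInstanceAs (AddCommGroup (Env k V N ⊗[k] gr k V m))
instance (m : ℕ) : Module (Env k V N) (TP k V N m) :=
  inferInstanceAs (Module (Env k V N) (Env k V N ⊗[k] gr k V m))

/-- The elementary tensor `α ⊗ x ⊗ β` of `A ⊗_k kΔ_m ⊗_k A`. -/
def tP {m : ℕ} (α : TQA k V N) (x : gr k V m) (β : TQA k V N) : TP k V N m :=
  (α ⊗ₜ[k] MulOpposite.op β) ⊗ₜ[k] x

variable (k V N)

/-- The relations which turn tensor products over `k` into tensor products over `kΔ_0`:
`α c ⊗ x ⊗ β = α ⊗ c x ⊗ β` and `α ⊗ x c ⊗ β = α ⊗ x ⊗ c β` for `c ∈ kΔ_0`. -/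
def relP (m : ℕ) : Submodule (Env k V N) (TP k V N m) :=
  Submodule.span (Env k V N)
    ({t | ∃ (α β : TQA k V N) (c : PathAlg k V) (x y : gr k V m),
        c ∈ gr k V 0 ∧ (y : PathAlg k V) = c * (x : PathAlg k V) ∧
          t = tP (α * toA k V N c) x β - tP α y β} ∪
     {t | ∃ (α β : TQA k V N) (c : PathAlg k V) (x y : gr k V m),
        c ∈ gr k V 0 ∧ (y : PathAlg k V) = (x : PathAlg k V) * c ∧
          t = tP α y β - tP α x (toA k V N c * β)})

/-- The bimodule `P_n = A ⊗_{Δ_0} kΔ_m ⊗_{Δ_0} A`, where `m = k N` if `n = 2 k`, and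
`m = k N + 1` if `n = 2 k + 1`. -/
def P (n : ℕ) : Type (max u v w) := TP k V N (mdeg N n) ⧸ relP k V N (mdeg N n)

instance (n : ℕ) : AddCommGroup (P k V N n) :=
  inferInstanceAs (AddCommGroup (TP k V N (mdeg N n) ⧸ relP k V N (mdeg N n)))
instance (n : ℕ) : Module (Env k V N) (P k V N n) :=
  inferInstanceAs (Module (Env k V N) (TP k V N (mdeg N n) ⧸ relP k V N (mdeg N n)))

variable {k V N}

variable (k V N) in
/-- The projection `A ⊗_k kΔ_m ⊗_k A → P_n`. -/
def projP (n : ℕ) : TP k V N (mdeg N n) →ₗ[Env k V N] P k V N n :=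
  (relP k V N (mdeg N n)).mkQ

/-- The element `α ⊗ x ⊗ β` of `P_n`. -/
def elemP (n : ℕ) (α : TQA k V N) (x : gr k V (mdeg N n)) (β : TQA k V N) : P k V N n :=
  projP k V N n (tP α x β)

end P

/-! ### The bimodules of the reduced bar resolution -/

section Q

variable (k : Type u) [Field k] (V : Type v) [Quiver.{w} V] [Fintype V] (N : ℕ)

/-- The bimodule `A ⊗_k A_+ ⊗_k … ⊗_k A_+ ⊗_k A` with `n` factors `A_+`, realized as the left
`A ⊗ Aᵒᵖ`-module `(A ⊗_k Aᵒᵖ) ⊗_k (A_+ ⊗_k … ⊗_k A_+)`. -/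
def TQ (n : ℕ) : Type (max u v w) := Env k V N ⊗[k] (⨂[k] _ : Fin n, Aplus k V N)

instance (n : ℕ) : AddCommGroup (TQ k V N n) :=
  inferInstanceAs (AddCommGroup (Env k V N ⊗[k] (⨂[k] _ : Fin n, Aplus k V N)))
instance (n : ℕ) : Module (Env k V N) (TQ k V N n) :=
  inferInstanceAs (Module (Env k V N) (Env k V N ⊗[k] (⨂[k] _ : Fin n, Aplus k V N)))

variable {k V N}

/-- The elementary tensor `α ⊗ a_1 ⊗ … ⊗ a_n ⊗ β` of `A ⊗_k A_+ ⊗_k … ⊗_k A_+ ⊗_k A`. -/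
def tQ {n : ℕ} (α : TQA k V N) (a : Fin n → Aplus k V N) (β : TQA k V N) : TQ k V N n :=
  (α ⊗ₜ[k] MulOpposite.op β) ⊗ₜ[k] PiTensorProduct.tprod k a

/-- The sequence `(α, a_1, …, a_n, β)` of elements of `A`. -/
def fullSeq {n : ℕ} (α : TQA k V N) (a : Fin n → Aplus k V N) (β : TQA k V N) :
    Fin (n + 2) → TQA k V N :=
  Fin.cons α (Fin.snoc (fun i => (a i : TQA k V N)) β : Fin (n + 1) → TQA k V N)

variable (k V N)

/-- The relations which turn tensor products over `k` into tensor products over `kΔ_0`: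
`… ⊗ s_i c ⊗ s_{i+1} ⊗ … = … ⊗ s_i ⊗ c s_{i+1} ⊗ …` for `c ∈ kΔ_0`, in each of the `n + 1`
positions. -/
def relQ (n : ℕ) : Submodule (Env k V N) (TQ k V N n) :=
  Submodule.span (Env k V N)
    {t | ∃ (α α' β β' : TQA k V N) (a a' : Fin n → Aplus k V N) (s : Fin (n + 2) → TQA k V N)
        (i : Fin (n + 1)) (c : PathAlg k V), c ∈ gr k V 0 ∧
        fullSeq α a β = Function.update s i.castSucc (s i.castSucc * toA k V N c) ∧
        fullSeq α' a' β' = Function.update s i.succ (toA k V N c * s i.succ) ∧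
        t = tQ α a β - tQ α' a' β'}

/-- The bimodule `Q_n = A ⊗_{Δ_0} A_+ ⊗_{Δ_0} … ⊗_{Δ_0} A_+ ⊗_{Δ_0} A`, with `n` factors
`A_+`. -/
def Q (n : ℕ) : Type (max u v w) := TQ k V N n ⧸ relQ k V N n

instance (n : ℕ) : AddCommGroup (Q k V N n) :=
  inferInstanceAs (AddCommGroup (TQ k V N n ⧸ relQ k V N n))
instance (n : ℕ) : Module (Env k V N) (Q k V N n) :=
  inferInstanceAs (Module (Env k V N) (TQ k V N n ⧸ relQ k V N n))

variable {k V N}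

variable (k V N) in
/-- The projection `A ⊗_k A_+ ⊗_k … ⊗_k A_+ ⊗_k A → Q_n`. -/
def projQ (n : ℕ) : TQ k V N n →ₗ[Env k V N] Q k V N n :=
  (relQ k V N n).mkQ

/-- The element `α[a_1|…|a_n]β` of `Q_n`. -/
def elemQ {n : ℕ} (α : TQA k V N) (a : Fin n → Aplus k V N) (β : TQA k V N) : Q k V N n :=
  projQ k V N n (tQ α a β)

end Q

/-! ### Bimodule extension of a map defined on generators -/

open Classical in
/-- The `R`-linear extension of the map `g i ↦ y i`, for a family `g` of generators of the module
`M`, provided that there is one (otherwise the zero map). -/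
def linExt {R ι M M' : Type*} [Ring R] [AddCommGroup M] [Module R M] [AddCommGroup M'] [Module R M']
    (g : ι → M) (y : ι → M') : M →ₗ[R] M' :=
  if h : ∃ f : M →ₗ[R] M', ∀ i, f (g i) = y i then h.choose else 0

/-! ### Differentials, augmentations and the maps `F` and `G` -/

section Maps

variable (k : Type u) [Field k] (V : Type v) [Quiver.{w} V] [Fintype V] (N : ℕ)

variable {V}

/-- The value of `d_{n+1}` on `α ⊗ p ⊗ β`, for a path `p = v_1 … v_M`, `M = mdeg N (n+1)`. With
`m = mdeg N n` and `c_j = α v_1 … v_j ⊗ v_{j+1} … v_{j+m} ⊗ v_{j+m+1} … v_M β`, it is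
`c_0 + … + c_{N-1}` if `n + 1` is even, and `c_1 - c_0` if `n + 1` is odd. -/
def dVal (n : ℕ) (α : TQA k V N) (p : Pth V) (β : TQA k V N) : P k V N n :=
  let c : ℕ → P k V N n := fun j =>
    elemP n (α * pa k N (seg p 0 j)) (inGr k (mdeg N n) (seg p j (mdeg N n)))
      (pa k N (rest p (j + mdeg N n)) * β)
  if Even (n + 1) then ∑ j ∈ Finset.range N, c j else c 1 - c 0

/-- The value of `b_{n+1}` on `α[a_1|…|a_{n+1}]β`. -/
def bVal (n : ℕ) (α : TQA k V N) (a : Fin (n + 1) → Aplus k V N) (β : TQA k V N) : Q k V N n :=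
  elemQ (α * (a 0 : TQA k V N)) (Fin.tail a) β
    + ∑ i : Fin n, (-1 : ℤ) ^ ((i : ℕ) + 1) • elemQ α (Fin.contractNth i.castSucc mulPlus a) β
    + (-1 : ℤ) ^ (n + 1) • elemQ α (Fin.init a) ((a (Fin.last n) : TQA k V N) * β)

variable (V)

/-- The differential `d_{n+1} : P_{n+1} → P_n`. -/
def d (n : ℕ) : P k V N (n + 1) →ₗ[Env k V N] P k V N n :=
  linExt
    (fun t : TQA k V N × {p : Pth V // len p = mdeg N (n + 1)} × TQA k V N =>
      elemP (n + 1) t.1 (inGr k (mdeg N (n + 1)) t.2.1.1) t.2.2)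
    (fun t => dVal k N n t.1 t.2.1.1 t.2.2)

/-- The augmentation `P_0 = A ⊗_{Δ_0} kΔ_0 ⊗_{Δ_0} A → A`. -/
def epsP : P k V N 0 →ₗ[Env k V N] TQA k V N :=
  linExt
    (fun t : TQA k V N × gr k V (mdeg N 0) × TQA k V N => elemP 0 t.1 t.2.1 t.2.2)
    (fun t => t.1 * toA k V N (t.2.1 : PathAlg k V) * t.2.2)

/-- The differential `b_{n+1} : Q_{n+1} → Q_n`. -/
def b (n : ℕ) : Q k V N (n + 1) →ₗ[Env k V N] Q k V N n :=
  linExt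
    (fun t : TQA k V N × (Fin (n + 1) → Aplus k V N) × TQA k V N => elemQ t.1 t.2.1 t.2.2)
    (fun t => bVal k N n t.1 t.2.1 t.2.2)

/-- The augmentation `Q_0 = A ⊗_{Δ_0} A → A`. -/
def epsQ : Q k V N 0 →ₗ[Env k V N] TQA k V N :=
  linExt
    (fun t : TQA k V N × (Fin 0 → Aplus k V N) × TQA k V N => elemQ t.1 t.2.1 t.2.2)
    (fun t => t.1 * t.2.2)

variable {V}

/-- For `p = v_1 … v_m` and lengths `c_1, …, c_n`, the `n` consecutive subpaths of `p`, starting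
with `v_1`, of lengths `c_1, …, c_n`. -/
def pieces {n : ℕ} (p : Pth V) (c : Fin n → ℕ) : Fin n → Aplus k V N :=
  fun i => pathPlus k N (seg p (∑ j ∈ Finset.Iio i, c j) (c i))

/-- The composition `(x_1, 1, x_2, 1, …, x_k, 1)` if `n = 2 k`, and `(1, x_1, 1, …, x_k, 1)` if
`n = 2 k + 1`. -/
def parts (n : ℕ) (x : Fin (n / 2) → ℕ) : Fin n → ℕ :=
  fun i => if h : Even (n + (i : ℕ)) then
    x ⟨(i : ℕ) / 2, by rw [Nat.even_iff] at h; have := i.2; omega⟩ else 1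

/-- The value of `F_n` on `1 ⊗ p ⊗ 1`; the sum is over the tuples `x` with `1 ≤ x_i < N`. -/
def FVal (n : ℕ) (p : Pth V) : Q k V N n :=
  ∑ x ∈ Fintype.piFinset (fun _ : Fin (n / 2) => Finset.Ico 1 N),
    elemQ 1 (pieces k N p (parts n x)) (pa k N (rest p (∑ i, parts n x i)))

variable (V)

/-- The map `F_n : P_n → Q_n`. For `n = 0` it is the identification
`A ⊗_{Δ_0} kΔ_0 ⊗_{Δ_0} A = A ⊗_{Δ_0} A`. -/
def F (n : ℕ) : P k V N n →ₗ[Env k V N] Q k V N n :=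
  linExt
    (fun p : {p : Pth V // len p = mdeg N n} => elemP n 1 (inGr k (mdeg N n) p.1) 1)
    (fun p => FVal k N n p.1)

/-- A composable sequence of `n` paths `α_1, …, α_n` with `1 ≤ |α_i| < N`, given by the path
`α_1 … α_n` (a vertex, if `n = 0`) and the lengths `|α_i|`. -/
structure BarWord (n : ℕ) where
  /-- the path `α_1 … α_n` of the quiver -/
  path : Pth V
  /-- the lengths of the `α_i` -/
  lens : Fin n → ℕ
  one_le : ∀ i, 1 ≤ lens i
  lt : ∀ i, lens i < N
  sum_eq : ∑ i, lens i = len path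

variable {V}

/-- The generator `o(α_1)[α_1|…|α_n]t(α_n)` of `Q_n`, which is equal to `1[α_1|…|α_n]1` if
`n ≥ 1`. -/
def barGen {n : ℕ} (q : BarWord V N n) : Q k V N n :=
  elemQ (pa k N (vtx q.path.1)) (pieces k N q.path q.lens) (pa k N (vtx q.path.2.1))

open Classical in
/-- The value of `G_n` on `1[α_1|…|α_n]1`, where `α_1 … α_n = v_1 … v_L`. If `n = 2 k`, it is
`1 ⊗ v_1 … v_{kN} ⊗ v_{kN+1} … v_L` if `α_1 α_2 = α_3 α_4 = … = 0` in `A`, and `0` otherwise.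
If `n = 2 k + 1`, it is the sum of the
`v_1 … v_j ⊗ v_{j+1} … v_{j+kN+1} ⊗ v_{j+kN+2} … v_L` over `0 ≤ j < |α_1|` if
`α_2 α_3 = α_4 α_5 = … = 0` in `A`, and `0` otherwise. -/
def GVal (n : ℕ) (q : BarWord V N n) : P k V N n :=
  if ∀ (i : ℕ) (hi : i + 1 < n), i % 2 = n % 2 →
      (pieces k N q.path q.lens ⟨i, by omega⟩ : TQA k V N) *
        (pieces k N q.path q.lens ⟨i + 1, hi⟩ : TQA k V N) = 0 then
    if hn : Even n then
      elemP n 1 (inGr k (mdeg N n) (seg q.path 0 (mdeg N n))) (pa k N (rest q.path (mdeg N n)))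
    else
      ∑ j ∈ Finset.range (q.lens ⟨0, Nat.pos_of_ne_zero (by rintro rfl; exact hn Even.zero)⟩),
        elemP n (pa k N (seg q.path 0 j)) (inGr k (mdeg N n) (seg q.path j (mdeg N n)))
          (pa k N (rest q.path (j + mdeg N n)))
  else 0

variable (V)

/-- The map `G_n : Q_n → P_n`. For `n = 0` it is the identification
`A ⊗_{Δ_0} A = A ⊗_{Δ_0} kΔ_0 ⊗_{Δ_0} A`. -/
def G (n : ℕ) : Q k V N n →ₗ[Env k V N] P k V N n :=
  linExt (fun q : BarWord V N n => barGen k N q) (fun q => GVal k N n q)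

end Maps

/-! ### Projective resolutions and comparison morphisms -/

section Resolutions

variable {R : Type*} [Ring R] {A : Type*} [AddCommGroup A] [Module R A]

/-- `… → M_2 → M_1 → M_0 → A → 0`, with maps `δ n : M_{n+1} → M_n` and `ε : M_0 → A`, is a
projective resolution of the `R`-module `A`. -/
structure IsProjRes (M : ℕ → Type*) [∀ n, AddCommGroup (M n)] [∀ n, Module R (M n)]
    (δ : ∀ n, M (n + 1) →ₗ[R] M n) (ε : M 0 →ₗ[R] A) : Prop where
  projective : ∀ n, Module.Projective R (M n)
  exact : ∀ n, Function.Exact (δ (n + 1)) (δ n)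
  exact_zero : Function.Exact (δ 0) ε
  surjective : Function.Surjective ε

/-- The maps `f n : M_n → M'_n` are a comparison morphism between projective resolutions of `A`,
i.e. a morphism of chain complexes lifting the identity of `A`. -/
structure IsComparison {M M' : ℕ → Type*} [∀ n, AddCommGroup (M n)] [∀ n, Module R (M n)]
    [∀ n, AddCommGroup (M' n)] [∀ n, Module R (M' n)]
    (δ : ∀ n, M (n + 1) →ₗ[R] M n) (ε : M 0 →ₗ[R] A)
    (δ' : ∀ n, M' (n + 1) →ₗ[R] M' n) (ε' : M' 0 →ₗ[R] A)
    (f : ∀ n, M n →ₗ[R] M' n) : Prop where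
  source : IsProjRes M δ ε
  target : IsProjRes M' δ' ε'
  comm : ∀ n, δ' n ∘ₗ f (n + 1) = f n ∘ₗ δ n
  lifts_id : ε' ∘ₗ f 0 = ε

end Resolutions

end TruncQuiver

end

/-!
Both complexes, augmented by `ε`, are contractible over `k`, and all their bimodules are direct
sums of bimodules `A e ⊗ e' A`, where `e` and `e'` are vertices. Everything else follows from these
two facts.

*Freeness.* `P_n` is generated by the elements `1 ⊗ p ⊗ 1` (`isFreeBy_genP`), and `Q_n` by the words
of paths of positive length less than `N` (`isFreeBy_barGen`); the only relations are that such a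
generator is fixed by its end vertices. Hence these bimodules are projective, bimodule maps may be
prescribed on the generators as soon as the values have the same end vertices, and `k`-linear maps
may be prescribed on the elements `α g β`, where `g` is a generator and `α`, `β` are paths of length
less than `N` which are composable with it (`exists_linearMap_composables`).

*Homotopies.* For a path `w`, let `c_j` be the element of `P_n` whose left factor consists of the
first `j` arrows of `w`, and whose middle factor consists of the next ones (`cutP`). Then
`d c_j = c_{j+1} - c_j` in odd degrees and `d c_j = c_j + … + c_{j+N-1}` in even degrees, and
`c_j = 0` as soon as the left or the right factor has at least `N` arrows. A contracting homotopy
(`homotopyP`) is given by `c_j ↦ c_0 + … + c_{j-1}` on `P_n` for even `n`, and by `c_{N-1} ↦ c_0`,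
`c_j ↦ 0` for `j ≠ N - 1`, on `P_n` for odd `n`. On `Q` there is the usual contracting homotopy
`α[a_1|…|a_n]β ↦ 1[α|a_1|…|a_n]β`, where the component of `α` in `kΔ_0` is dropped (`homotopyQ`).
This makes `P` and `Q` projective resolutions (`isProjRes_P`, `isProjRes_Q`).

*Comparison maps.* A family of bimodule maps `f_n` which lifts the identity of `A`, and is given by
`f_{n+1} = h f_n δ` on the generators, is a morphism of complexes (`comm_of_homotopy`); here `h` is
a contracting homotopy of the target. Both `F` and `G` satisfy this recursion (`F_genP_succ`,
`G_barGen_succ`). For `F`, applying the homotopy of `Q` to `F_n c_j` puts the left factor of `c_j`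
in front as a new first entry, and this yields the sum over the possible first entries. For `G`, the
homotopy of `P` kills the values of `G_n` on all elements `1[a_1|…|a_n]β` (`homotopyP_G_elemQ_one`),
so that only the first term `α_1[α_2|…|α_{n+1}]1` of the bar differential contributes.
-/

open scoped TensorProduct

noncomputable section

namespace TruncQuiver

universe u v w

/-! ### Subpaths and concatenation of paths -/

section PathCalculus

variable {V : Type v} [Quiver.{w} V]

theorem takeP_comp {a b : V} (x : Quiver.Path a b) {c : V} (y : Quiver.Path b c) :
    takeP (x.comp y) x.length = ⟨a, b, x⟩ := by
  induction y with
  | nil => cases x <;> simp [takeP]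
  | cons y e ih =>
    rw [Quiver.Path.comp_cons, takeP, if_neg (by simp), ih]

theorem dropP_comp {a b : V} (x : Quiver.Path a b) {c : V} (y : Quiver.Path b c) :
    dropP (x.comp y) x.length = ⟨b, y⟩ := by
  induction y with
  | nil => cases x <;> simp [dropP]
  | cons y e ih =>
    rw [Quiver.Path.comp_cons, dropP, if_neg (by simp), ih]

theorem takeP_fst {a b : V} (p : Quiver.Path a b) (j : ℕ) : (takeP p j).1 = a := by
  induction p with
  | nil => rfl
  | cons p e ih => rw [takeP]; split_ifs <;> simp [ih]

/-- Subpaths are computed from any decomposition `x y z` of the path with `|x| = i` and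
`|y| = l`. -/
theorem seg_eq {w : Pth V} {a b c d : V} {x : Quiver.Path a b} {y : Quiver.Path b c}
    {z : Quiver.Path c d} (hw : w = ⟨a, d, x.comp (y.comp z)⟩) {i l : ℕ} (hi : x.length = i)
    (hl : y.length = l) : seg w i l = ⟨b, c, y⟩ := by
  subst hw hi hl
  simp only [seg]
  rw [dropP_comp x (y.comp z)]
  exact takeP_comp y z

theorem rest_eq {w : Pth V} {a b c : V} {x : Quiver.Path a b} {y : Quiver.Path b c}
    (hw : w = ⟨a, c, x.comp y⟩) {i : ℕ} (hi : x.length = i) : rest w i = ⟨b, c, y⟩ := by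
  subst hw hi
  simp only [rest]
  rw [dropP_comp x y]

theorem exists_split (w : Pth V) {i l : ℕ} (h : i + l ≤ len w) :
    ∃ (a b c d : V) (x : Quiver.Path a b) (y : Quiver.Path b c) (z : Quiver.Path c d),
      w = ⟨a, d, x.comp (y.comp z)⟩ ∧ x.length = i ∧ y.length = l := by
  obtain ⟨a, d, p⟩ := w
  obtain ⟨b, x, q, rfl, hx⟩ := p.exists_eq_comp_of_le_length (n := i) (le_trans (by omega) h)
  obtain ⟨c, y, z, rfl, hy⟩ := q.exists_eq_comp_of_le_length (n := l) (by
    simp only [len, Quiver.Path.length_comp] at h; omega)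
  exact ⟨a, b, c, d, x, y, z, rfl, hx, hy⟩

theorem exists_split₂ (w : Pth V) {i : ℕ} (h : i ≤ len w) :
    ∃ (a b c : V) (x : Quiver.Path a b) (y : Quiver.Path b c),
      w = ⟨a, c, x.comp y⟩ ∧ x.length = i := by
  obtain ⟨a, d, p⟩ := w
  obtain ⟨b, x, q, rfl, hx⟩ := p.exists_eq_comp_of_le_length (n := i) h
  exact ⟨a, b, d, x, q, rfl, hx⟩

theorem len_seg {w : Pth V} {i l : ℕ} (h : i + l ≤ len w) : len (seg w i l) = l := by
  obtain ⟨a, b, c, d, x, y, z, hw, hx, hy⟩ := exists_split w h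
  rw [seg_eq hw hx hy]; exact hy

theorem len_rest {w : Pth V} {i : ℕ} (h : i ≤ len w) : len (rest w i) = len w - i := by
  obtain ⟨a, b, c, x, y, hw, hx⟩ := exists_split₂ w h
  rw [rest_eq hw hx, hw]
  simp only [len, Quiver.Path.length_comp]; omega

theorem seg_src (w : Pth V) (i l : ℕ) : (seg w i l).1 = (rest w i).1 := takeP_fst _ _

theorem seg_tgt {w : Pth V} {i l : ℕ} (h : i + l ≤ len w) :
    (seg w i l).2.1 = (rest w (i + l)).1 := by
  obtain ⟨a, b, c, d, x, y, z, hw, hx, hy⟩ := exists_split w h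
  rw [seg_eq hw hx hy, rest_eq (x := x.comp y) (y := z) (by rw [hw, Quiver.Path.comp_assoc])
    (by rw [Quiver.Path.length_comp, hx, hy])]

theorem rest_tgt (w : Pth V) (i : ℕ) : (rest w i).2.1 = w.2.1 := rfl

theorem rest_zero (w : Pth V) : rest w 0 = w :=
  rest_eq (x := .nil) (y := w.2.2) (by rw [Quiver.Path.nil_comp]) rfl

theorem seg_zero_src (w : Pth V) (l : ℕ) : (seg w 0 l).1 = w.1 := by
  rw [seg_src, rest_zero]

theorem rest_len {w : Pth V} {i : ℕ} (h : len w = i) : rest w i = vtx w.2.1 :=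
  rest_eq (x := w.2.2) (y := .nil) (by rw [Quiver.Path.comp_nil]) h

theorem seg_full {w : Pth V} {l : ℕ} (h : len w = l) : seg w 0 l = w :=
  seg_eq (x := .nil) (y := w.2.2) (z := .nil)
    (by rw [Quiver.Path.comp_nil, Quiver.Path.nil_comp]) rfl h

theorem eq_vtx_of_len {w : Pth V} (h : len w = 0) : w = vtx w.1 := by
  obtain ⟨a, b, p⟩ := w
  cases p with
  | nil => rfl
  | cons p e => simp [len] at h

theorem seg_len_zero (w : Pth V) : seg w 0 0 = vtx w.1 := by
  have h := len_seg (w := w) (i := 0) (l := 0) (by simp)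
  rw [eq_vtx_of_len h, seg_zero_src]

theorem seg_seg {w : Pth V} {j m i l : ℕ} (hw : j + m ≤ len w) (h : i + l ≤ m) :
    seg (seg w j m) i l = seg w (j + i) l := by
  obtain ⟨a, b, c, d, x, y, z, hw, hx, hy⟩ := exists_split w hw
  obtain ⟨b', e, f, c', y₁, y₂, y₃, hw', hy₁, hy₂⟩ := exists_split ⟨b, c, y⟩
    (i := i) (l := l) (by rw [len, hy]; exact h)
  have hb := congrArg Sigma.fst hw'
  dsimp only at hb; subst hb
  simp only [Sigma.mk.injEq, heq_eq_eq, true_and] at hw'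
  obtain ⟨hc, hw'⟩ := hw'
  subst hc
  rw [heq_eq_eq] at hw'
  rw [seg_eq hw hx hy, seg_eq (x := y₁) (y := y₂) (z := y₃) (by rw [hw']) hy₁ hy₂,
    seg_eq (x := x.comp y₁) (y := y₂) (z := y₃.comp z) (by rw [hw, hw']; simp)
      (by simp [hx, hy₁]) hy₂]

theorem rest_rest {w : Pth V} {i j : ℕ} (h : j + i ≤ len w) :
    rest (rest w j) i = rest w (j + i) := by
  obtain ⟨a, b, c, d, x, y, z, hw, hx, hy⟩ := exists_split w h
  rw [rest_eq hw hx, rest_eq rfl hy, rest_eq (x := x.comp y) (y := z) (by rw [hw]; simp)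
    (by simp [hx, hy])]

theorem rest_eq_seg {w : Pth V} {i : ℕ} (h : i ≤ len w) :
    rest w i = seg w i (len w - i) := by
  obtain ⟨a, b, c, x, y, hw, hx⟩ := exists_split₂ w h
  rw [rest_eq hw hx, seg_eq (x := x) (y := y) (z := .nil) (by rw [hw]; simp) hx]
  rw [hw]; simp only [len, Quiver.Path.length_comp]; omega

theorem seg_rest {w : Pth V} {i j l : ℕ} (h : j + i + l ≤ len w) :
    seg (rest w j) i l = seg w (j + i) l := by
  rw [rest_eq_seg (by omega), seg_seg (by omega) (by omega)]

theorem rest_seg {w : Pth V} {i j m : ℕ} (h : j + m ≤ len w) (hi : i ≤ m) :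
    rest (seg w j m) i = seg w (j + i) (m - i) := by
  rw [rest_eq_seg (by rw [len_seg h]; exact hi), seg_seg h (by rw [len_seg h]; omega), len_seg h]

open Classical in
/-- The concatenation of two paths if the first one ends where the second one starts; otherwise
the junk value is the first path. -/
def joinP (p q : Pth V) : Pth V :=
  if h : p.2.1 = q.1 then ⟨p.1, q.2.1, p.2.2.comp (q.2.2.cast h.symm rfl)⟩ else p

theorem joinP_mk {a b c : V} (p : Quiver.Path a b) (q : Quiver.Path b c) :
    joinP ⟨a, b, p⟩ ⟨b, c, q⟩ = ⟨a, c, p.comp q⟩ := by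
  simp [joinP]

theorem joinP_src (p q : Pth V) : (joinP p q).1 = p.1 := by
  rw [joinP]; split_ifs <;> rfl

theorem joinP_tgt {p q : Pth V} (h : p.2.1 = q.1) : (joinP p q).2.1 = q.2.1 := by
  rw [joinP, dif_pos h]

theorem len_joinP {p q : Pth V} (h : p.2.1 = q.1) : len (joinP p q) = len p + len q := by
  obtain ⟨a, b, p⟩ := p
  obtain ⟨c, d, q⟩ := q
  obtain rfl : b = c := h
  rw [joinP_mk]; simp [len]

theorem joinP_assoc {p q r : Pth V} (h : p.2.1 = q.1) (h' : q.2.1 = r.1) :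
    joinP (joinP p q) r = joinP p (joinP q r) := by
  obtain ⟨a, b, p⟩ := p
  obtain ⟨c, d, q⟩ := q
  obtain ⟨e, f, r⟩ := r
  obtain rfl : b = c := h
  obtain rfl : d = e := h'
  simp only [joinP_mk, Quiver.Path.comp_assoc]

theorem seg_joinP_left {p q : Pth V} (h : p.2.1 = q.1) : seg (joinP p q) 0 (len p) = p := by
  obtain ⟨a, b, p⟩ := p
  obtain ⟨c, d, q⟩ := q
  obtain rfl : b = c := h
  rw [joinP_mk]
  exact seg_eq (x := .nil) (y := p) (z := q) (by simp) rfl rfl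

theorem rest_joinP {p q : Pth V} (h : p.2.1 = q.1) : rest (joinP p q) (len p) = q := by
  obtain ⟨a, b, p⟩ := p
  obtain ⟨c, d, q⟩ := q
  obtain rfl : b = c := h
  rw [joinP_mk]
  exact rest_eq (x := p) (y := q) rfl rfl

theorem joinP_seg_seg {w : Pth V} {i l l' : ℕ} (h : i + l + l' ≤ len w) :
    joinP (seg w i l) (seg w (i + l) l') = seg w i (l + l') := by
  obtain ⟨a, b, c, d, x, y, z, hw, hx, hy⟩ := exists_split w (i := i) (l := l + l') (by omega)
  obtain ⟨e, y₁, y₂, rfl, hy₁⟩ := y.exists_eq_comp_of_le_length (n := l) (by omega)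
  rw [seg_eq hw hx hy, seg_eq (x := x) (y := y₁) (z := y₂.comp z) (by simp [hw]) hx hy₁,
    seg_eq (x := x.comp y₁) (y := y₂) (z := z) (by simp [hw]) (by simp [hx, hy₁])
      (by simp at hy; omega), joinP_mk]

theorem joinP_seg_rest {w : Pth V} {i l : ℕ} (h : i + l ≤ len w) :
    joinP (seg w i l) (rest w (i + l)) = rest w i := by
  rw [rest_eq_seg h, joinP_seg_seg (by omega), rest_eq_seg (by omega)]
  congr 1; omega

end PathCalculus

/-! ### Monomial bases of the truncated quiver algebra and of its radical -/

section TruncatedAlgebra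

variable {k : Type u} [Field k] {V : Type v} [Quiver.{w} V]

theorem ofPath_mul_of_eq {p q : Pth V} (h : p.2.1 = q.1) :
    ofPath k p * ofPath k q = ofPath k (joinP p q) := by
  rw [ofPath_mul_ofPath, concat, dif_pos h, joinP, dif_pos h]

theorem ofPath_mul_of_ne {p q : Pth V} (h : p.2.1 ≠ q.1) : ofPath k p * ofPath k q = 0 := by
  rw [ofPath_mul_ofPath, concat_ne _ _ h]

variable (k) in
/-- The span of a set of paths, as a subspace of the path algebra. -/
def pathSpan (s : Set (Pth V)) : Submodule k (PathAlg k V) :=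
  Submodule.span k (ofPath k '' s)

theorem pathSpan_eq_supported (s : Set (Pth V)) :
    pathSpan k s = (Finsupp.supported k k s : Submodule k (PathAlg k V)) :=
  (Finsupp.supported_eq_span_single k s).symm

theorem ofPath_mem_pathSpan {s : Set (Pth V)} {p : Pth V} (h : p ∈ s) :
    ofPath k p ∈ pathSpan k s :=
  Submodule.subset_span ⟨p, h, rfl⟩

theorem pathSpan_univ : pathSpan k (Set.univ : Set (Pth V)) = ⊤ := by
  rw [pathSpan_eq_supported]
  exact Finsupp.supported_univ

/-- The span of the paths of length at least `n`, as a subspace of the path algebra. -/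
def longPaths (k : Type u) [Field k] (V : Type v) [Quiver.{w} V] (n : ℕ) :
    Submodule k (PathAlg k V) :=
  pathSpan k {p : Pth V | n ≤ len p}

theorem ofPath_mem_longPaths {n : ℕ} {p : Pth V} (h : n ≤ len p) :
    ofPath k p ∈ longPaths k V n :=
  ofPath_mem_pathSpan h

theorem longPaths_zero : longPaths k V 0 = ⊤ := by
  rw [← pathSpan_univ, longPaths]
  congr 1
  exact Set.eq_univ_of_forall fun p => Nat.zero_le _

theorem mem_longPaths_zero (x : PathAlg k V) : x ∈ longPaths k V 0 := by
  rw [longPaths_zero]; trivial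

variable [Fintype V]

theorem gr_eq_pathSpan (m : ℕ) : gr k V m = pathSpan k {p : Pth V | len p = m} :=
  (pathSpan_eq_supported _).symm

theorem mul_mem_pathSpan {s t r : Set (Pth V)}
    (H : ∀ p ∈ s, ∀ q ∈ t, p.2.1 = q.1 → joinP p q ∈ r) {x y : PathAlg k V}
    (hx : x ∈ pathSpan k s)
    (hy : y ∈ pathSpan k t) :
    x * y ∈ pathSpan k r := by
  induction hx using Submodule.span_induction with
  | zero => rw [zero_mul]; exact Submodule.zero_mem _
  | add a b _ _ ha hb => rw [add_mul]; exact add_mem ha hb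
  | smul c a _ ha => rw [smul_mul_assoc]; exact Submodule.smul_mem _ c ha
  | mem x hx =>
    induction hy using Submodule.span_induction with
    | zero => rw [mul_zero]; exact Submodule.zero_mem _
    | add a b _ _ ha hb => rw [mul_add]; exact add_mem ha hb
    | smul c a _ ha => rw [mul_smul_comm]; exact Submodule.smul_mem _ c ha
    | mem y hy =>
      obtain ⟨p, hp, rfl⟩ := hx
      obtain ⟨q, hq, rfl⟩ := hy
      by_cases h : p.2.1 = q.1
      · rw [ofPath_mul_of_eq h]
        exact ofPath_mem_pathSpan (H p hp q hq h)
      · rw [ofPath_mul_of_ne h]; exact Submodule.zero_mem _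

theorem longPaths_mul_mem {m n : ℕ} {x y : PathAlg k V} (hx : x ∈ longPaths k V m)
    (hy : y ∈ longPaths k V n) : x * y ∈ longPaths k V (m + n) := by
  refine mul_mem_pathSpan (fun p hp q hq h => ?_) hx hy
  simp only [Set.mem_ofPred_eq] at hp hq ⊢
  rw [len_joinP h]; omega

theorem mul_mem_longPaths_left {n : ℕ} (x : PathAlg k V) {y : PathAlg k V}
    (hy : y ∈ longPaths k V n) : x * y ∈ longPaths k V n := by
  simpa using longPaths_mul_mem (mem_longPaths_zero x) hy

theorem mul_mem_longPaths_right {n : ℕ} {x : PathAlg k V} (y : PathAlg k V)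
    (hx : x ∈ longPaths k V n) : x * y ∈ longPaths k V n := by
  simpa using longPaths_mul_mem hx (mem_longPaths_zero y)

theorem arrowIdeal_le {x : PathAlg k V} (hx : x ∈ arrowIdeal k V) : x ∈ longPaths k V 1 := by
  rw [arrowIdeal, TwoSidedIdeal.mem_asIdeal] at hx
  induction hx using TwoSidedIdeal.span_induction with
  | mem x hx => obtain ⟨p, hp, rfl⟩ := hx; exact ofPath_mem_longPaths hp.ge
  | zero => exact zero_mem _
  | add x y _ _ hx hy => exact add_mem hx hy
  | neg x _ hx => exact neg_mem hx
  | left_absorb a x _ hx => exact mul_mem_longPaths_left a hx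
  | right_absorb a x _ hx => exact mul_mem_longPaths_right a hx

theorem ofPath_mem_arrowIdeal {p : Pth V} (hp : 1 ≤ len p) : ofPath k p ∈ arrowIdeal k V := by
  rw [← rest_zero p, ← joinP_seg_rest (w := p) (i := 0) (l := 1) (by omega),
    ← ofPath_mul_of_eq (by rw [seg_tgt (by omega)])]
  refine Ideal.IsTwoSided.mul_mem_of_left _ ?_
  rw [arrowIdeal, TwoSidedIdeal.mem_asIdeal]
  exact TwoSidedIdeal.subset_span ⟨_, len_seg (by omega), rfl⟩

theorem ofPath_mem_arrowIdeal_pow {n : ℕ} {p : Pth V} (hp : n ≤ len p) :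
    ofPath k p ∈ arrowIdeal k V ^ n := by
  induction n generalizing p with
  | zero => rw [Submodule.pow_zero, Ideal.one_eq_top]; trivial
  | succ n ih =>
    rw [Submodule.pow_succ, ← rest_zero p, ← joinP_seg_rest (w := p) (i := 0) (l := n) (by omega),
      ← ofPath_mul_of_eq (by rw [seg_tgt (by omega)])]
    refine Ideal.mul_mem_mul (ih ?_) (ofPath_mem_arrowIdeal ?_)
    · rw [len_seg (by omega)]
    · rw [len_rest (by omega)]; omega

/-- The power `I ^ n` of the arrow ideal is spanned by the paths of length at least `n`. -/
theorem mem_arrowIdeal_pow {n : ℕ} {x : PathAlg k V} :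
    x ∈ arrowIdeal k V ^ n ↔ x ∈ longPaths k V n := by
  constructor
  · intro hx
    induction n generalizing x with
    | zero => exact mem_longPaths_zero x
    | succ n ih =>
      rw [Submodule.pow_succ] at hx
      let K : Ideal (PathAlg k V) :=
        { (longPaths k V (n + 1)).toAddSubmonoid with
          smul_mem' := fun c x hx => mul_mem_longPaths_left c hx }
      have : arrowIdeal k V ^ n * arrowIdeal k V ≤ K :=
        Ideal.mul_le.2 fun r hr s hs => longPaths_mul_mem (ih hr) (arrowIdeal_le hs)
      exact this hx
  · intro hx
    rw [longPaths, pathSpan] at hx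
    have : Submodule.span k (ofPath k '' {p : Pth V | n ≤ len p}) ≤
        (arrowIdeal k V ^ n).restrictScalars k := by
      rw [Submodule.span_le]
      rintro _ ⟨p, hp, rfl⟩
      exact ofPath_mem_arrowIdeal_pow hp
    exact this hx

variable {N : ℕ}

theorem toA_eq_zero {x : PathAlg k V} : toA k V N x = 0 ↔ x ∈ longPaths k V N := by
  rw [← mem_arrowIdeal_pow]
  exact Ideal.Quotient.eq_zero_iff_mem

theorem pa_eq_zero {p : Pth V} (h : N ≤ len p) : pa k N p = 0 :=
  toA_eq_zero.2 (ofPath_mem_longPaths h)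

theorem pa_mul {p q : Pth V} (h : p.2.1 = q.1) : pa k N p * pa k N q = pa k N (joinP p q) := by
  rw [pa, pa, ← map_mul, ofPath_mul_of_eq h, pa]

theorem pa_mul_of_ne {p q : Pth V} (h : p.2.1 ≠ q.1) : pa k N p * pa k N q = 0 := by
  rw [pa, pa, ← map_mul, ofPath_mul_of_ne h, map_zero]

theorem vtx_mul {p : Pth V} {a : V} (h : p.1 = a) : pa k N (vtx a) * pa k N p = pa k N p := by
  obtain ⟨c, d, p⟩ := p
  obtain rfl : c = a := h
  rw [pa_mul (by rfl), vtx, joinP_mk, Quiver.Path.nil_comp]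

theorem mul_vtx {p : Pth V} {a : V} (h : p.2.1 = a) : pa k N p * pa k N (vtx a) = pa k N p := by
  obtain ⟨c, d, p⟩ := p
  obtain rfl : d = a := h
  rw [pa_mul (by rfl), vtx, joinP_mk, Quiver.Path.comp_nil]

theorem vtx_mul_vtx (a : V) : pa k N (vtx a) * pa k N (vtx a) = pa k N (vtx a) := vtx_mul rfl

theorem one_eq_sum_vtx : (1 : TQA k V N) = ∑ a : V, pa k N (vtx a) := by
  rw [← map_one (toA k V N), one_def, map_sum]; rfl

theorem linearIndependent_pa :
    LinearIndependent k fun p : {p : Pth V // len p < N} => pa k N p.1 := by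
  have h1 : LinearIndependent k fun p : {p : Pth V // len p < N} => (ofPath k p.1 : PathAlg k V) :=
    (Finsupp.linearIndependent_single_one k (Pth V)).comp _ Subtype.val_injective
  refine h1.map (f := (toA k V N).toLinearMap) ?_
  rw [Submodule.disjoint_def]
  intro x hx hx'
  have hx' : x ∈ longPaths k V N := toA_eq_zero.1 hx'
  have hr : Set.range (fun p : {p : Pth V // len p < N} => (ofPath k p.1 : PathAlg k V)) =
      ofPath k '' {p : Pth V | len p < N} := by
    ext y; simp
  rw [hr] at hx
  have hx := (pathSpan_eq_supported (k := k) {p : Pth V | len p < N}).le hx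
  have hx' := (pathSpan_eq_supported (k := k) {p : Pth V | N ≤ len p}).le hx'
  have hd : Disjoint (Finsupp.supported k k {p : Pth V | len p < N})
      (Finsupp.supported k k {p : Pth V | N ≤ len p}) := by
    rw [Finsupp.disjoint_supported_supported_iff, Set.disjoint_left]
    intro p hp hp'
    exact absurd (show len p < N from hp) (not_lt.2 hp')
  exact (Submodule.disjoint_def.1 hd) x hx hx'

theorem toA_surjective : Function.Surjective (toA k V N) := Ideal.Quotient.mk_surjective

theorem span_pa : Submodule.span k (Set.range fun p : {p : Pth V // len p < N} => pa k N p.1)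
    = ⊤ := by
  rw [eq_top_iff]
  rintro x -
  obtain ⟨y, rfl⟩ := toA_surjective x
  have hy : y ∈ (⊤ : Submodule k (PathAlg k V)) := trivial
  rw [← longPaths_zero, longPaths, pathSpan] at hy
  induction hy using Submodule.span_induction with
  | zero => simp
  | add a b _ _ ha hb => rw [map_add]; exact add_mem ha hb
  | smul c a _ ha => rw [map_smul]; exact Submodule.smul_mem _ c ha
  | mem x hx =>
    obtain ⟨p, -, rfl⟩ := hx
    by_cases h : len p < N
    · exact Submodule.subset_span ⟨⟨p, h⟩, rfl⟩
    · have : toA k V N (ofPath k p) = 0 := pa_eq_zero (not_lt.1 h)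
      rw [this]; exact zero_mem _

variable (k V N) in
/-- The basis of `A` consisting of the paths of length less than `N`. -/
def basisA : Module.Basis {p : Pth V // len p < N} k (TQA k V N) :=
  Module.Basis.mk linearIndependent_pa span_pa.ge

theorem basisA_apply (p : {p : Pth V // len p < N}) : basisA k V N p = pa k N p.1 := by
  rw [basisA, Module.Basis.mk_apply]

theorem pa_ne_zero {p : Pth V} (h : len p < N) : pa k N p ≠ 0 := by
  have := (basisA k V N).ne_zero ⟨p, h⟩
  rwa [basisA_apply] at this

theorem coe_pathPlus {p : Pth V} (h : 1 ≤ len p) : (pathPlus k N p : TQA k V N) = pa k N p := by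
  rw [pathPlus, dif_pos h]

theorem pathPlus_eq_zero {p : Pth V} (h : N ≤ len p) : pathPlus k N p = 0 := by
  rw [pathPlus]
  split_ifs with h'
  · exact Subtype.ext (pa_eq_zero h)
  · rfl

theorem linearIndependent_pathPlus :
    LinearIndependent k fun p : {p : Pth V // 1 ≤ len p ∧ len p < N} => pathPlus k N p.1 := by
  refine LinearIndependent.of_comp (Aplus k V N).subtype ?_
  have := (linearIndependent_pa (k := k) (V := V) (N := N)).comp
    (fun p : {p : Pth V // 1 ≤ len p ∧ len p < N} => ⟨p.1, p.2.2⟩)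
    (fun p q h => Subtype.ext (congrArg (fun x => x.1) h))
  convert this using 1
  ext p
  exact coe_pathPlus p.2.1

theorem span_pathPlus :
    Submodule.span k (Set.range fun p : {p : Pth V // 1 ≤ len p ∧ len p < N} =>
      pathPlus k N p.1) = ⊤ := by
  rw [eq_top_iff]
  rintro ⟨x, hx⟩ -
  refine Submodule.span_induction (p := fun x hx => (⟨x, hx⟩ : Aplus k V N) ∈
    Submodule.span k (Set.range fun p : {p : Pth V // 1 ≤ len p ∧ len p < N} =>
      pathPlus k N p.1)) ?_ ?_ ?_ ?_ hx
  · rintro _ ⟨p, hp, rfl⟩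
    by_cases h : len p < N
    · refine Submodule.subset_span ⟨⟨p, hp, h⟩, Subtype.ext (coe_pathPlus hp)⟩
    · have h0 : (⟨pa k N p, Submodule.subset_span ⟨p, hp, rfl⟩⟩ : Aplus k V N) = 0 :=
        Subtype.ext (pa_eq_zero (not_lt.1 h))
      rw [h0]; exact zero_mem _
  · exact zero_mem _
  · intro x y hx hy h1 h2; exact add_mem h1 h2
  · intro c x hx h; exact Submodule.smul_mem _ c h

variable (k V N) in
/-- The basis of `A_+` consisting of the paths of positive length less than `N`. -/
def basisPlus : Module.Basis {p : Pth V // 1 ≤ len p ∧ len p < N} k (Aplus k V N) :=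
  Module.Basis.mk linearIndependent_pathPlus span_pathPlus.ge

theorem basisPlus_apply (p : {p : Pth V // 1 ≤ len p ∧ len p < N}) :
    basisPlus k V N p = pathPlus k N p.1 := by
  rw [basisPlus, Module.Basis.mk_apply]

variable (k V N) in
/-- The projection of `A = kΔ_0 ⊕ A_+` onto `A_+`; it kills the vertices. -/
def plus : TQA k V N →ₗ[k] Aplus k V N :=
  (basisA k V N).constr k fun p => pathPlus k N p.1

theorem plus_pa (p : Pth V) : plus k V N (pa k N p) = pathPlus k N p := by
  by_cases h : len p < N
  · have := (basisA k V N).constr_basis k (fun p => pathPlus k N p.1) ⟨p, h⟩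
    rwa [basisA_apply] at this
  · rw [pa_eq_zero (not_lt.1 h), pathPlus_eq_zero (not_lt.1 h), map_zero]

theorem plus_coe (x : Aplus k V N) : plus k V N x = x := by
  have : plus k V N ∘ₗ (Aplus k V N).subtype = LinearMap.id := by
    refine (basisPlus k V N).ext fun p => ?_
    rw [basisPlus_apply]
    simp only [LinearMap.comp_apply, Submodule.subtype_apply, LinearMap.id_apply]
    rw [coe_pathPlus p.2.1, plus_pa]
  exact LinearMap.congr_fun this x

theorem plus_vtx (a : V) : plus k V N (pa k N (vtx a)) = 0 := by
  rw [plus_pa, pathPlus, dif_neg]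
  simp [len, vtx]

/-- Induction principle for `kΔ_0`. -/
theorem gr_zero_induction {motive : PathAlg k V → Prop} (vtx' : ∀ a, motive (ofPath k (vtx a)))
    (zero : motive 0) (add : ∀ x y, motive x → motive y → motive (x + y))
    (smul : ∀ (c : k) x, motive x → motive (c • x)) {x : PathAlg k V} (hx : x ∈ gr k V 0) :
    motive x := by
  rw [gr_eq_pathSpan, pathSpan] at hx
  induction hx using Submodule.span_induction with
  | zero => exact zero
  | add a b _ _ ha hb => exact add _ _ ha hb
  | smul c a _ ha => exact smul _ _ ha
  | mem x hx =>
    obtain ⟨p, hp, rfl⟩ := hx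
    rw [eq_vtx_of_len hp]; exact vtx' _

theorem vtx_mem_gr (a : V) : ofPath k (vtx a) ∈ gr k V 0 :=
  Finsupp.single_mem_supported k 1 rfl

theorem linear_pa_induction {motive : TQA k V N → Prop} (pa' : ∀ p, motive (pa k N p))
    (zero : motive 0) (add : ∀ x y, motive x → motive y → motive (x + y))
    (smul : ∀ (c : k) x, motive x → motive (c • x)) (x : TQA k V N) : motive x := by
  have hx : x ∈ (⊤ : Submodule k (TQA k V N)) := trivial
  rw [← span_pa] at hx
  induction hx using Submodule.span_induction with
  | zero => exact zero
  | add a b _ _ ha hb => exact add _ _ ha hb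
  | smul c a _ ha => exact smul _ _ ha
  | mem x hx => obtain ⟨p, rfl⟩ := hx; exact pa' _

theorem linearMap_ext_pa {M : Type*} [AddCommMonoid M] [Module k M] {f g : TQA k V N →ₗ[k] M}
    (h : ∀ p, f (pa k N p) = g (pa k N p)) (x : TQA k V N) : f x = g x :=
  linear_pa_induction (motive := fun x => f x = g x) h (by simp)
    (fun x y hx hy => by simp [hx, hy]) (fun c x hx => by simp [hx]) x

/-- An element of `kΔ_0` acts on a vertex, on either side, by its coefficient at this vertex. -/
theorem gr_zero_mul_vtx {c : PathAlg k V} (hc : c ∈ gr k V 0) (a : V) :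
    ∃ r : k, toA k V N c * pa k N (vtx a) = r • pa k N (vtx a) ∧
      pa k N (vtx a) * toA k V N c = r • pa k N (vtx a) := by
  refine gr_zero_induction (motive := fun c => ∃ r : k, toA k V N c * pa k N (vtx a) =
    r • pa k N (vtx a) ∧ pa k N (vtx a) * toA k V N c = r • pa k N (vtx a)) ?_ ?_ ?_ ?_ hc
  · intro b
    by_cases h : b = a
    · subst h
      exact ⟨1, by rw [one_smul]; exact vtx_mul_vtx b, by rw [one_smul]; exact vtx_mul_vtx b⟩
    · exact ⟨0, by rw [zero_smul]; exact pa_mul_of_ne h,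
        by rw [zero_smul]; exact pa_mul_of_ne (Ne.symm h)⟩
  · exact ⟨0, by simp, by simp⟩
  · rintro x y ⟨r, h1, h2⟩ ⟨s, h3, h4⟩
    exact ⟨r + s, by rw [map_add, add_mul, h1, h3, add_smul],
      by rw [map_add, mul_add, h2, h4, add_smul]⟩
  · rintro r x ⟨s, h1, h2⟩
    exact ⟨r * s, by rw [map_smul, smul_mul_assoc, h1, mul_smul],
      by rw [map_smul, mul_smul_comm, h2, mul_smul]⟩

theorem Aplus_mul_toA {c : PathAlg k V} (x : TQA k V N) (hx : x ∈ Aplus k V N)  :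
    x * toA k V N c ∈ Aplus k V N := by
  have hc := mem_longPaths_zero c
  rw [longPaths, pathSpan] at hc
  induction hx using Submodule.span_induction with
  | zero => simp
  | add a b _ _ ha hb => rw [add_mul]; exact add_mem ha hb
  | smul r a _ ha => rw [smul_mul_assoc]; exact Submodule.smul_mem _ r ha
  | mem x hx =>
    obtain ⟨p, hp, rfl⟩ := hx
    induction hc using Submodule.span_induction with
    | zero => simp
    | add a b _ _ ha hb => rw [map_add, mul_add]; exact add_mem ha hb
    | smul r a _ ha => rw [map_smul, mul_smul_comm]; exact Submodule.smul_mem _ r ha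
    | mem y hy =>
      obtain ⟨q, -, rfl⟩ := hy
      change pa k N p * pa k N q ∈ _
      by_cases h : p.2.1 = q.1
      · rw [pa_mul h]
        exact Submodule.subset_span ⟨_, by rw [len_joinP h]; omega, rfl⟩
      · rw [pa_mul_of_ne h]; exact zero_mem _

theorem mul_mem_Aplus_left {x : TQA k V N} (hx : x ∈ Aplus k V N) (y : TQA k V N) :
    y * x ∈ Aplus k V N := by
  refine linear_pa_induction (motive := fun y => y * x ∈ Aplus k V N) (fun q => ?_) ?_ ?_ ?_ y
  · induction hx using Submodule.span_induction with
    | zero => simp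
    | add a b _ _ ha hb => rw [mul_add]; exact add_mem ha hb
    | smul r a _ ha => rw [mul_smul_comm]; exact Submodule.smul_mem _ r ha
    | mem x hx =>
      obtain ⟨p, hp, rfl⟩ := hx
      by_cases h : q.2.1 = p.1
      · rw [pa_mul h]
        exact Submodule.subset_span ⟨_, by rw [len_joinP h]; omega, rfl⟩
      · rw [pa_mul_of_ne h]; exact zero_mem _
  · simp
  · intro a b ha hb; rw [add_mul]; exact add_mem ha hb
  · intro r a ha; rw [smul_mul_assoc]; exact Submodule.smul_mem _ r ha

theorem mul_mem_Aplus_right {x : TQA k V N} (hx : x ∈ Aplus k V N) (y : TQA k V N) :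
    x * y ∈ Aplus k V N := by
  obtain ⟨c, rfl⟩ := toA_surjective y
  exact Aplus_mul_toA x hx

/-- Every element of `A` is the sum of an element of `kΔ_0` and of its projection to `A_+`. -/
theorem exists_eq_add_plus (x : TQA k V N) :
    ∃ c ∈ gr k V 0, x = toA k V N c + plus k V N x := by
  refine linear_pa_induction (motive := fun x => ∃ c ∈ gr k V 0, x = toA k V N c + plus k V N x)
    (fun p => ?_) ⟨0, zero_mem _, by simp⟩ ?_ ?_ x
  · by_cases h : 1 ≤ len p
    · exact ⟨0, zero_mem _, by rw [plus_pa, coe_pathPlus h, map_zero, zero_add]⟩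
    · have : p = vtx p.1 := eq_vtx_of_len (by omega)
      rw [this]
      exact ⟨_, vtx_mem_gr _, by rw [plus_vtx]; simp; rfl⟩
  · rintro x y ⟨c, hc, h⟩ ⟨d, hd, h'⟩
    refine ⟨c + d, add_mem hc hd, ?_⟩
    conv_lhs => rw [h, h']
    rw [map_add, map_add, Submodule.coe_add]; abel
  · rintro r x ⟨c, hc, h⟩
    refine ⟨r • c, Submodule.smul_mem _ r hc, ?_⟩
    conv_lhs => rw [h]
    rw [map_smul, map_smul, Submodule.coe_smul, smul_add]

theorem plus_gr_zero {c : PathAlg k V} (hc : c ∈ gr k V 0) : plus k V N (toA k V N c) = 0 :=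
  gr_zero_induction (motive := fun c => plus k V N (toA k V N c) = 0) plus_vtx (by simp)
    (fun x y hx hy => by rw [map_add, map_add, hx, hy, add_zero])
    (fun r x hx => by rw [map_smul, map_smul, hx, smul_zero]) hc

theorem gr_zero_mul_mem {c d : PathAlg k V} (hc : c ∈ gr k V 0) (hd : d ∈ gr k V 0) :
    c * d ∈ gr k V 0 := by
  rw [gr_eq_pathSpan] at *
  refine mul_mem_pathSpan (fun p hp q hq h => ?_) hc hd
  simp only [Set.mem_ofPred_eq] at hp hq ⊢
  rw [len_joinP h]; omega

theorem plus_mul_gr_zero {c : PathAlg k V} (hc : c ∈ gr k V 0) (x : TQA k V N) :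
    (plus k V N (x * toA k V N c) : TQA k V N) = plus k V N x * toA k V N c := by
  obtain ⟨d, hd, h⟩ := exists_eq_add_plus x
  conv_lhs => rw [h]
  rw [add_mul, map_add, ← map_mul, plus_gr_zero (gr_zero_mul_mem hd hc), zero_add]
  have := plus_coe ⟨_, mul_mem_Aplus_right (plus k V N x).2 (toA k V N c)⟩
  rw [this]

theorem plus_gr_zero_mul {c : PathAlg k V} (hc : c ∈ gr k V 0) (x : TQA k V N) :
    (plus k V N (toA k V N c * x) : TQA k V N) = toA k V N c * plus k V N x := by
  obtain ⟨d, hd, h⟩ := exists_eq_add_plus x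
  conv_lhs => rw [h]
  rw [mul_add, map_add, ← map_mul, plus_gr_zero (gr_zero_mul_mem hc hd), zero_add]
  have := plus_coe ⟨_, mul_mem_Aplus_left (plus k V N x).2 (toA k V N c)⟩
  rw [this]

end TruncatedAlgebra

/-! ### Modules presented by idempotents, and contracting homotopies -/

section Generic

variable {R : Type*} [Ring R]

/-- The family `g` exhibits `M` as the direct sum of the left ideals `R ε_s`, with `g s`
corresponding to `ε s`. This is encoded by a section `M → ⊕ R` of the tautological map
`⊕ R → M`. -/
structure IsFreeBy {S M : Type*} [AddCommGroup M] [Module R M] (ε : S → R) (g : S → M) :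
    Prop where
  span_eq_top : Submodule.span R (Set.range g) = ⊤
  smul_eq : ∀ s, ε s • g s = g s
  exists_section : ∃ σ : M →ₗ[R] (S →₀ R), ∀ s, σ (g s) = Finsupp.single s (ε s)

namespace IsFreeBy

variable {S M : Type*} [AddCommGroup M] [Module R M] {ε : S → R} {g : S → M}

theorem linearMap_ext (h : IsFreeBy ε g) {M' : Type*} [AddCommGroup M'] [Module R M']
    {f f' : M →ₗ[R] M'} (hf : ∀ s, f (g s) = f' (g s)) : f = f' :=
  LinearMap.ext_on h.span_eq_top (by rintro _ ⟨s, rfl⟩; exact hf s)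

theorem section_comp (h : IsFreeBy ε g) {σ : M →ₗ[R] (S →₀ R)}
    (hσ : ∀ s, σ (g s) = Finsupp.single s (ε s)) :
    Finsupp.linearCombination R g ∘ₗ σ = LinearMap.id :=
  h.linearMap_ext fun s => by
    rw [LinearMap.comp_apply, hσ, Finsupp.linearCombination_single, h.smul_eq, LinearMap.id_apply]

theorem projective (h : IsFreeBy ε g) : Module.Projective R M := by
  obtain ⟨σ, hσ⟩ := h.exists_section
  exact Module.Projective.of_split σ (Finsupp.linearCombination R g) (h.section_comp hσ)

end IsFreeBy

/-- `linExt` takes the prescribed values as soon as some linear map does. -/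
theorem linExt_apply {ι M M' : Type*} [AddCommGroup M] [Module R M] [AddCommGroup M'] [Module R M']
    {g : ι → M} {y : ι → M'} (h : ∃ f : M →ₗ[R] M', ∀ i, f (g i) = y i) (i : ι) :
    linExt (R := R) g y (g i) = y i := by
  rw [linExt, dif_pos h]
  exact h.choose_spec i

variable {A : Type*} [AddCommGroup A] [Module R A]

/-- An augmented complex of projective modules with an additive contracting homotopy is a
projective resolution. -/
theorem IsProjRes.of_homotopy {M : ℕ → Type*} [∀ n, AddCommGroup (M n)] [∀ n, Module R (M n)]
    {δ : ∀ n, M (n + 1) →ₗ[R] M n} {ε : M 0 →ₗ[R] A} (hP : ∀ n, Module.Projective R (M n))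
    (h : ∀ n, M n →+ M (n + 1)) (h' : A →+ M 0) (hε : ∀ a, ε (h' a) = a)
    (h0 : ∀ x, δ 0 (h 0 x) + h' (ε x) = x)
    (hS : ∀ n x, δ (n + 1) (h (n + 1) x) + h n (δ n x) = x)
    (εδ : ∀ x, ε (δ 0 x) = 0) (δδ : ∀ n x, δ n (δ (n + 1) x) = 0) : IsProjRes M δ ε where
  projective := hP
  exact n y := by
    refine ⟨fun hy => ⟨h (n + 1) y, ?_⟩, ?_⟩
    · simpa [hy] using hS n y
    · rintro ⟨x, rfl⟩; exact δδ n x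
  exact_zero y := by
    refine ⟨fun hy => ⟨h 0 y, ?_⟩, ?_⟩
    · simpa [hy] using h0 y
    · rintro ⟨x, rfl⟩; exact εδ x
  surjective a := ⟨h' a, hε a⟩

/-- A family of maps which on generators is given by the recursion `f_{n+1} = h f_n δ`, for a
contracting homotopy `h` of the target, is a chain map. -/
theorem comm_of_homotopy {M M' : ℕ → Type*} [∀ n, AddCommGroup (M n)] [∀ n, Module R (M n)]
    [∀ n, AddCommGroup (M' n)] [∀ n, Module R (M' n)]
    {δ : ∀ n, M (n + 1) →ₗ[R] M n} {ε : M 0 →ₗ[R] A}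
    {δ' : ∀ n, M' (n + 1) →ₗ[R] M' n} {ε' : M' 0 →ₗ[R] A}
    {f : ∀ n, M n →ₗ[R] M' n} (h : ∀ n, M' n →+ M' (n + 1)) (h' : A →+ M' 0)
    (h0 : ∀ x, δ' 0 (h 0 x) + h' (ε' x) = x)
    (hS : ∀ n x, δ' (n + 1) (h (n + 1) x) + h n (δ' n x) = x)
    (εδ : ∀ x, ε (δ 0 x) = 0) (δδ : ∀ n x, δ n (δ (n + 1) x) = 0)
    (lifts : ∀ x, ε' (f 0 x) = ε x) {S : ℕ → Type*} {g : ∀ n, S n → M n}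
    (hg : ∀ n, Submodule.span R (Set.range (g n)) = ⊤)
    (hf : ∀ n s, f (n + 1) (g (n + 1) s) = h n (f n (δ n (g (n + 1) s)))) (n : ℕ) :
    δ' n ∘ₗ f (n + 1) = f n ∘ₗ δ n := by
  induction n with
  | zero =>
    refine LinearMap.ext_on (hg 1) ?_
    rintro _ ⟨s, rfl⟩
    have := h0 (f 0 (δ 0 (g 1 s)))
    rw [lifts, εδ, map_zero, add_zero] at this
    rw [LinearMap.comp_apply, hf, this, LinearMap.comp_apply]
  | succ n ih =>
    refine LinearMap.ext_on (hg (n + 2)) ?_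
    rintro _ ⟨s, rfl⟩
    have := hS n (f (n + 1) (δ (n + 1) (g (n + 2) s)))
    have h2 := LinearMap.congr_fun ih (δ (n + 1) (g (n + 2) s))
    rw [LinearMap.comp_apply, LinearMap.comp_apply, δδ, map_zero] at h2
    rw [h2, map_zero, add_zero] at this
    rw [LinearMap.comp_apply, hf, this, LinearMap.comp_apply]

end Generic

/-! ### Bimodules spanned by paths -/

section Bimodules

variable {k : Type u} [Field k] {V : Type v} [Quiver.{w} V] [Fintype V] {N : ℕ}

/-- The element `α ⊗ β` of the enveloping algebra, acting by `x ↦ α x β`. -/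
abbrev ten (α β : TQA k V N) : Env k V N := α ⊗ₜ[k] MulOpposite.op β

theorem ten_mul (α β α' β' : TQA k V N) : ten α β * ten α' β' = ten (α * α') (β' * β) := by
  rw [ten, ten, Algebra.TensorProduct.tmul_mul_tmul, ← MulOpposite.op_mul]

theorem ten_one_one : (ten 1 1 : Env k V N) = 1 := rfl

variable (k N) in
/-- The idempotent of the enveloping algebra given by a pair of vertices. -/
def idem (a b : V) : Env k V N := ten (pa k N (vtx a)) (pa k N (vtx b))

theorem idem_mul_idem (a b : V) : idem k N a b * idem k N a b = idem k N a b := by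
  rw [idem, ten_mul, vtx_mul_vtx, vtx_mul_vtx]

theorem ten_mul_idem {p q : Pth V} {a b : V} (hp : p.2.1 = a) (hq : q.1 = b) :
    ten (pa k N p) (pa k N q) * idem k N a b = ten (pa k N p) (pa k N q) := by
  rw [idem, ten_mul, mul_vtx hp, vtx_mul hq]

theorem ten_mul_idem_of_ne {p q : Pth V} {a b : V} (h : p.2.1 ≠ a ∨ b ≠ q.1) :
    ten (pa k N p) (pa k N q) * idem k N a b = 0 := by
  rw [idem, ten_mul]
  rcases h with h | h
  · rw [pa_mul_of_ne (by exact h), ten, TensorProduct.zero_tmul]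
  · rw [pa_mul_of_ne (p := vtx b) h, ten, MulOpposite.op_zero, TensorProduct.tmul_zero]

theorem span_ten : Submodule.span k
    {x : Env k V N | ∃ p q : Pth V, x = ten (pa k N p) (pa k N q)} = ⊤ := by
  rw [eq_top_iff]
  rintro x -
  induction x using TensorProduct.induction_on with
  | zero => exact zero_mem _
  | add x y hx hy => exact add_mem hx hy
  | tmul x y =>
    induction y using MulOpposite.rec' with
    | _ y =>
    refine linear_pa_induction (motive := fun x => x ⊗ₜ[k] MulOpposite.op y ∈ Submodule.span k
      {x : Env k V N | ∃ p q : Pth V, x = ten (pa k N p) (pa k N q)}) (fun p => ?_) ?_ ?_ ?_ x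
    · refine linear_pa_induction (motive := fun y => pa k N p ⊗ₜ[k] MulOpposite.op y ∈
        Submodule.span k {x : Env k V N | ∃ p q : Pth V, x = ten (pa k N p) (pa k N q)})
        (fun q => Submodule.subset_span ⟨p, q, rfl⟩) ?_ ?_ ?_ y
      · rw [MulOpposite.op_zero, TensorProduct.tmul_zero]; exact zero_mem _
      · intro a b ha hb
        rw [MulOpposite.op_add, TensorProduct.tmul_add]; exact add_mem ha hb
      · intro c a ha
        rw [MulOpposite.op_smul, TensorProduct.tmul_smul]; exact Submodule.smul_mem _ c ha
    · rw [TensorProduct.zero_tmul]; exact zero_mem _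
    · intro a b ha hb
      rw [TensorProduct.add_tmul]; exact add_mem ha hb
    · intro c a ha
      rw [← TensorProduct.smul_tmul']; exact Submodule.smul_mem _ c ha

variable {S M : Type*} [AddCommGroup M] [Module (Env k V N) M] [Module k M]
  [IsScalarTower k (Env k V N) M] {src tgt : S → V} {g : S → M}

variable (k V N) in
/-- The elements `α g_s β` of a bimodule, for composable paths `α` and `β`. -/
def composables (src tgt : S → V) (g : S → M) : Set M :=
  {x | ∃ (p q : Pth V) (s : S), p.2.1 = src s ∧ tgt s = q.1 ∧
    x = ten (pa k N p) (pa k N q) • g s}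

/-- A bimodule generated by the elements `g_s` is spanned, as a vector space, by the `α g_s β` for
composable paths `α` and `β`. -/
theorem span_composables (h : IsFreeBy (fun s => idem k N (src s) (tgt s)) g) :
    Submodule.span k (composables k V N src tgt g) = ⊤ := by
  have z : ∀ s : S, (0 : Env k V N) • g s = 0 := fun s => zero_smul (Env k V N) (g s)
  have key : ∀ (r : Env k V N) (s : S),
      r • g s ∈ Submodule.span k (composables k V N src tgt g) := by
    intro r s
    have hr : r ∈ (⊤ : Submodule k (Env k V N)) := trivial
    rw [← span_ten] at hr
    induction hr using Submodule.span_induction with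
    | zero => rw [z]; exact zero_mem _
    | add a b _ _ ha hb => rw [add_smul]; exact add_mem ha hb
    | smul c a _ ha => rw [smul_assoc]; exact Submodule.smul_mem _ c ha
    | mem x hx =>
      obtain ⟨p, q, rfl⟩ := hx
      by_cases hc : p.2.1 = src s ∧ tgt s = q.1
      · exact Submodule.subset_span ⟨p, q, s, hc.1, hc.2, rfl⟩
      · rw [← h.smul_eq, ← mul_smul, ten_mul_idem_of_ne (by tauto), z]
        exact zero_mem _
  rw [eq_top_iff]
  rintro x -
  have hx : x ∈ (⊤ : Submodule (Env k V N) M) := trivial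
  rw [← h.span_eq_top] at hx
  refine Submodule.span_induction (p := fun x _ => ∀ r : Env k V N, r • x ∈
    Submodule.span k (composables k V N src tgt g)) ?_ ?_ ?_ ?_ hx 1 |> fun h => by
      rwa [one_smul] at h
  · rintro _ ⟨s, rfl⟩ r; exact key r s
  · intro r; rw [smul_zero]; exact zero_mem _
  · intro x y _ _ hx hy r; rw [smul_add]; exact add_mem (hx r) (hy r)
  · intro a x _ hx r; rw [← mul_smul]; exact hx _

theorem eq_of_composables (h : IsFreeBy (fun s => idem k N (src s) (tgt s)) g) {M' : Type*}
    [AddCommGroup M'] [Module k M'] {f f' : M →ₗ[k] M'}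
    (hf : ∀ (p q : Pth V) (s : S), p.2.1 = src s → tgt s = q.1 →
      f (ten (pa k N p) (pa k N q) • g s) = f' (ten (pa k N p) (pa k N q) • g s)) : f = f' :=
  LinearMap.ext_on (span_composables h) (by
    rintro _ ⟨p, q, s, h1, h2, rfl⟩; exact hf p q s h1 h2)

/-- A linear map may be prescribed arbitrarily on the elements `α g_s β`, for composable paths
`α`, `β` of length less than `N`: these form a basis of the bimodule. -/
theorem exists_linearMap_composables (h : IsFreeBy (fun s => idem k N (src s) (tgt s)) g)
    {M' : Type*} [AddCommGroup M'] [Module k M'] (H : Pth V → S → Pth V → M') :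
    ∃ f : M →ₗ[k] M', ∀ (p q : Pth V) (s : S), p.2.1 = src s → tgt s = q.1 → len p < N →
      len q < N → f (ten (pa k N p) (pa k N q) • g s) = H p s q := by
  obtain ⟨σ, hσ⟩ := h.exists_section
  let B : S → Env k V N →ₗ[k] M' := fun s =>
    TensorProduct.lift ((basisA k V N).constr k fun p =>
      ((basisA k V N).constr k fun q => H p.1 s q.1) ∘ₗ
        (MulOpposite.opLinearEquiv k).symm.toLinearMap)
  refine ⟨(Finsupp.lsum k B : (S →₀ Env k V N) →ₗ[k] M') ∘ₗ σ.restrictScalars k,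
    fun p q s h1 h2 hp hq => ?_⟩
  have e1 := (basisA k V N).constr_basis k (fun p => ((basisA k V N).constr k fun q =>
    H p.1 s q.1) ∘ₗ (MulOpposite.opLinearEquiv k).symm.toLinearMap) ⟨p, hp⟩
  have e2 := (basisA k V N).constr_basis k (fun q => H p s q.1) ⟨q, hq⟩
  rw [basisA_apply] at e1 e2
  rw [LinearMap.comp_apply, LinearMap.restrictScalars_apply, map_smul, hσ, Finsupp.smul_single,
    smul_eq_mul, ten_mul_idem h1 h2.symm, Finsupp.lsum_single]
  simp only [B]
  rw [ten, TensorProduct.lift.tmul, e1, LinearMap.comp_apply]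
  exact e2

end Bimodules

/-! ### Extension of scalars to the enveloping algebra -/

section LiftLeft

variable {k E : Type*} [Field k] [Semiring E] [Algebra k E]
  {X M : Type*} [AddCommGroup X] [Module k X]
  [AddCommMonoid M] [Module E M] [Module k M] [IsScalarTower k E M]

/-- The `E`-linear map `E ⊗ X → M` extending a `k`-linear map `X → M`, for an algebra `E` which
need not be commutative. -/
def liftLeft (θ : X →ₗ[k] M) : E ⊗[k] X →ₗ[E] M :=
  have : SMulCommClass k E M := IsScalarTower.to_smulCommClass
  TensorProduct.AlgebraTensorModule.lift (LinearMap.toSpanSingleton E (X →ₗ[k] M) θ)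

theorem liftLeft_tmul (θ : X →ₗ[k] M) (r : E) (x : X) : liftLeft θ (r ⊗ₜ[k] x) = r • θ x := rfl

end LiftLeft

/-! ### The bimodules of the minimal resolution -/

section MinimalBimodules

variable {k : Type u} [Field k] {V : Type v} [Quiver.{w} V] [Fintype V] {N : ℕ}

theorem algebraMap_env (c : k) : algebraMap k (Env k V N) c = ten (c • 1) 1 := by
  rw [Algebra.TensorProduct.algebraMap_apply, Algebra.algebraMap_eq_smul_one]; rfl

theorem ten_smul_A (a b x : TQA k V N) : ten a b • x = a * x * b := env_smul a b x

/-- The actions of `k` and of the enveloping algebra on `A` are compatible. -/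
theorem isScalarTower_A : IsScalarTower k (Env k V N) (TQA k V N) := ⟨fun c r x => by
  have h : ∀ y : TQA k V N, algebraMap k (Env k V N) c • y = c • y := fun y => by
    rw [algebraMap_env, ten_smul_A, mul_one]
    exact (smul_mul_assoc c 1 y).trans (by rw [one_mul])
  rw [← h, ← mul_smul, ← Algebra.smul_def]⟩

instance (n : ℕ) : Module k (P k V N n) := Module.compHom _ (algebraMap k (Env k V N))

theorem smul_P_def (n : ℕ) (c : k) (x : P k V N n) : c • x = algebraMap k (Env k V N) c • x := rfl

instance (n : ℕ) : IsScalarTower k (Env k V N) (P k V N n) := ⟨fun c r x => by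
  rw [smul_P_def, ← mul_smul, ← Algebra.smul_def]⟩

theorem smul_tP {m : ℕ} (a b α β : TQA k V N) (x : gr k V m) :
    ten a b • tP α x β = tP (a * α) x (β * b) :=
  (TensorProduct.smul_tmul' (ten a b) (ten α β) x).trans
    (congrArg (fun r : Env k V N => r ⊗ₜ[k] x) (ten_mul a b α β))

theorem tP_add {m : ℕ} (α β : TQA k V N) (x y : gr k V m) :
    tP α (x + y) β = tP α x β + tP α y β := TensorProduct.tmul_add _ _ _

theorem tP_smul {m : ℕ} (α β : TQA k V N) (c : k) (x : gr k V m) :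
    tP α (c • x) β = algebraMap k (Env k V N) c • tP α x β := by
  rw [algebraMap_env, smul_tP, mul_one]
  refine (TensorProduct.tmul_smul c (ten α β) x).trans ?_
  refine (TensorProduct.smul_tmul' c (ten α β) x).trans ?_
  refine congrArg (fun r : Env k V N => r ⊗ₜ[k] x) ?_
  refine (TensorProduct.smul_tmul' c α (MulOpposite.op β)).trans ?_
  exact congrArg (fun a => ten a β) (by rw [smul_mul_assoc, one_mul])

theorem ten_smul_elemP (n : ℕ) (a b α β : TQA k V N) (x : gr k V (mdeg N n)) :
    ten a b • elemP n α x β = elemP n (a * α) x (β * b) := by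
  rw [elemP, ← map_smul, smul_tP]; rfl

theorem elemP_eq_smul (n : ℕ) (α β : TQA k V N) (x : gr k V (mdeg N n)) :
    elemP n α x β = ten α β • elemP n 1 x 1 := by
  rw [ten_smul_elemP, mul_one, one_mul]

theorem elemP_add (n : ℕ) (α β : TQA k V N) (x y : gr k V (mdeg N n)) :
    elemP n α (x + y) β = elemP n α x β + elemP n α y β := by
  rw [elemP, elemP, elemP, ← map_add, tP_add]

theorem elemP_smul (n : ℕ) (α β : TQA k V N) (c : k) (x : gr k V (mdeg N n)) :
    elemP n α (c • x) β = c • elemP n α x β := by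
  rw [smul_P_def, elemP, elemP, ← map_smul, tP_smul]

theorem elemP_zero (n : ℕ) (α β : TQA k V N) : elemP n α (0 : gr k V (mdeg N n)) β = 0 := by
  have := elemP_smul n α β (0 : k) 0
  rwa [zero_smul, zero_smul] at this

theorem zero_smul_env {M : Type*} [AddCommGroup M] [Module (Env k V N) M] (x : M) :
    (0 : Env k V N) • x = 0 := zero_smul (Env k V N) x

theorem ten_zero_left (β : TQA k V N) : ten 0 β = 0 := TensorProduct.zero_tmul _ _

theorem ten_zero_right (α : TQA k V N) : ten α 0 = 0 := TensorProduct.tmul_zero _ _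

theorem elemP_zero_left (n : ℕ) (β : TQA k V N) (x : gr k V (mdeg N n)) : elemP n 0 x β = 0 := by
  rw [elemP_eq_smul, ten_zero_left, zero_smul_env]

theorem elemP_zero_right (n : ℕ) (α : TQA k V N) (x : gr k V (mdeg N n)) : elemP n α x 0 = 0 := by
  rw [elemP_eq_smul, ten_zero_right, zero_smul_env]

theorem elemP_mul_left (n : ℕ) (α β : TQA k V N) {c : PathAlg k V} {x y : gr k V (mdeg N n)}
    (hc : c ∈ gr k V 0) (hy : (y : PathAlg k V) = c * x) :
    elemP n (α * toA k V N c) x β = elemP n α y β := by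
  rw [← sub_eq_zero, elemP, elemP, ← map_sub]
  exact (Submodule.Quotient.mk_eq_zero _).2
    (Submodule.subset_span (Or.inl ⟨α, β, c, x, y, hc, hy, rfl⟩))

theorem elemP_mul_right (n : ℕ) (α β : TQA k V N) {c : PathAlg k V} {x y : gr k V (mdeg N n)}
    (hc : c ∈ gr k V 0) (hy : (y : PathAlg k V) = x * c) :
    elemP n α y β = elemP n α x (toA k V N c * β) := by
  rw [← sub_eq_zero, elemP, elemP, ← map_sub]
  exact (Submodule.Quotient.mk_eq_zero _).2
    (Submodule.subset_span (Or.inr ⟨α, β, c, x, y, hc, hy, rfl⟩))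

theorem coe_inGr {m : ℕ} {p : Pth V} (h : len p = m) :
    (inGr k m p : PathAlg k V) = ofPath k p := by
  rw [inGr, dif_pos h]

theorem inGr_of_ne {m : ℕ} {p : Pth V} (h : len p ≠ m) : inGr k m p = 0 := by
  rw [inGr, dif_neg h]

theorem vtx_mul_inGr (m : ℕ) (p : Pth V) :
    (inGr k m p : PathAlg k V) = ofPath k (vtx p.1) * inGr k m p := by
  by_cases h : len p = m
  · rw [coe_inGr h, ofPath_mul_of_eq rfl, vtx, joinP_mk, Quiver.Path.nil_comp]
  · rw [inGr_of_ne h]; simp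

theorem inGr_mul_vtx (m : ℕ) (p : Pth V) :
    (inGr k m p : PathAlg k V) = inGr k m p * ofPath k (vtx p.2.1) := by
  by_cases h : len p = m
  · rw [coe_inGr h, ofPath_mul_of_eq rfl, vtx, joinP_mk, Quiver.Path.comp_nil]
  · rw [inGr_of_ne h]; simp

theorem elemP_vtx_left (n : ℕ) (α β : TQA k V N) {p : Pth V} {a : V} (h : p.1 = a) :
    elemP n (α * pa k N (vtx a)) (inGr k (mdeg N n) p) β =
      elemP n α (inGr k (mdeg N n) p) β := by
  subst h; exact elemP_mul_left n α β (vtx_mem_gr _) (vtx_mul_inGr _ p)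

theorem elemP_vtx_right (n : ℕ) (α β : TQA k V N) {p : Pth V} {a : V} (h : p.2.1 = a) :
    elemP n α (inGr k (mdeg N n) p) (pa k N (vtx a) * β) =
      elemP n α (inGr k (mdeg N n) p) β := by
  subst h; exact (elemP_mul_right n α β (vtx_mem_gr _) (inGr_mul_vtx _ p)).symm

theorem gr_induction {m : ℕ} {motive : gr k V m → Prop}
    (path : ∀ p, len p = m → motive (inGr k m p)) (zero : motive 0)
    (add : ∀ x y, motive x → motive y → motive (x + y))
    (smul : ∀ (c : k) x, motive x → motive (c • x)) (x : gr k V m) : motive x := by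
  obtain ⟨x, hx⟩ := x
  have hx' := hx
  rw [gr_eq_pathSpan, pathSpan] at hx'
  have H : ∃ h : x ∈ gr k V m, motive ⟨x, h⟩ := by
    clear hx
    induction hx' using Submodule.span_induction with
    | zero => exact ⟨zero_mem _, zero⟩
    | add a b _ _ ha hb =>
      obtain ⟨ha, ha'⟩ := ha
      obtain ⟨hb, hb'⟩ := hb
      exact ⟨add_mem ha hb, add _ _ ha' hb'⟩
    | smul c a _ ha =>
      obtain ⟨ha, ha'⟩ := ha
      exact ⟨Submodule.smul_mem _ c ha, smul _ _ ha'⟩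
    | mem x hx =>
      obtain ⟨p, hp, rfl⟩ := hx
      rw [← coe_inGr hp]
      exact ⟨(inGr k m p).2, path p hp⟩
  exact H.choose_spec

variable (k V N) in
/-- The generators `1 ⊗ p ⊗ 1` of `P_n`. -/
def genP (n : ℕ) (p : {p : Pth V // len p = mdeg N n}) : P k V N n :=
  elemP n 1 (inGr k (mdeg N n) p.1) 1

theorem elemP_mem_span (n : ℕ) (α β : TQA k V N) (x : gr k V (mdeg N n)) :
    elemP n α x β ∈ Submodule.span (Env k V N) (Set.range (genP k V N n)) := by
  rw [elemP_eq_smul]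
  refine Submodule.smul_mem _ _ ?_
  refine gr_induction (motive := fun x => elemP n (1 : TQA k V N) x 1 ∈
    Submodule.span (Env k V N) (Set.range (genP k V N n))) (fun p hp => ?_) ?_ ?_ ?_ x
  · exact Submodule.subset_span ⟨⟨p, hp⟩, rfl⟩
  · rw [elemP_zero]; exact zero_mem _
  · intro x y hx hy; rw [elemP_add]; exact add_mem hx hy
  · intro c x hx; rw [elemP_smul, ← algebraMap_smul (Env k V N) c]; exact Submodule.smul_mem _ _ hx

theorem span_genP (n : ℕ) :
    Submodule.span (Env k V N) (Set.range (genP k V N n)) = ⊤ := by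
  rw [eq_top_iff]
  rintro x -
  obtain ⟨t, rfl⟩ : ∃ t, projP k V N n t = x := Submodule.mkQ_surjective _ x
  refine TensorProduct.induction_on (motive := fun t : Env k V N ⊗[k] gr k V (mdeg N n) =>
    projP k V N n t ∈ Submodule.span (Env k V N) (Set.range (genP k V N n))) t ?_ ?_ ?_
  · exact (map_zero (projP k V N n)) ▸ zero_mem _
  · intro r x
    have h1 : (r • tP 1 x 1 : TP k V N (mdeg N n)) = r ⊗ₜ[k] x :=
      (TensorProduct.smul_tmul' r (ten 1 1) x).trans
        (congrArg (fun r : Env k V N => r ⊗ₜ[k] x) (mul_one r))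
    have h2 := (map_smul (projP k V N n) r (tP 1 x 1)).symm.trans (congrArg (projP k V N n) h1)
    exact h2 ▸ Submodule.smul_mem _ _ (elemP_mem_span n 1 1 x)
  · intro x y hx hy
    exact (map_add (projP k V N n) x y) ▸ add_mem hx hy

section Universal

variable {M : Type*} [AddCommGroup M] [Module (Env k V N) M] [Module k M]
  [IsScalarTower k (Env k V N) M]

open Classical in
/-- The linear map on the path algebra which takes a prescribed value on each path of length `m`,
and vanishes on the other paths. -/
def extendPaths (m : ℕ) (y : {p : Pth V // len p = m} → M) : PathAlg k V →ₗ[k] M :=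
  Finsupp.linearCombination k fun p : Pth V => if h : len p = m then y ⟨p, h⟩ else 0

theorem extendPaths_ofPath {m : ℕ} (y : {p : Pth V // len p = m} → M) {p : Pth V}
    (h : len p = m) : extendPaths (k := k) m y (ofPath k p) = y ⟨p, h⟩ := by
  rw [extendPaths, ofPath]
  erw [Finsupp.linearCombination_single]
  rw [one_smul, dif_pos h]

theorem extendPaths_mul_left {m : ℕ} (y : {p : Pth V // len p = m} → M)
    (hy : ∀ p, idem k N p.1.1 p.1.2.1 • y p = y p) {c : PathAlg k V} (hc : c ∈ gr k V 0)
    (x : gr k V m) : extendPaths m y (c * (x : PathAlg k V)) =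
      ten (toA k V N c) 1 • extendPaths m y (x : PathAlg k V) := by
  have hv : ∀ (a : V) (x : gr k V m), extendPaths m y (ofPath k (vtx a) * (x : PathAlg k V)) =
      ten (pa k N (vtx a)) 1 • extendPaths m y (x : PathAlg k V) := by
    intro a x
    induction x using gr_induction with
    | path p hp =>
      rw [coe_inGr hp, extendPaths_ofPath y hp, ← hy, ← mul_smul, idem, ten_mul, mul_one]
      by_cases h : a = p.1
      · subst h
        rw [ofPath_mul_of_eq rfl, vtx_mul_vtx, vtx, joinP_mk, Quiver.Path.nil_comp,
          extendPaths_ofPath y hp]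
        exact (hy ⟨p, hp⟩).symm
      · rw [ofPath_mul_of_ne (by exact h), pa_mul_of_ne (by exact h), map_zero,
          ten_zero_left, zero_smul_env]
    | zero => simp
    | add x y hx hy => rw [Submodule.coe_add, mul_add, map_add, hx, hy, map_add, smul_add]
    | smul c x hx =>
      rw [Submodule.coe_smul, mul_smul_comm, map_smul, hx, map_smul]
      have : SMulCommClass k (Env k V N) M := IsScalarTower.to_smulCommClass
      rw [smul_comm]
  refine gr_zero_induction (x := c) (motive := fun c => extendPaths m y (c * (x : PathAlg k V)) =
    ten (toA k V N c) 1 • extendPaths m y (x : PathAlg k V)) (fun a => hv a x) ?_ ?_ ?_ hc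
  · rw [zero_mul, map_zero, map_zero, ten_zero_left, zero_smul_env]
  · intro c d hc hd
    rw [add_mul, map_add, hc, hd, map_add, ten, ten, ten, TensorProduct.add_tmul, add_smul]
  · intro r c hc
    rw [smul_mul_assoc, map_smul, hc, map_smul, ten, ten, ← TensorProduct.smul_tmul', smul_assoc]

theorem extendPaths_mul_right {m : ℕ} (y : {p : Pth V // len p = m} → M)
    (hy : ∀ p, idem k N p.1.1 p.1.2.1 • y p = y p) {c : PathAlg k V} (hc : c ∈ gr k V 0)
    (x : gr k V m) : extendPaths m y ((x : PathAlg k V) * c) =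
      ten (1 : TQA k V N) (toA k V N c) • extendPaths m y (x : PathAlg k V) := by
  have hv : ∀ (a : V) (x : gr k V m), extendPaths m y ((x : PathAlg k V) * ofPath k (vtx a)) =
      ten (1 : TQA k V N) (pa k N (vtx a)) • extendPaths m y (x : PathAlg k V) := by
    intro a x
    induction x using gr_induction with
    | path p hp =>
      rw [coe_inGr hp, extendPaths_ofPath y hp, ← hy, ← mul_smul, idem, ten_mul, one_mul]
      by_cases h : p.2.1 = a
      · subst h
        rw [ofPath_mul_of_eq rfl, vtx_mul_vtx, vtx, joinP_mk, Quiver.Path.comp_nil,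
          extendPaths_ofPath y hp]
        exact (hy ⟨p, hp⟩).symm
      · rw [ofPath_mul_of_ne (by exact h), pa_mul_of_ne (by exact h), map_zero,
          ten_zero_right, zero_smul_env]
    | zero => simp
    | add x y hx hy => rw [Submodule.coe_add, add_mul, map_add, hx, hy, map_add, smul_add]
    | smul c x hx =>
      rw [Submodule.coe_smul, smul_mul_assoc, map_smul, hx, map_smul]
      have : SMulCommClass k (Env k V N) M := IsScalarTower.to_smulCommClass
      rw [smul_comm]
  refine gr_zero_induction (x := c) (motive := fun c => extendPaths m y ((x : PathAlg k V) * c) =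
    ten (1 : TQA k V N) (toA k V N c) • extendPaths m y (x : PathAlg k V)) (fun a => hv a x)
    ?_ ?_ ?_ hc
  · rw [mul_zero, map_zero, map_zero, ten_zero_right, zero_smul_env]
  · intro c d hc hd
    rw [mul_add, map_add, hc, hd, map_add, ten, ten, ten, MulOpposite.op_add,
      TensorProduct.tmul_add, add_smul]
  · intro r c hc
    rw [mul_smul_comm, map_smul, hc, map_smul, ten, ten, MulOpposite.op_smul,
      TensorProduct.tmul_smul, smul_assoc]

/-- A bimodule map out of `P_n` may be prescribed on the generators, as long as the values are
compatible with the endpoints of the paths. -/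
theorem exists_linearMap_P (n : ℕ) (y : {p : Pth V // len p = mdeg N n} → M)
    (hy : ∀ p, idem k N p.1.1 p.1.2.1 • y p = y p) :
    ∃ f : P k V N n →ₗ[Env k V N] M, ∀ p, f (genP k V N n p) = y p := by
  let σ : TP k V N (mdeg N n) →ₗ[Env k V N] M :=
    liftLeft (E := Env k V N) (extendPaths (mdeg N n) y ∘ₗ (gr k V (mdeg N n)).subtype)
  have hσ : ∀ (α β : TQA k V N) (x : gr k V (mdeg N n)), σ (tP α x β) =
      ten α β • extendPaths (mdeg N n) y (x : PathAlg k V) :=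
    fun α β x => liftLeft_tmul _ _ x
  have hrel : relP k V N (mdeg N n) ≤ LinearMap.ker σ := by
    rw [relP, Submodule.span_le]
    rintro _ (⟨α, β, c, x, z, hc, hz, rfl⟩ | ⟨α, β, c, x, z, hc, hz, rfl⟩)
    · rw [SetLike.mem_coe, LinearMap.mem_ker, map_sub, hσ, hσ, hz, extendPaths_mul_left y hy hc,
        ← mul_smul, ten_mul, one_mul, sub_self]
    · rw [SetLike.mem_coe, LinearMap.mem_ker, map_sub, hσ, hσ, hz, extendPaths_mul_right y hy hc,
        ← mul_smul, ten_mul, mul_one, sub_self]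
  refine ⟨(relP k V N (mdeg N n)).liftQ σ hrel, fun p => ?_⟩
  have h1 : (relP k V N (mdeg N n)).liftQ σ hrel (genP k V N n p) =
      σ (tP 1 (inGr k (mdeg N n) p.1) 1) := Submodule.liftQ_apply _ _ _
  refine h1.trans ?_
  rw [hσ, ten_one_one, one_smul, coe_inGr p.2, extendPaths_ofPath y p.2]

end Universal

/-- `P_n` is the direct sum of the bimodules `A o(p) ⊗ t(p) A`, over the paths `p` of length
`mdeg N n`. -/
theorem isFreeBy_genP (n : ℕ) : IsFreeBy
    (fun p : {p : Pth V // len p = mdeg N n} => idem k N p.1.1 p.1.2.1) (genP k V N n) where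
  span_eq_top := span_genP n
  smul_eq p := by
    rw [idem, genP, ten_smul_elemP, mul_one, one_mul]
    have h1 := elemP_vtx_left (k := k) (N := N) n 1 (pa k N (vtx p.1.2.1)) (p := p.1) rfl
    have h2 := elemP_vtx_right (k := k) (N := N) n 1 1 (p := p.1) rfl
    rw [one_mul] at h1
    rw [mul_one] at h2
    rw [h1, h2]
  exists_section :=
    exists_linearMap_P (M := {p : Pth V // len p = mdeg N n} →₀ Env k V N) n
      (fun p => Finsupp.single p (idem k N p.1.1 p.1.2.1)) fun p => by
        rw [Finsupp.smul_single, smul_eq_mul, idem_mul_idem]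

end MinimalBimodules

/-! ### The minimal resolution -/

section MinimalResolution

variable {k : Type u} [Field k] {V : Type v} [Quiver.{w} V] [Fintype V] {N : ℕ}

theorem mdeg_zero : mdeg N 0 = 0 := by simp [mdeg]

theorem mdeg_succ_of_even {n : ℕ} (hn : Even n) : mdeg N (n + 1) = mdeg N n + 1 := by
  obtain ⟨k, rfl⟩ := hn
  have h1 : (k + k + 1) / 2 = k := by omega
  have h2 : (k + k + 1) % 2 = 1 := by omega
  have h3 : (k + k) / 2 = k := by omega
  have h4 : (k + k) % 2 = 0 := by omega
  simp only [mdeg, h1, h2, h3, h4, add_zero]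

theorem mdeg_succ_of_odd {n : ℕ} (hn : ¬ Even n) : mdeg N (n + 1) + 1 = mdeg N n + N := by
  obtain ⟨k, rfl⟩ := Nat.not_even_iff_odd.1 hn
  have h1 : (2 * k + 1 + 1) / 2 = k + 1 := by omega
  have h2 : (2 * k + 1 + 1) % 2 = 0 := by omega
  have h3 : (2 * k + 1) / 2 = k := by omega
  have h4 : (2 * k + 1) % 2 = 1 := by omega
  simp only [mdeg, h1, h2, h3, h4, add_mul]; omega

theorem not_even_succ {n : ℕ} (h : Even n) : ¬ Even (n + 1) := by
  rw [Nat.even_add_one]; exact not_not.2 h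

theorem even_succ {n : ℕ} (h : ¬ Even n) : Even (n + 1) := Nat.even_add_one.2 h

variable (k N) in
/-- The element `v_1 … v_j ⊗ v_{j+1} … v_{j+m} ⊗ v_{j+m+1} … v_L` of `P_n`, for a path
`w = v_1 … v_L` and `m = mdeg N n`. -/
def cutP (n : ℕ) (w : Pth V) (j : ℕ) : P k V N n :=
  elemP n (pa k N (seg w 0 j)) (inGr k (mdeg N n) (seg w j (mdeg N n)))
    (pa k N (rest w (j + mdeg N n)))

/-- The left factor is zero in `A` if it has at least `N` arrows. -/
theorem cutP_eq_zero_left {n : ℕ} {w : Pth V} {j : ℕ} (h : j + mdeg N n ≤ len w) (hj : N ≤ j) :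
    cutP k N n w j = 0 := by
  rw [cutP, pa_eq_zero (by rwa [len_seg (by omega)]), elemP_zero_left]

/-- The right factor is zero in `A` if it has at least `N` arrows. -/
theorem cutP_eq_zero_right {n : ℕ} {w : Pth V} {j : ℕ} (h : j + mdeg N n + N ≤ len w) :
    cutP k N n w j = 0 := by
  rw [cutP, pa_eq_zero (p := rest _ _) (by rw [len_rest (by omega)]; omega), elemP_zero_right]

theorem ten_smul_genP (n : ℕ) (p q : Pth V) (s : {p : Pth V // len p = mdeg N n})
    (h1 : p.2.1 = s.1.1) (h2 : s.1.2.1 = q.1) :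
    ten (pa k N p) (pa k N q) • genP k V N n s = cutP k N n (joinP p (joinP s.1 q)) (len p) := by
  have h3 : p.2.1 = (joinP s.1 q).1 := by rw [joinP_src, h1]
  have h4 : len p + mdeg N n ≤ len (joinP p (joinP s.1 q)) := by
    rw [len_joinP h3, len_joinP h2, s.2]; omega
  have hr := rest_joinP h3
  have e1 : seg (joinP p (joinP s.1 q)) (len p) (mdeg N n) = s.1 := by
    have := seg_rest (w := joinP p (joinP s.1 q)) (j := len p) (i := 0) (l := mdeg N n) (by omega)
    rw [hr, add_zero] at this
    rw [← this]
    have h5 := seg_joinP_left h2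
    rwa [s.2] at h5
  have e2 : rest (joinP p (joinP s.1 q)) (len p + mdeg N n) = q := by
    rw [← rest_rest h4, hr]
    have h5 := rest_joinP h2
    rwa [s.2] at h5
  rw [genP, ten_smul_elemP, mul_one, one_mul, cutP, seg_joinP_left h3, e1, e2]

/-- The elements `cutP` span `P_n` as a vector space. -/
theorem eq_of_cutP (n : ℕ) {M : Type*} [AddCommGroup M] [Module k M] {f f' : P k V N n →ₗ[k] M}
    (h : ∀ (w : Pth V) (j : ℕ), j + mdeg N n ≤ len w → f (cutP k N n w j) = f' (cutP k N n w j)) :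
    f = f' := by
  refine eq_of_composables (isFreeBy_genP n) fun p q s h1 h2 => ?_
  rw [ten_smul_genP n p q s h1 h2]
  refine h _ _ ?_
  rw [len_joinP (by rw [joinP_src, h1]), len_joinP h2, s.2]; omega

theorem ten_smul_dVal (n : ℕ) (a b α β : TQA k V N) (p : Pth V) :
    ten a b • dVal k N n α p β = dVal k N n (a * α) p (β * b) := by
  simp only [dVal]
  split_ifs
  · simp only [Finset.smul_sum, ten_smul_elemP, mul_assoc]
  · simp only [smul_sub, ten_smul_elemP, mul_assoc]

theorem exists_d (n : ℕ) : ∃ f : P k V N (n + 1) →ₗ[Env k V N] P k V N n,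
    ∀ t : TQA k V N × {p : Pth V // len p = mdeg N (n + 1)} × TQA k V N,
      f (elemP (n + 1) t.1 (inGr k (mdeg N (n + 1)) t.2.1.1) t.2.2) =
        dVal k N n t.1 t.2.1.1 t.2.2 := by
  obtain ⟨f, hf⟩ := exists_linearMap_P (k := k) (V := V) (N := N) (M := P k V N n) (n + 1)
    (fun p => dVal k N n (pa k N (vtx p.1.1)) p.1 (pa k N (vtx p.1.2.1))) fun p => by
      rw [idem, ten_smul_dVal, vtx_mul_vtx, vtx_mul_vtx]
  have key : ∀ (α β : TQA k V N) (p : Pth V),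
      dVal k N n (α * pa k N (vtx p.1)) p (pa k N (vtx p.2.1) * β) = dVal k N n α p β := by
    intro α β p
    have e1 : ∀ j, α * pa k N (vtx p.1) * pa k N (seg p 0 j) = α * pa k N (seg p 0 j) := fun j => by
      rw [mul_assoc, vtx_mul (seg_zero_src p j)]
    have e2 : ∀ j, pa k N (rest p j) * (pa k N (vtx p.2.1) * β) = pa k N (rest p j) * β :=
      fun j => by rw [← mul_assoc, mul_vtx (rest_tgt p j)]
    simp only [dVal, e1, e2]
  refine ⟨f, fun ⟨α, p, β⟩ => ?_⟩
  have := hf p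
  dsimp only at this ⊢
  rw [elemP_eq_smul, map_smul]
  change ten α β • f (genP k V N (n + 1) p) = _
  rw [this, ten_smul_dVal, key]

theorem d_elemP (n : ℕ) (α : TQA k V N) {p : Pth V} (β : TQA k V N) (hp : len p = mdeg N (n + 1)) :
    d k V N n (elemP (n + 1) α (inGr k _ p) β) = dVal k N n α p β := by
  have h := linExt_apply (R := Env k V N) (exists_d (k := k) (V := V) (N := N) n) (α, ⟨p, hp⟩, β)
  exact h

theorem elemP_eq_cutP (n : ℕ) {w : Pth V} {j m i : ℕ} (hw : j + m ≤ len w)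
    (hi : i + mdeg N n ≤ m) :
    elemP n (pa k N (seg w 0 j) * pa k N (seg (seg w j m) 0 i))
      (inGr k (mdeg N n) (seg (seg w j m) i (mdeg N n)))
      (pa k N (rest (seg w j m) (i + mdeg N n)) * pa k N (rest w (j + m))) =
      cutP k N n w (j + i) := by
  have e1 : pa k N (seg w 0 j) * pa k N (seg (seg w j m) 0 i) = pa k N (seg w 0 (j + i)) := by
    have := joinP_seg_seg (w := w) (i := 0) (l := j) (l' := i) (by omega)
    rw [zero_add] at this
    rw [seg_seg hw (by omega), add_zero, pa_mul, this]
    rw [seg_tgt (by omega), seg_src, zero_add]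
  have e2 : pa k N (rest (seg w j m) (i + mdeg N n)) * pa k N (rest w (j + m)) =
      pa k N (rest w (j + i + mdeg N n)) := by
    have h3 : j + (i + mdeg N n) + (m - (i + mdeg N n)) = j + m := by omega
    have := joinP_seg_rest (w := w) (i := j + (i + mdeg N n)) (l := m - (i + mdeg N n)) (by omega)
    rw [h3] at this
    rw [rest_seg hw hi, pa_mul, this, add_assoc]
    rw [seg_tgt (by omega), h3]
  rw [e1, e2, seg_seg hw hi, cutP]

/-- The differential in odd degrees. -/
theorem d_cutP_of_even {n : ℕ} (hn : Even n) {w : Pth V} {j : ℕ}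
    (h : j + mdeg N (n + 1) ≤ len w) :
    d k V N n (cutP k N (n + 1) w j) = cutP k N n w (j + 1) - cutP k N n w j := by
  have hm := mdeg_succ_of_even (N := N) hn
  rw [cutP, d_elemP _ _ _ (len_seg h), dVal]
  simp only [if_neg (not_even_succ hn)]
  rw [elemP_eq_cutP n h (by omega), elemP_eq_cutP n h (by omega), add_zero]

/-- The differential in even degrees. -/
theorem d_cutP_of_odd {n : ℕ} (hn : ¬ Even n) {w : Pth V} {j : ℕ}
    (h : j + mdeg N (n + 1) ≤ len w) :
    d k V N n (cutP k N (n + 1) w j) = ∑ i ∈ Finset.range N, cutP k N n w (j + i) := by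
  have hm := mdeg_succ_of_odd (N := N) hn
  rw [cutP, d_elemP _ _ _ (len_seg h), dVal]
  simp only [if_pos (even_succ hn)]
  refine Finset.sum_congr rfl fun i hi => ?_
  rw [elemP_eq_cutP n h (by rw [Finset.mem_range] at hi; omega)]

theorem exists_epsP : ∃ f : P k V N 0 →ₗ[Env k V N] TQA k V N,
    ∀ t : TQA k V N × gr k V (mdeg N 0) × TQA k V N, f (elemP 0 t.1 t.2.1 t.2.2) =
      t.1 * toA k V N (t.2.1 : PathAlg k V) * t.2.2 := by
  have := isScalarTower_A (k := k) (V := V) (N := N)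
  obtain ⟨f, hf⟩ := exists_linearMap_P (k := k) (V := V) (N := N) (M := TQA k V N) 0
    (fun p => pa k N p.1) fun p => by
    rw [idem, ten_smul_A, vtx_mul rfl, mul_vtx rfl]
  refine ⟨f, fun ⟨α, x, β⟩ => ?_⟩
  dsimp only
  have key : f (elemP 0 1 x 1) = toA k V N x := by
    induction x using gr_induction with
    | path p hp => rw [coe_inGr hp]; exact hf ⟨p, hp⟩
    | zero => rw [elemP_zero, map_zero]; exact (map_zero _).symm
    | add x y hx hy => rw [elemP_add, map_add, hx, hy, Submodule.coe_add, map_add]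
    | smul c x hx =>
      have h2 : f (c • elemP 0 1 x 1) = c • f (elemP 0 1 x 1) :=
        (f.restrictScalars k).map_smul c _
      rw [elemP_smul, h2, hx, Submodule.coe_smul, map_smul]
  rw [elemP_eq_smul, map_smul, key, ten_smul_A]

theorem epsP_elemP (α : TQA k V N) (x : gr k V (mdeg N 0)) (β : TQA k V N) :
    epsP k V N (elemP 0 α x β) = α * toA k V N x * β :=
  linExt_apply exists_epsP (α, x, β)

theorem epsP_cutP {w : Pth V} {j : ℕ} (h : j ≤ len w) :
    epsP k V N (cutP k N 0 w j) = pa k N w := by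
  have h0 : mdeg N 0 = 0 := mdeg_zero
  have e2 := joinP_seg_rest (w := w) (i := j) (l := mdeg N 0) (by omega)
  have e3 := joinP_seg_rest (w := w) (i := 0) (l := j) (by omega)
  rw [zero_add] at e3
  rw [cutP, epsP_elemP, coe_inGr (len_seg (by omega))]
  change _ * pa k N _ * _ = _
  rw [mul_assoc, pa_mul (seg_tgt (by omega)), e2, pa_mul (by rw [seg_tgt (by omega), zero_add]),
    e3, rest_zero]

variable (k N) in
/-- The value of the contracting homotopy of the minimal resolution on `cutP k N n w j`. In even
degrees, all the arrows of the left factor are moved, one after the other, to the middle; in odd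
degrees, the left factor is absorbed in the middle if it has the maximal length `N - 1`. -/
def homotopyPVal (n : ℕ) (w : Pth V) (j : ℕ) : P k V N (n + 1) :=
  if Even n then (if j < N then ∑ i ∈ Finset.range j, cutP k N (n + 1) w i else 0)
  else if j + 1 = N then cutP k N (n + 1) w 0 else 0

theorem exists_homotopyP (n : ℕ) : ∃ h : P k V N n →ₗ[k] P k V N (n + 1),
    ∀ (w : Pth V) (j : ℕ), j + mdeg N n ≤ len w → h (cutP k N n w j) = homotopyPVal k N n w j := by
  obtain ⟨h, hh⟩ := exists_linearMap_composables (isFreeBy_genP (k := k) (V := V) (N := N) n)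
    (fun p s q => homotopyPVal k N n (joinP p (joinP s.1 q)) (len p))
  refine ⟨h, fun w j hw => ?_⟩
  by_cases hj : j < N
  · by_cases hr : len w < j + mdeg N n + N
    · have e1 : (seg w 0 j).2.1 = (seg w j (mdeg N n)).1 := by
        rw [seg_tgt (by omega), seg_src, zero_add]
      have e2 : (seg w j (mdeg N n)).2.1 = (rest w (j + mdeg N n)).1 := seg_tgt hw
      have := hh (seg w 0 j) (rest w (j + mdeg N n)) ⟨seg w j (mdeg N n), len_seg hw⟩ e1 e2
        (by rwa [len_seg (by omega)]) (by rw [len_rest hw]; omega)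
      have e3 := joinP_seg_rest (w := w) (i := 0) (l := j) (by omega)
      rw [zero_add, rest_zero] at e3
      rw [genP, ten_smul_elemP, mul_one, one_mul, joinP_seg_rest hw, e3, len_seg (by omega)] at this
      exact this
    · rw [cutP_eq_zero_right (by omega), map_zero, homotopyPVal]
      split_ifs with hn hN
      · have hm := mdeg_succ_of_even (N := N) hn
        refine (Finset.sum_eq_zero fun i hi => cutP_eq_zero_right ?_).symm
        rw [Finset.mem_range] at hi; omega
      · have hm := mdeg_succ_of_odd (N := N) hn
        exact (cutP_eq_zero_right (by omega)).symm
      · rfl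
  · rw [cutP_eq_zero_left hw (by omega), map_zero, homotopyPVal, if_neg hj,
      if_neg (show ¬ j + 1 = N by omega), ite_self]

variable (k V N) in
/-- The contracting homotopy of the minimal resolution. -/
def homotopyP (n : ℕ) : P k V N n →ₗ[k] P k V N (n + 1) := (exists_homotopyP n).choose

theorem homotopyP_of_even {n : ℕ} (hn : Even n) {w : Pth V} {j : ℕ} (h : j + mdeg N n ≤ len w)
    (hj : j < N) : homotopyP k V N n (cutP k N n w j) =
      ∑ i ∈ Finset.range j, cutP k N (n + 1) w i := by
  rw [homotopyP, (exists_homotopyP n).choose_spec w j h, homotopyPVal, if_pos hn, if_pos hj]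

theorem homotopyP_of_odd {n : ℕ} (hn : ¬ Even n) {w : Pth V} {j : ℕ} (h : j + mdeg N n ≤ len w) :
    homotopyP k V N n (cutP k N n w j) = if j + 1 = N then cutP k N (n + 1) w 0 else 0 := by
  rw [homotopyP, (exists_homotopyP n).choose_spec w j h, homotopyPVal, if_neg hn]

variable (k V N) in
/-- The contracting homotopy of the minimal resolution, in degree `-1`. -/
def homotopyPAug : TQA k V N →ₗ[k] P k V N 0 :=
  (basisA k V N).constr k fun p => cutP k N 0 p.1 0

theorem homotopyPAug_pa (w : Pth V) : homotopyPAug k V N (pa k N w) = cutP k N 0 w 0 := by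
  by_cases h : len w < N
  · have := (basisA k V N).constr_basis k (fun p => cutP k N 0 p.1 0) ⟨w, h⟩
    rwa [basisA_apply] at this
  · rw [pa_eq_zero (by omega), map_zero, cutP_eq_zero_right (by rw [mdeg_zero]; omega)]

theorem epsP_homotopyPAug (a : TQA k V N) : epsP k V N (homotopyPAug k V N a) = a := by
  have := isScalarTower_A (k := k) (V := V) (N := N)
  refine linearMap_ext_pa (f := (epsP k V N).restrictScalars k ∘ₗ homotopyPAug k V N)
    (g := LinearMap.id) (fun w => ?_) a
  rw [LinearMap.comp_apply, LinearMap.restrictScalars_apply, homotopyPAug_pa,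
    epsP_cutP (Nat.zero_le _), LinearMap.id_apply]

theorem d_homotopyP_zero (x : P k V N 0) :
    d k V N 0 (homotopyP k V N 0 x) + homotopyPAug k V N (epsP k V N x) = x := by
  have := isScalarTower_A (k := k) (V := V) (N := N)
  have key : (d k V N 0).restrictScalars k ∘ₗ homotopyP k V N 0 +
      homotopyPAug k V N ∘ₗ (epsP k V N).restrictScalars k = LinearMap.id := by
    refine eq_of_cutP 0 fun w j h => ?_
    have h0 : mdeg N 0 = 0 := mdeg_zero
    simp only [LinearMap.add_apply, LinearMap.comp_apply, LinearMap.restrictScalars_apply,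
      LinearMap.id_apply]
    rw [epsP_cutP (by omega), homotopyPAug_pa]
    by_cases hj : j < N
    · rw [homotopyP_of_even Even.zero h hj, map_sum, Finset.sum_congr rfl fun i hi =>
        d_cutP_of_even Even.zero (j := i) (by
          rw [Finset.mem_range] at hi
          rw [mdeg_succ_of_even Even.zero]; omega), Finset.sum_range_sub, sub_add_cancel]
    · rw [cutP_eq_zero_left h (by omega), cutP_eq_zero_right (by omega), map_zero, map_zero,
        add_zero]
  exact LinearMap.congr_fun key x

theorem d_homotopyP_succ (n : ℕ) (x : P k V N (n + 1)) :
    d k V N (n + 1) (homotopyP k V N (n + 1) x) + homotopyP k V N n (d k V N n x) = x := by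
  have key : (d k V N (n + 1)).restrictScalars k ∘ₗ homotopyP k V N (n + 1) +
      homotopyP k V N n ∘ₗ (d k V N n).restrictScalars k = LinearMap.id := by
    refine eq_of_cutP (n + 1) fun w j h => ?_
    simp only [LinearMap.add_apply, LinearMap.comp_apply, LinearMap.restrictScalars_apply,
      LinearMap.id_apply]
    by_cases hj : j < N
    · by_cases hn : Even n
      · have hm := mdeg_succ_of_even (N := N) hn
        have hn' := not_even_succ hn
        have hm' := mdeg_succ_of_odd (N := N) hn'
        rw [homotopyP_of_odd hn' h, d_cutP_of_even hn h, map_sub,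
          homotopyP_of_even hn (j := j) (by omega) hj]
        split_ifs with hN
        · rw [d_cutP_of_odd hn' (by omega), cutP_eq_zero_left (j := j + 1) (by omega) (by omega),
            map_zero, zero_sub, ← hN, Finset.sum_range_succ]
          simp only [zero_add]
          rw [add_neg_cancel_comm]
        · rw [homotopyP_of_even hn (by omega) (by omega), Finset.sum_range_succ, map_zero, zero_add,
            add_sub_cancel_left]
      · have hm := mdeg_succ_of_odd (N := N) hn
        have hn' := even_succ hn
        have hm' := mdeg_succ_of_even (N := N) hn'
        rw [homotopyP_of_even hn' h hj, map_sum, Finset.sum_congr rfl fun i hi =>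
          d_cutP_of_even hn' (j := i) (by rw [Finset.mem_range] at hi; omega),
          Finset.sum_range_sub, d_cutP_of_odd hn h, map_sum, Finset.sum_congr rfl fun i hi =>
          homotopyP_of_odd hn (j := j + i) (by rw [Finset.mem_range] at hi; omega),
          Finset.sum_eq_single (N - 1 - j)]
        · rw [if_pos (by omega), sub_add_cancel]
        · intro i _ hi
          rw [if_neg (by omega)]
        · intro hi
          rw [Finset.mem_range] at hi; omega
    · rw [cutP_eq_zero_left h (by omega), map_zero, map_zero, map_zero, map_zero, add_zero]
  exact LinearMap.congr_fun key x

theorem epsP_d (x : P k V N 1) : epsP k V N (d k V N 0 x) = 0 := by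
  have := isScalarTower_A (k := k) (V := V) (N := N)
  have key : (epsP k V N).restrictScalars k ∘ₗ (d k V N 0).restrictScalars k = 0 := by
    refine eq_of_cutP 1 fun w j h => ?_
    change j + mdeg N (0 + 1) ≤ len w at h
    have hm := mdeg_succ_of_even (N := N) Even.zero
    simp only [LinearMap.comp_apply, LinearMap.restrictScalars_apply, LinearMap.zero_apply]
    rw [d_cutP_of_even Even.zero h, map_sub, epsP_cutP (by omega), epsP_cutP (by omega), sub_self]
  exact LinearMap.congr_fun key x

theorem d_d (n : ℕ) (x : P k V N (n + 2)) : d k V N n (d k V N (n + 1) x) = 0 := by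
  have key : (d k V N n).restrictScalars k ∘ₗ (d k V N (n + 1)).restrictScalars k = 0 := by
    refine eq_of_cutP (n + 2) fun w j h => ?_
    change j + mdeg N (n + 1 + 1) ≤ len w at h
    simp only [LinearMap.comp_apply, LinearMap.restrictScalars_apply, LinearMap.zero_apply]
    by_cases hn : Even n
    · have hm := mdeg_succ_of_even (N := N) hn
      have hn' := not_even_succ hn
      have hm' := mdeg_succ_of_odd (N := N) hn'
      rw [d_cutP_of_odd hn' h, map_sum, Finset.sum_congr rfl fun i hi =>
        d_cutP_of_even hn (j := j + i) (by rw [Finset.mem_range] at hi; omega)]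
      have := Finset.sum_range_sub (fun i => cutP k N n w (j + i)) N
      simp only [← add_assoc] at this
      rw [this, cutP_eq_zero_left (by omega) (by omega), cutP_eq_zero_right (by omega), sub_self]
    · have hm := mdeg_succ_of_odd (N := N) hn
      have hn' := even_succ hn
      have hm' := mdeg_succ_of_even (N := N) hn'
      rw [d_cutP_of_even hn' h, map_sub, d_cutP_of_odd hn (by omega), d_cutP_of_odd hn (by omega),
        ← Finset.sum_sub_distrib]
      have := Finset.sum_range_sub (fun i => cutP k N n w (j + i)) N
      simp only [add_right_comm j 1, add_assoc j _ 1] at this ⊢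
      rw [this, cutP_eq_zero_left (by omega) (by omega), cutP_eq_zero_right (by omega), sub_self]
  exact LinearMap.congr_fun key x

/-- The complex `P` is a projective resolution of `A`. -/
theorem isProjRes_P : IsProjRes (P k V N) (d k V N) (epsP k V N) :=
  IsProjRes.of_homotopy (fun n => (isFreeBy_genP n).projective)
    (fun n => (homotopyP k V N n).toAddMonoidHom) (homotopyPAug k V N).toAddMonoidHom
    epsP_homotopyPAug d_homotopyP_zero d_homotopyP_succ epsP_d d_d

end MinimalResolution

/-! ### Decompositions of a path into consecutive subpaths -/

section Words

variable {V : Type v} [Quiver.{w} V]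

/-- The sum of the first `m` entries of a tuple of natural numbers. -/
def psum {n : ℕ} (c : Fin n → ℕ) (m : ℕ) : ℕ := ∑ j : Fin n, if (j : ℕ) < m then c j else 0

theorem sum_Iio {n : ℕ} (c : Fin n → ℕ) (i : Fin n) : ∑ j ∈ Finset.Iio i, c j = psum c i := by
  rw [psum, ← Finset.sum_filter]
  refine Finset.sum_congr ?_ fun _ _ => rfl
  ext j; simp

theorem psum_zero {n : ℕ} (c : Fin n → ℕ) : psum c 0 = 0 := by simp [psum]

theorem psum_full {n : ℕ} (c : Fin n → ℕ) : psum c n = ∑ i, c i := by simp [psum]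

theorem psum_succ {n : ℕ} (c : Fin n → ℕ) (i : Fin n) : psum c (i + 1) = psum c i + c i := by
  rw [← sum_Iio, psum, ← Finset.sum_filter]
  have : Finset.univ.filter (fun j : Fin n => (j : ℕ) < i + 1) = insert i (Finset.Iio i) := by
    ext j; simp only [Finset.mem_filter, Finset.mem_univ, true_and, Finset.mem_insert,
      Finset.mem_Iio, Fin.ext_iff, Fin.lt_def]; omega
  rw [this, Finset.sum_insert (by simp), add_comm]

theorem psum_mono {n : ℕ} (c : Fin n → ℕ) {l m : ℕ} (h : l ≤ m) : psum c l ≤ psum c m := by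
  refine Finset.sum_le_sum fun j _ => ?_
  split_ifs <;> omega

theorem psum_le_sum {n : ℕ} (c : Fin n → ℕ) (m : ℕ) : psum c m ≤ ∑ i, c i := by
  refine Finset.sum_le_sum fun j _ => ?_
  split_ifs <;> omega

theorem psum_add_le {n : ℕ} (c : Fin n → ℕ) (i : Fin n) : psum c i + c i ≤ ∑ i, c i := by
  rw [← psum_succ]; exact psum_le_sum c _

theorem psum_cons {n : ℕ} (c : Fin (n + 1) → ℕ) (m : ℕ) :
    psum c (m + 1) = c 0 + psum (Fin.tail c) m := by
  simp [psum, Fin.sum_univ_succ, Fin.tail]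

/-- A path is determined by its source and by its consecutive subpaths of given lengths. -/
theorem eq_of_seg_eq {n : ℕ} (c : Fin n → ℕ) {x y : Pth V} (hx : ∑ i, c i = len x)
    (hy : ∑ i, c i = len y) (h0 : x.1 = y.1)
    (h : ∀ i : Fin n, seg x (psum c i) (c i) = seg y (psum c i) (c i)) : x = y := by
  have key : ∀ m, m ≤ n → seg x 0 (psum c m) = seg y 0 (psum c m) := by
    intro m
    induction m with
    | zero => intro _; rw [psum_zero, seg_len_zero, seg_len_zero, h0]
    | succ m ih =>
      intro hm
      have hi := h ⟨m, hm⟩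
      have hs := psum_succ c ⟨m, hm⟩
      have hl := psum_add_le c ⟨m, hm⟩
      dsimp only at hi hs hl
      have e1 := joinP_seg_seg (w := x) (i := 0) (l := psum c m) (l' := c ⟨m, hm⟩) (by omega)
      have e2 := joinP_seg_seg (w := y) (i := 0) (l := psum c m) (l' := c ⟨m, hm⟩) (by omega)
      rw [zero_add] at e1 e2
      rw [hs, ← e1, ← e2, ih (by omega), hi]
  have := key n le_rfl
  rwa [psum_full, seg_full hx.symm, seg_full hy.symm] at this

theorem seg_joinP_of_le {p q : Pth V} (h : p.2.1 = q.1) {i l : ℕ} (hi : i + l ≤ len p) :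
    seg (joinP p q) i l = seg p i l := by
  have e := seg_joinP_left h
  have := seg_seg (w := joinP p q) (j := 0) (m := len p) (i := i) (l := l)
    (by rw [len_joinP h]; omega) hi
  rwa [e, zero_add, eq_comm] at this

theorem seg_joinP_right {p q : Pth V} (h : p.2.1 = q.1) :
    seg (joinP p q) (len p) (len q) = q := by
  have e := rest_joinP h
  rwa [rest_eq_seg (by rw [len_joinP h]; omega), len_joinP h, Nat.add_sub_cancel_left] at e

/-- Composable paths are the consecutive subpaths of their concatenation. -/
theorem exists_word {n : ℕ} (t : Fin n → Pth V) (a : V) (h0 : ∀ h : 0 < n, a = (t ⟨0, h⟩).1)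
    (h : ∀ (i : ℕ) (hi : i + 1 < n), (t ⟨i, by omega⟩).2.1 = (t ⟨i + 1, hi⟩).1) :
    ∃ x : Pth V, x.1 = a ∧ ∑ i, len (t i) = len x ∧
      ∀ i : Fin n, seg x (psum (fun i => len (t i)) i) (len (t i)) = t i := by
  set c : Fin n → ℕ := fun i => len (t i) with hc
  have key : ∀ m, m ≤ n → ∃ x : Pth V, x.1 = a ∧ len x = psum c m ∧
      (∀ hm : m < n, x.2.1 = (t ⟨m, hm⟩).1) ∧
      ∀ i : Fin n, (i : ℕ) < m → seg x (psum c i) (len (t i)) = t i := by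
    intro m
    induction m with
    | zero =>
      exact fun _ => ⟨vtx a, rfl, by rw [psum_zero]; rfl, h0, fun i hi => absurd hi (by omega)⟩
    | succ m ih =>
      intro hm
      obtain ⟨x, hx1, hx2, hx3, hx4⟩ := ih (by omega)
      have hj := hx3 (by omega)
      have hs := psum_succ c ⟨m, hm⟩
      dsimp only at hs
      refine ⟨joinP x (t ⟨m, hm⟩), by rw [joinP_src, hx1], ?_, ?_, ?_⟩
      · rw [len_joinP hj, hx2, hs]
      · intro hm'
        rw [joinP_tgt hj]; exact h m hm'
      · intro i hi
        rcases Nat.lt_succ_iff_lt_or_eq.1 hi with hi | hi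
        · rw [seg_joinP_of_le hj, hx4 i hi]
          have h1 := psum_succ c i
          have h2 := psum_mono c (l := i + 1) (m := m) (by omega)
          have h3 : psum c i + len (t i) ≤ len x := by
            rw [hx2]; exact (h1.symm.trans_le h2 :)
          exact h3
        · have hi' : i = ⟨m, hm⟩ := Fin.ext hi
          subst hi'
          rw [← hx2]; exact seg_joinP_right hj
  obtain ⟨x, hx1, hx2, -, hx4⟩ := key n le_rfl
  exact ⟨x, hx1, by rw [hx2, psum_full], fun i => hx4 i i.2⟩

theorem barWord_add_le {n N : ℕ} (q : BarWord V N n) (i : Fin n) :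
    psum q.lens i + q.lens i ≤ len q.path := by
  rw [← q.sum_eq]; exact psum_add_le _ _

theorem len_seg_barWord {n N : ℕ} (q : BarWord V N n) (i : Fin n) :
    len (seg q.path (psum q.lens i) (q.lens i)) = q.lens i := len_seg (barWord_add_le q i)

/-- A word of paths is determined by its source and by the paths. -/
theorem barWord_ext {n N : ℕ} {q q' : BarWord V N n} (h0 : q.path.1 = q'.path.1)
    (h : ∀ i : Fin n, seg q.path (psum q.lens i) (q.lens i) =
      seg q'.path (psum q'.lens i) (q'.lens i)) :
    q = q' := by
  have hl : q.lens = q'.lens := by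
    funext i
    rw [← len_seg_barWord q i, h i, len_seg_barWord]
  have hp : q.path = q'.path := by
    refine eq_of_seg_eq q.lens q.sum_eq (by rw [hl, q'.sum_eq]) h0 fun i => ?_
    rw [h i, hl]
  cases q; cases q'
  dsimp only at hl hp
  subst hl hp; rfl

end Words

/-! ### The bimodules of the reduced bar resolution -/

section BarBimodules

variable {k : Type u} [Field k] {V : Type v} [Quiver.{w} V] [Fintype V] {N : ℕ}

instance (n : ℕ) : Module k (Q k V N n) := Module.compHom _ (algebraMap k (Env k V N))

theorem smul_Q_def (n : ℕ) (c : k) (x : Q k V N n) : c • x = algebraMap k (Env k V N) c • x := rfl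

instance (n : ℕ) : IsScalarTower k (Env k V N) (Q k V N n) := ⟨fun c r x => by
  rw [smul_Q_def, ← mul_smul, ← Algebra.smul_def]⟩

theorem ten_add_left (a b β : TQA k V N) : ten (a + b) β = ten a β + ten b β :=
  TensorProduct.add_tmul _ _ _

theorem ten_add_right (α a b : TQA k V N) : ten α (a + b) = ten α a + ten α b :=
  TensorProduct.tmul_add _ _ _

theorem ten_smul_left (c : k) (a β : TQA k V N) : ten (c • a) β = c • ten a β :=
  (TensorProduct.smul_tmul' _ _ _).symm

theorem ten_smul_right (c : k) (a β : TQA k V N) : ten a (c • β) = c • ten a β :=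
  TensorProduct.tmul_smul c a (MulOpposite.op β)

section SeqMap

variable {M : Type*} [AddCommGroup M] [Module (Env k V N) M] [Module k M]
  [IsScalarTower k (Env k V N) M]

/-- The middle entries of a sequence of elements of `A`, projected to `A_+`. -/
def mid {n : ℕ} (s : Fin (n + 2) → TQA k V N) : Fin n → Aplus k V N :=
  fun i => plus k V N (s i.castSucc.succ)

theorem mid_update_zero {n : ℕ} (s : Fin (n + 2) → TQA k V N) (x : TQA k V N) :
    mid (Function.update s 0 x) = mid s := by
  funext i
  rw [mid, Function.update_of_ne (Fin.succ_ne_zero _), mid]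

theorem mid_update_last {n : ℕ} (s : Fin (n + 2) → TQA k V N) (x : TQA k V N) :
    mid (Function.update s (Fin.last (n + 1)) x) = mid s := by
  funext i
  rw [mid, Function.update_of_ne, mid]
  rw [← Fin.succ_last]
  exact fun h => (Fin.castSucc_lt_last i).ne (Fin.succ_injective _ h)

theorem mid_update_mid {n : ℕ} (s : Fin (n + 2) → TQA k V N) (i : Fin n) (x : TQA k V N) :
    mid (Function.update s i.castSucc.succ x) = Function.update (mid s) i (plus k V N x) := by
  funext j
  by_cases h : j = i
  · subst h; simp [mid]
  · rw [Function.update_of_ne h, mid, Function.update_of_ne, mid]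
    exact fun h' => h (Fin.castSucc_injective _ (Fin.succ_injective _ h'))

/-- The multilinear map `(s_0, …, s_{n+1}) ↦ s_0 θ(s_1 ⊗ … ⊗ s_n) s_{n+1}`, where the inner entries
are projected to `A_+`. -/
def seqMap {n : ℕ} (θ : (⨂[k] _ : Fin n, Aplus k V N) →ₗ[k] M) :
    MultilinearMap k (fun _ : Fin (n + 2) => TQA k V N) M :=
  MultilinearMap.mk'
    (fun s => ten (s 0) (s (Fin.last (n + 1))) • θ (PiTensorProduct.tprod k (mid s)))
    (by
      intro s i x y
      have h0 : (Fin.last (n + 1)) ≠ 0 := (Fin.last_pos).ne'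
      induction i using Fin.cases with
      | zero =>
        simp only [Function.update_self, Function.update_of_ne h0, mid_update_zero, ten_add_left,
          add_smul]
      | succ i =>
        induction i using Fin.lastCases with
        | last =>
          simp only [Fin.succ_last, Function.update_self, Function.update_of_ne h0.symm,
            mid_update_last, ten_add_right, add_smul]
        | cast i =>
          have h1 : (0 : Fin (n + 2)) ≠ i.castSucc.succ := (Fin.succ_ne_zero _).symm
          have h2 : Fin.last (n + 1) ≠ i.castSucc.succ := by
            rw [← Fin.succ_last]
            exact fun h => (Fin.castSucc_lt_last i).ne' (Fin.succ_injective _ h)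
          simp only [Function.update_of_ne h1, Function.update_of_ne h2, mid_update_mid, map_add,
            MultilinearMap.map_update_add, smul_add])
    (by
      intro s i c x
      have h0 : (Fin.last (n + 1)) ≠ 0 := (Fin.last_pos).ne'
      induction i using Fin.cases with
      | zero =>
        simp only [Function.update_self, Function.update_of_ne h0, mid_update_zero, ten_smul_left,
          smul_assoc]
      | succ i =>
        induction i using Fin.lastCases with
        | last =>
          simp only [Fin.succ_last, Function.update_self, Function.update_of_ne h0.symm,
            mid_update_last, ten_smul_right, smul_assoc]
        | cast i =>
          have h1 : (0 : Fin (n + 2)) ≠ i.castSucc.succ := (Fin.succ_ne_zero _).symm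
          have h2 : Fin.last (n + 1) ≠ i.castSucc.succ := by
            rw [← Fin.succ_last]
            exact fun h => (Fin.castSucc_lt_last i).ne' (Fin.succ_injective _ h)
          have : SMulCommClass k (Env k V N) M := IsScalarTower.to_smulCommClass
          simp only [Function.update_of_ne h1, Function.update_of_ne h2, mid_update_mid, map_smul,
            MultilinearMap.map_update_smul]
          rw [smul_comm])

theorem seqMap_apply {n : ℕ} (θ : (⨂[k] _ : Fin n, Aplus k V N) →ₗ[k] M)
    (s : Fin (n + 2) → TQA k V N) : seqMap θ s =
      ten (s 0) (s (Fin.last (n + 1))) • θ (PiTensorProduct.tprod k (mid s)) := rfl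

end SeqMap

theorem fullSeq_zero {n : ℕ} (α : TQA k V N) (a : Fin n → Aplus k V N) (β : TQA k V N) :
    fullSeq α a β 0 = α := rfl

theorem fullSeq_last {n : ℕ} (α : TQA k V N) (a : Fin n → Aplus k V N) (β : TQA k V N) :
    fullSeq α a β (Fin.last (n + 1)) = β := by
  rw [fullSeq, ← Fin.succ_last, Fin.cons_succ, Fin.snoc_last]

theorem fullSeq_mid {n : ℕ} (α : TQA k V N) (a : Fin n → Aplus k V N) (β : TQA k V N) (i : Fin n) :
    fullSeq α a β i.castSucc.succ = a i := by
  rw [fullSeq, Fin.cons_succ, Fin.snoc_castSucc]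

theorem mid_fullSeq {n : ℕ} (α : TQA k V N) (a : Fin n → Aplus k V N) (β : TQA k V N) :
    mid (fullSeq α a β) = a := by
  funext i
  rw [mid, fullSeq_mid, plus_coe]

theorem smul_tQ {n : ℕ} (a b α β : TQA k V N) (x : Fin n → Aplus k V N) :
    ten a b • tQ α x β = tQ (a * α) x (β * b) :=
  (TensorProduct.smul_tmul' (ten a b) (ten α β) (PiTensorProduct.tprod k x)).trans
    (congrArg (fun r : Env k V N => r ⊗ₜ[k] PiTensorProduct.tprod k x) (ten_mul a b α β))

theorem ten_smul_elemQ {n : ℕ} (a b α β : TQA k V N) (x : Fin n → Aplus k V N) :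
    ten a b • elemQ α x β = elemQ (a * α) x (β * b) := by
  rw [elemQ, ← map_smul, smul_tQ]; rfl

theorem elemQ_eq_smul {n : ℕ} (α β : TQA k V N) (x : Fin n → Aplus k V N) :
    elemQ α x β = ten α β • elemQ 1 x 1 := by
  rw [ten_smul_elemQ, mul_one, one_mul]

variable (k V N) in
/-- The map `a_1 ⊗ … ⊗ a_n ↦ 1[a_1|…|a_n]1`. -/
def bracket (n : ℕ) : (⨂[k] _ : Fin n, Aplus k V N) →ₗ[k] Q k V N n where
  toFun t := projQ k V N n ((1 : Env k V N) ⊗ₜ[k] t)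
  map_add' x y := (congrArg (projQ k V N n) (TensorProduct.tmul_add _ _ _)).trans (map_add _ _ _)
  map_smul' c x := by
    rw [RingHom.id_apply, smul_Q_def]
    refine Eq.trans ?_ (map_smul (projQ k V N n) _ _)
    refine congrArg (projQ k V N n) ?_
    refine (TensorProduct.tmul_smul c (1 : Env k V N) x).trans ?_
    refine (TensorProduct.smul_tmul' c (1 : Env k V N) x).trans ?_
    refine Eq.trans ?_
      (TensorProduct.smul_tmul' (algebraMap k (Env k V N) c) (1 : Env k V N) x).symm
    refine congrArg (fun r : Env k V N => r ⊗ₜ[k] x) ?_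
    rw [smul_eq_mul, mul_one, Algebra.algebraMap_eq_smul_one]

theorem bracket_tprod (n : ℕ) (a : Fin n → Aplus k V N) :
    bracket k V N n (PiTensorProduct.tprod k a) = elemQ 1 a 1 := rfl

variable (k V N) in
/-- The multilinear map `(s_0, …, s_{n+1}) ↦ s_0[s_1|…|s_n]s_{n+1}`. -/
def elemSeq (n : ℕ) : MultilinearMap k (fun _ : Fin (n + 2) => TQA k V N) (Q k V N n) :=
  seqMap (bracket k V N n)

theorem elemSeq_apply (n : ℕ) (s : Fin (n + 2) → TQA k V N) :
    elemSeq k V N n s = elemQ (s 0) (mid s) (s (Fin.last (n + 1))) := by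
  rw [elemSeq, seqMap_apply, bracket_tprod, ← elemQ_eq_smul]

theorem elemSeq_fullSeq {n : ℕ} (α : TQA k V N) (a : Fin n → Aplus k V N) (β : TQA k V N) :
    elemSeq k V N n (fullSeq α a β) = elemQ α a β := by
  rw [elemSeq_apply, fullSeq_zero, fullSeq_last, mid_fullSeq]

/-- A change `f` of one entry of a sequence commutes with the projection of the inner entries to
`A_+`, if `f` commutes with the projection `plus`. -/
theorem fullSeq_mid_update {n : ℕ} (s : Fin (n + 2) → TQA k V N) (j : Fin (n + 2))
    {f : TQA k V N → TQA k V N}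
    (hf : ∀ x, (plus k V N (f x) : TQA k V N) = f (plus k V N x)) :
    let u := Function.update s j (f (s j))
    let z := fullSeq (s 0) (mid s) (s (Fin.last (n + 1)))
    fullSeq (u 0) (mid u) (u (Fin.last (n + 1))) = Function.update z j (f (z j)) := by
  intro u z
  have hz0 : z 0 = s 0 := fullSeq_zero _ _ _
  have hzl : z (Fin.last (n + 1)) = s (Fin.last (n + 1)) := fullSeq_last _ _ _
  have hzm : ∀ i : Fin n, z i.castSucc.succ = plus k V N (s i.castSucc.succ) := fullSeq_mid _ _ _
  funext i
  by_cases h : i = j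
  · subst h
    rw [Function.update_self]
    induction i using Fin.cases with
    | zero => rw [fullSeq_zero, hz0]; exact Function.update_self _ _ _
    | succ i =>
      induction i using Fin.lastCases with
      | last => rw [Fin.succ_last, fullSeq_last, hzl]; exact Function.update_self _ _ _
      | cast i =>
        rw [fullSeq_mid, hzm, ← hf]
        simp only [u, mid, Function.update_self]
  · rw [Function.update_of_ne h]
    have hu : u i = s i := Function.update_of_ne h _ _
    induction i using Fin.cases with
    | zero => rw [fullSeq_zero, hz0, hu]
    | succ i =>
      induction i using Fin.lastCases with
      | last => rw [Fin.succ_last, fullSeq_last, hzl, ← Fin.succ_last, hu]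
      | cast i => rw [fullSeq_mid, hzm, mid, hu]

/-- Elements of `kΔ_0` may be moved across any of the bars. -/
theorem elemSeq_rel {n : ℕ} (s : Fin (n + 2) → TQA k V N) (i : Fin (n + 1)) {c : PathAlg k V}
    (hc : c ∈ gr k V 0) :
    elemSeq k V N n (Function.update s i.castSucc (s i.castSucc * toA k V N c)) =
      elemSeq k V N n (Function.update s i.succ (toA k V N c * s i.succ)) := by
  rw [elemSeq_apply, elemSeq_apply, ← sub_eq_zero, elemQ, elemQ, ← map_sub]
  refine (Submodule.Quotient.mk_eq_zero _).2 (Submodule.subset_span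
    ⟨_, _, _, _, _, _, fullSeq (s 0) (mid s) (s (Fin.last (n + 1))), i, c, hc, ?_, ?_, rfl⟩)
  · exact fullSeq_mid_update s i.castSucc (f := fun x => x * toA k V N c)
      (plus_mul_gr_zero hc)
  · exact fullSeq_mid_update s i.succ (f := fun x => toA k V N c * x) (plus_gr_zero_mul hc)

theorem elemSeq_vtx {n : ℕ} {s : Fin (n + 2) → TQA k V N} (i : Fin (n + 1)) {a : V}
    (h : s i.castSucc * pa k N (vtx a) = s i.castSucc) :
    elemSeq k V N n s = elemSeq k V N n (Function.update s i.succ (pa k N (vtx a) * s i.succ)) := by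
  have := elemSeq_rel s i (vtx_mem_gr a)
  change elemSeq k V N n (Function.update s i.castSucc (s i.castSucc * pa k N (vtx a))) = _ at this
  rwa [h, Function.update_eq_self] at this

/-- A sequence with two neighbouring entries which are not composable gives zero. -/
theorem elemSeq_eq_zero {n : ℕ} {s : Fin (n + 2) → TQA k V N} (i : Fin (n + 1)) {a : V}
    (h : s i.castSucc * pa k N (vtx a) = s i.castSucc) (h' : pa k N (vtx a) * s i.succ = 0) :
    elemSeq k V N n s = 0 := by
  rw [elemSeq_vtx i h, h']
  exact (elemSeq k V N n).map_coord_zero i.succ (Function.update_self _ _ _)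

/-! ### Words of paths generate the reduced bar resolution -/

theorem pieces_apply {n : ℕ} (p : Pth V) (c : Fin n → ℕ) (i : Fin n) :
    pieces k N p c i = pathPlus k N (seg p (psum c i) (c i)) := by
  rw [pieces, sum_Iio]

theorem coe_pieces {n : ℕ} (q : BarWord V N n) (i : Fin n) :
    (pieces k N q.path q.lens i : TQA k V N) = pa k N (seg q.path (psum q.lens i) (q.lens i)) := by
  rw [pieces_apply, coe_pathPlus (by rw [len_seg_barWord]; exact q.one_le i)]

theorem elemQ_one_eq_sum {n : ℕ} (a : Fin n → Aplus k V N) :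
    elemQ 1 a 1 = ∑ x : V, elemQ (pa k N (vtx x)) a 1 := by
  have h : ∀ s : Finset V, ten (∑ x ∈ s, pa k N (vtx x)) 1 = ∑ x ∈ s, ten (pa k N (vtx x)) 1 :=
    fun s => TensorProduct.sum_tmul _ _ _
  have : ∀ x : V, elemQ (pa k N (vtx x)) a 1 = ten (pa k N (vtx x)) 1 • elemQ 1 a 1 :=
    fun x => elemQ_eq_smul _ _ _
  simp only [this]
  rw [← Finset.sum_smul, ← h, ← one_eq_sum_vtx, ten_one_one, one_smul]

/-- For paths `t_1, …, t_n`, the element `a[t_1|…|t_n]1`, where `a` is a vertex, is zero, unless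
it comes from a word of paths. -/
theorem elemQ_vtx_mem {n : ℕ} (t : Fin n → {p : Pth V // 1 ≤ len p ∧ len p < N}) (a : V) :
    elemQ (pa k N (vtx a)) (fun i => pathPlus k N (t i).1) 1 ∈
      Submodule.span k (Set.range fun q : BarWord V N n => barGen k N q) := by
  set s := fullSeq (pa k N (vtx a)) (fun i => pathPlus k N (t i).1) 1 with hs
  have hs0 : s 0 = pa k N (vtx a) := rfl
  have hsl : s (Fin.last (n + 1)) = 1 := fullSeq_last _ _ _
  have hsm : ∀ i : Fin n, s i.castSucc.succ = pa k N (t i).1 := fun i => by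
    rw [hs, fullSeq_mid, coe_pathPlus (t i).2.1]
  rw [← elemSeq_fullSeq, ← hs]
  by_cases h0 : ∀ h : 0 < n, a = (t ⟨0, h⟩).1.1
  · by_cases h : ∀ (i : ℕ) (hi : i + 1 < n), (t ⟨i, by omega⟩).1.2.1 = (t ⟨i + 1, hi⟩).1.1
    · obtain ⟨x, hx1, hx2, hx3⟩ := exists_word (fun i => (t i).1) a h0 h
      subst hx1
      let q : BarWord V N n :=
        ⟨x, fun i => len (t i).1, fun i => (t i).2.1, fun i => (t i).2.2, hx2⟩
      refine Submodule.subset_span ⟨q, ?_⟩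
      have hp : pieces k N q.path q.lens = fun i => pathPlus k N (t i).1 := by
        funext i; rw [pieces_apply]; exact congrArg _ (hx3 i)
      -- The final `1` may be replaced by the end vertex of the word.
      have hlast : s (Fin.last n).castSucc * pa k N (vtx q.path.2.1) = s (Fin.last n).castSucc := by
        rcases Nat.eq_zero_or_pos n with rfl | hn
        · change s 0 * pa k N (vtx q.path.2.1) = s 0
          have hx0 : len x = 0 := by rw [← hx2]; rfl
          have : x = vtx x.1 := eq_vtx_of_len hx0
          have h3 : q.path.2.1 = x.1 := by
            change x.2.1 = x.1
            rw [this]; rfl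
          rw [h3, hs0, vtx_mul_vtx]
        · obtain ⟨m, rfl⟩ : ∃ m, n = m + 1 := ⟨n - 1, by omega⟩
          have e : (Fin.last (m + 1)).castSucc = (Fin.last m).castSucc.succ := by
            ext; simp
          rw [e, hsm, mul_vtx]
          have h4 := psum_succ q.lens (Fin.last m)
          rw [Fin.val_last, psum_full, q.sum_eq] at h4
          rw [← hx3 (Fin.last m)]
          refine (seg_tgt (barWord_add_le q (Fin.last m))).trans ?_
          rw [Fin.val_last, ← h4, rest_len rfl]; rfl
      rw [elemSeq_vtx (Fin.last n) hlast, Fin.succ_last, hsl, mul_one]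
      have : Function.update s (Fin.last (n + 1)) (pa k N (vtx q.path.2.1)) =
          fullSeq (pa k N (vtx q.path.1)) (pieces k N q.path q.lens) (pa k N (vtx q.path.2.1)) := by
        rw [hs, fullSeq, fullSeq, ← Fin.succ_last, ← Fin.cons_update, Fin.update_snoc_last, hp]
      rw [this, elemSeq_fullSeq]; rfl
    · push Not at h
      -- The paths with numbers `i` and `i + 1` are not composable.
      obtain ⟨i, hi, hne⟩ := h
      obtain ⟨m, rfl⟩ : ∃ m, n = m + 1 := ⟨n - 1, by omega⟩
      rw [elemSeq_eq_zero (⟨i + 1, by omega⟩ : Fin (m + 1 + 1))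
        (a := (t ⟨i, by omega⟩).1.2.1)]
      · exact zero_mem _
      · have := hsm ⟨i, by omega⟩
        exact (congrArg (fun x => x * pa k N (vtx _)) this).trans ((mul_vtx rfl).trans this.symm)
      · have := hsm ⟨i + 1, hi⟩
        exact (congrArg (fun x => pa k N (vtx _) * x) this).trans (pa_mul_of_ne (by exact hne))
  · push Not at h0
    -- The first path does not start at `a`.
    obtain ⟨hn, hne⟩ := h0
    rw [elemSeq_eq_zero (s := s) 0 (a := a)]
    · exact zero_mem _
    · change s 0 * _ = s 0
      rw [hs0, vtx_mul_vtx]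
    · have := hsm ⟨0, hn⟩
      have e : (Fin.succ 0 : Fin (n + 2)) = (⟨0, hn⟩ : Fin n).castSucc.succ := by ext; rfl
      rw [e, this]
      exact pa_mul_of_ne (by exact hne)

/-- The elements `1[a_1|…|a_n]1` are linear combinations of the generators, with coefficients in `k`
rather than in the enveloping algebra. -/
theorem elemQ_one_mem {n : ℕ} (a : Fin n → Aplus k V N) :
    elemQ 1 a 1 ∈ Submodule.span k (Set.range fun q : BarWord V N n => barGen k N q) := by
  rw [← bracket_tprod]
  have h : LinearMap.range (bracket k V N n) ≤
      Submodule.span k (Set.range fun q : BarWord V N n => barGen k N q) := by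
    rw [← Submodule.map_top, ← (Basis.piTensorProduct fun _ : Fin n => basisPlus k V N).span_eq,
      Submodule.map_span, Submodule.span_le]
    rintro _ ⟨_, ⟨t, rfl⟩, rfl⟩
    rw [Basis.piTensorProduct_apply, bracket_tprod, elemQ_one_eq_sum]
    refine Submodule.sum_mem _ fun x _ => ?_
    simp only [basisPlus_apply]
    exact elemQ_vtx_mem t x
  exact h ⟨_, rfl⟩

theorem elemQ_mem_span {n : ℕ} (α : TQA k V N) (a : Fin n → Aplus k V N) (β : TQA k V N) :
    elemQ α a β ∈
      Submodule.span (Env k V N) (Set.range fun q : BarWord V N n => barGen k N q) := by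
  rw [elemQ_eq_smul]
  refine Submodule.smul_mem _ _ ?_
  have h : Submodule.span k (Set.range fun q : BarWord V N n => barGen k N q) ≤
      (Submodule.span (Env k V N)
        (Set.range fun q : BarWord V N n => barGen k N q)).restrictScalars k :=
    Submodule.span_le_restrictScalars _ _ _
  exact h (elemQ_one_mem a)

/-- Induction principle for `Q_n`. -/
theorem Q_induction {n : ℕ} {motive : Q k V N n → Prop}
    (elem : ∀ (α : TQA k V N) (a : Fin n → Aplus k V N) (β : TQA k V N), motive (elemQ α a β))
    (zero : motive 0) (add : ∀ x y, motive x → motive y → motive (x + y)) (x : Q k V N n) :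
    motive x := by
  obtain ⟨t, rfl⟩ : ∃ t, projQ k V N n t = x := Submodule.mkQ_surjective _ x
  refine TensorProduct.induction_on
    (motive := fun t : Env k V N ⊗[k] (⨂[k] _ : Fin n, Aplus k V N) => motive (projQ k V N n t))
    t ?_ ?_ ?_
  · exact (map_zero (projQ k V N n)) ▸ zero
  · intro r x
    induction x using PiTensorProduct.induction_on with
    | smul_tprod c a =>
      refine TensorProduct.induction_on (motive := fun r : Env k V N =>
        motive (projQ k V N n (r ⊗ₜ[k] (c • PiTensorProduct.tprod k a)))) r ?_ ?_ ?_
      · have : projQ k V N n ((0 : Env k V N) ⊗ₜ[k] (c • PiTensorProduct.tprod k a)) = 0 :=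
          (congrArg (projQ k V N n) (TensorProduct.zero_tmul _ _)).trans (map_zero _)
        rw [this]; exact zero
      · intro α β
        have h : projQ k V N n ((α ⊗ₜ[k] β : Env k V N) ⊗ₜ[k] (c • PiTensorProduct.tprod k a)) =
            elemQ (c • α) a β.unop := by
          refine congrArg (projQ k V N n) ?_
          refine (TensorProduct.tmul_smul c _ _).trans ?_
          refine (TensorProduct.smul_tmul' c _ _).trans ?_
          exact congrArg (fun r : Env k V N => r ⊗ₜ[k] PiTensorProduct.tprod k a)
            (TensorProduct.smul_tmul' c _ _)
        rw [h]; exact elem _ _ _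
      · intro r r' h h'
        have : projQ k V N n ((r + r' : Env k V N) ⊗ₜ[k] (c • PiTensorProduct.tprod k a)) =
            projQ k V N n (r ⊗ₜ[k] (c • PiTensorProduct.tprod k a)) +
            projQ k V N n (r' ⊗ₜ[k] (c • PiTensorProduct.tprod k a)) :=
          (congrArg (projQ k V N n) (TensorProduct.add_tmul _ _ _)).trans (map_add _ _ _)
        rw [this]; exact add _ _ h h'
    | add x y hx hy =>
      have : projQ k V N n (r ⊗ₜ[k] (x + y)) =
          projQ k V N n (r ⊗ₜ[k] x) + projQ k V N n (r ⊗ₜ[k] y) :=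
        (congrArg (projQ k V N n) (TensorProduct.tmul_add _ _ _)).trans (map_add _ _ _)
      rw [this]; exact add _ _ hx hy
  · intro x y hx hy
    exact (map_add (projQ k V N n) x y) ▸ add _ _ hx hy

theorem span_barGen (n : ℕ) :
    Submodule.span (Env k V N) (Set.range fun q : BarWord V N n => barGen k N q) = ⊤ := by
  rw [eq_top_iff]
  rintro x -
  exact Q_induction (motive := fun x => x ∈ Submodule.span (Env k V N)
    (Set.range fun q : BarWord V N n => barGen k N q)) elemQ_mem_span (zero_mem _)
    (fun x y hx hy => add_mem hx hy) x

end BarBimodules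

/-! ### Bimodule maps out of the reduced bar resolution -/

section BarMaps

variable {k : Type u} [Field k] {V : Type v} [Quiver.{w} V] [Fintype V] {N : ℕ}

theorem fullSeq_update {n : ℕ} (α : TQA k V N) (a : Fin n → Aplus k V N) (β : TQA k V N)
    (i : Fin n) (x : Aplus k V N) :
    fullSeq α (Function.update a i x) β = Function.update (fullSeq α a β) i.castSucc.succ x := by
  rw [fullSeq, fullSeq, ← Fin.cons_update, ← Fin.snoc_update]
  congr 2
  funext j
  by_cases h : j = i
  · subst h; simp
  · simp [Function.update_of_ne h]

section Seq

variable {M : Type*} [AddCommGroup M] [Module (Env k V N) M] [Module k M]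
  [IsScalarTower k (Env k V N) M]

/-- The restriction of a multilinear map to the sequences `(1, a_1, …, a_n, 1)`. -/
def restrictSeq {n : ℕ} (Λ : MultilinearMap k (fun _ : Fin (n + 2) => TQA k V N) M) :
    MultilinearMap k (fun _ : Fin n => Aplus k V N) M :=
  MultilinearMap.mk' (fun a => Λ (fullSeq 1 a 1))
    (fun a i x y => by
      simp only [fullSeq_update, Submodule.coe_add, MultilinearMap.map_update_add])
    (fun a i c x => by
      simp only [fullSeq_update, Submodule.coe_smul, MultilinearMap.map_update_smul])

/-- A multilinear map which is compatible with the bimodule structure and with moving elements of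
`kΔ_0` across the bars defines a bimodule map on `Q_n`. -/
theorem exists_linearMap_seq {n : ℕ} (Λ : MultilinearMap k (fun _ : Fin (n + 2) => TQA k V N) M)
    (hbi : ∀ (α : TQA k V N) (a : Fin n → Aplus k V N) (β : TQA k V N),
      ten α β • Λ (fullSeq 1 a 1) = Λ (fullSeq α a β))
    (hrel : ∀ (s : Fin (n + 2) → TQA k V N) (i : Fin (n + 1)) (c : PathAlg k V), c ∈ gr k V 0 →
      Λ (Function.update s i.castSucc (s i.castSucc * toA k V N c)) =
        Λ (Function.update s i.succ (toA k V N c * s i.succ))) :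
    ∃ f : Q k V N n →ₗ[Env k V N] M, ∀ (α : TQA k V N) (a : Fin n → Aplus k V N) (β : TQA k V N),
      f (elemQ α a β) = Λ (fullSeq α a β) := by
  let σ : TQ k V N n →ₗ[Env k V N] M :=
    liftLeft (E := Env k V N) (X := ⨂[k] _ : Fin n, Aplus k V N)
      (PiTensorProduct.lift (restrictSeq Λ))
  have hσ : ∀ (α : TQA k V N) (a : Fin n → Aplus k V N) (β : TQA k V N),
      σ (tQ α a β) = Λ (fullSeq α a β) := fun α a β => by
    have h : σ (tQ α a β) = ten α β • PiTensorProduct.lift (restrictSeq Λ)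
      (PiTensorProduct.tprod k a) := rfl
    rw [h, PiTensorProduct.lift.tprod]
    exact hbi α a β
  refine ⟨(relQ k V N n).liftQ σ ?_, hσ⟩
  rw [relQ, Submodule.span_le]
  rintro _ ⟨α, α', β, β', a, a', s, i, c, hc, h1, h2, rfl⟩
  rw [SetLike.mem_coe, LinearMap.mem_ker, map_sub, hσ, hσ, h1, h2, hrel s i c hc, sub_self]

end Seq

/-! ### Freeness of the reduced bar resolution -/

section Free

variable {M : Type*} [AddCommGroup M] [Module k M]

theorem multilinear_update_smul {n : ℕ} {Λ : MultilinearMap k (fun _ : Fin n => TQA k V N) M}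
    {f : Fin n → TQA k V N →ₗ[k] TQA k V N} {s : Fin n → TQA k V N} {i : Fin n} {x : TQA k V N}
    {r : k} (h : f i x = r • f i (s i)) :
    Λ.compLinearMap f (Function.update s i x) = r • Λ.compLinearMap f s := by
  have : (fun j => f j (Function.update s i x j)) =
      Function.update (fun j => f j (s j)) i (r • f i (s i)) := by
    funext j
    by_cases hj : j = i
    · subst hj; rw [Function.update_self, Function.update_self, h]
    · rw [Function.update_of_ne hj, Function.update_of_ne hj]
  rw [MultilinearMap.compLinearMap_apply, this, MultilinearMap.map_update_smul,
    Function.update_eq_self, MultilinearMap.compLinearMap_apply]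

/-- For vertices `v_0, …, v_n`, the projection of the entry `s_j` of a sequence to
`v_{j-1} s_j v_j`; only one side is projected for the first and the last entry. -/
def compress {n : ℕ} (x : Fin (n + 1) → V) (j : Fin (n + 2)) : TQA k V N →ₗ[k] TQA k V N :=
  LinearMap.mulLeft k ((Fin.cons 1 (fun i => pa k N (vtx (x i))) : Fin (n + 2) → TQA k V N) j) ∘ₗ
  LinearMap.mulRight k ((Fin.snoc (fun i => pa k N (vtx (x i))) 1 : Fin (n + 2) → TQA k V N) j)

theorem compress_castSucc {n : ℕ} (x : Fin (n + 1) → V) (i : Fin (n + 1)) :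
    ∃ l : TQA k V N, ∀ s, compress x i.castSucc s = l * (s * pa k N (vtx (x i))) :=
  ⟨_, fun s => by
    rw [compress, LinearMap.comp_apply, LinearMap.mulLeft_apply, LinearMap.mulRight_apply,
      Fin.snoc_castSucc]⟩

theorem compress_succ {n : ℕ} (x : Fin (n + 1) → V) (i : Fin (n + 1)) :
    ∃ r : TQA k V N, ∀ s, compress x i.succ s = pa k N (vtx (x i)) * s * r :=
  ⟨_, fun s => by
    rw [compress, LinearMap.comp_apply, LinearMap.mulLeft_apply, LinearMap.mulRight_apply,
      Fin.cons_succ, mul_assoc]⟩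

theorem compress_zero {n : ℕ} (x : Fin (n + 1) → V) (s : TQA k V N) :
    compress x 0 s = s * pa k N (vtx (x 0)) := by
  rw [compress, LinearMap.comp_apply, LinearMap.mulLeft_apply, LinearMap.mulRight_apply,
    Fin.cons_zero, ← Fin.castSucc_zero, Fin.snoc_castSucc, one_mul]

theorem compress_last {n : ℕ} (x : Fin (n + 1) → V) (s : TQA k V N) :
    compress x (Fin.last (n + 1)) s = pa k N (vtx (x (Fin.last n))) * s := by
  rw [compress, LinearMap.comp_apply, LinearMap.mulLeft_apply, LinearMap.mulRight_apply,
    Fin.snoc_last, ← Fin.succ_last, Fin.cons_succ, mul_one]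

open Classical in
/-- The linear map with value `y q` on `α_1 ⊗ … ⊗ α_n` if `α_1, …, α_n` is the word of paths `q`
and has source `a`, and with value `0` if there is no such word. -/
def wordVal {n : ℕ} (y : BarWord V N n → M) (a : V) : (⨂[k] _ : Fin n, Aplus k V N) →ₗ[k] M :=
  (Basis.piTensorProduct fun _ : Fin n => basisPlus k V N).constr k fun t =>
    if h : ∃ q : BarWord V N n, q.path.1 = a ∧
      ∀ i : Fin n, seg q.path (psum q.lens i) (q.lens i) = (t i).1 then y h.choose else 0

theorem wordVal_pieces {n : ℕ} (y : BarWord V N n → M) (q : BarWord V N n) :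
    wordVal y q.path.1 (PiTensorProduct.tprod k (pieces k N q.path q.lens)) = y q := by
  let t : Fin n → {p : Pth V // 1 ≤ len p ∧ len p < N} := fun i =>
    ⟨seg q.path (psum q.lens i) (q.lens i), by
      rw [len_seg_barWord]; exact ⟨q.one_le i, q.lt i⟩⟩
  have ht : PiTensorProduct.tprod k (pieces k N q.path q.lens) =
      Basis.piTensorProduct (fun _ : Fin n => basisPlus k V N) t := by
    rw [Basis.piTensorProduct_apply]
    congr 1
    funext i
    rw [basisPlus_apply, pieces_apply]
  have h : ∃ q' : BarWord V N n, q'.path.1 = q.path.1 ∧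
      ∀ i : Fin n, seg q'.path (psum q'.lens i) (q'.lens i) = (t i).1 := ⟨q, rfl, fun _ => rfl⟩
  rw [ht, wordVal, Module.Basis.constr_basis, dif_pos h]
  congr 1
  exact barWord_ext h.choose_spec.1 h.choose_spec.2

/-- The vertices passed by a word of paths. -/
def vert {n : ℕ} (q : BarWord V N n) (i : Fin (n + 1)) : V := (rest q.path (psum q.lens i)).1

/-- The entry `i` of the sequence of a word ends at the vertex number `i`. -/
theorem fullSeq_mul_vert {n : ℕ} (q : BarWord V N n) (i : Fin (n + 1)) :
    ∃ p : Pth V, p.2.1 = vert q i ∧ fullSeq (pa k N (vtx q.path.1)) (pieces k N q.path q.lens)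
      (pa k N (vtx q.path.2.1)) i.castSucc = pa k N p := by
  induction i using Fin.cases with
  | zero =>
    refine ⟨vtx q.path.1, ?_, rfl⟩
    rw [vert, Fin.val_zero, psum_zero, rest_zero]; rfl
  | succ i =>
    refine ⟨_, ?_, (fullSeq_mid _ _ _ i).trans (coe_pieces q i)⟩
    rw [seg_tgt (barWord_add_le q i), ← psum_succ, vert, Fin.val_succ]

/-- The entry `i + 1` of the sequence of a word starts at the vertex number `i`. -/
theorem vert_mul_fullSeq {n : ℕ} (q : BarWord V N n) (i : Fin (n + 1)) :
    ∃ p : Pth V, p.1 = vert q i ∧ fullSeq (pa k N (vtx q.path.1)) (pieces k N q.path q.lens)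
      (pa k N (vtx q.path.2.1)) i.succ = pa k N p := by
  induction i using Fin.lastCases with
  | last =>
    refine ⟨vtx q.path.2.1, ?_, ?_⟩
    · rw [vert, Fin.val_last, psum_full, q.sum_eq, rest_len rfl]
    · rw [Fin.succ_last, fullSeq_last]
  | cast i =>
    exact ⟨_, seg_src _ _ _, (fullSeq_mid _ _ _ i).trans (coe_pieces q i)⟩

variable [Module (Env k V N) M] [IsScalarTower k (Env k V N) M]

/-- A bimodule map on `Q_n` may be prescribed on the words of paths, if the values satisfy the
obvious condition on the end vertices. It is defined by decomposing each entry of a sequence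
according to its source and end. -/
theorem exists_linearMap_Q (n : ℕ) (y : BarWord V N n → M)
    (hy : ∀ q, idem k N q.path.1 q.path.2.1 • y q = y q) :
    ∃ f : Q k V N n →ₗ[Env k V N] M, ∀ q, f (barGen k N q) = y q := by
  let Λ : (Fin (n + 1) → V) → MultilinearMap k (fun _ : Fin (n + 2) => TQA k V N) M := fun x =>
    (seqMap (wordVal y (x 0))).compLinearMap (compress x)
  have hΛ : ∀ x s, Λ x s = seqMap (wordVal y (x 0)) (fun j => compress x j (s j)) :=
    fun _ _ => rfl
  classical
  have hbi : ∀ (α : TQA k V N) (a : Fin n → Aplus k V N) (β : TQA k V N),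
      ten α β • (∑ x, Λ x) (fullSeq 1 a 1) = (∑ x, Λ x) (fullSeq α a β) := by
    intro α a β
    rw [sum_apply, sum_apply, Finset.smul_sum]
    refine Finset.sum_congr rfl fun x _ => ?_
    rw [hΛ, hΛ, seqMap_apply, seqMap_apply, fullSeq_zero, fullSeq_zero, fullSeq_last, fullSeq_last,
      ← mul_smul, ten_mul]
    have : mid (fun j => compress x j (fullSeq 1 a 1 j)) =
        mid (fun j => compress x j (fullSeq α a β j)) := by
      funext i
      simp only [mid, fullSeq_mid]
    rw [this, compress_zero, compress_zero, compress_last, compress_last, one_mul, mul_one]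
  have hrel : ∀ (s : Fin (n + 2) → TQA k V N) (i : Fin (n + 1)) (c : PathAlg k V),
      c ∈ gr k V 0 → (∑ x, Λ x) (Function.update s i.castSucc (s i.castSucc * toA k V N c)) =
        (∑ x, Λ x) (Function.update s i.succ (toA k V N c * s i.succ)) := by
    intro s i c hc
    rw [sum_apply, sum_apply]
    refine Finset.sum_congr rfl fun x _ => ?_
    obtain ⟨r, h1, h2⟩ := gr_zero_mul_vtx (N := N) hc (x i)
    obtain ⟨l, hl⟩ := compress_castSucc (k := k) (N := N) x i
    obtain ⟨l', hl'⟩ := compress_succ (k := k) (N := N) x i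
    rw [multilinear_update_smul (r := r), multilinear_update_smul (r := r)]
    · rw [hl', hl', ← mul_assoc, h2, smul_mul_assoc, smul_mul_assoc]
    · rw [hl, hl, mul_assoc (s i.castSucc), h1, mul_smul_comm, mul_smul_comm]
  obtain ⟨f, hf⟩ := exists_linearMap_seq (∑ x, Λ x) hbi hrel
  refine ⟨f, fun q => ?_⟩
  rw [barGen, hf]
  set s := fullSeq (pa k N (vtx q.path.1)) (pieces k N q.path q.lens)
    (pa k N (vtx q.path.2.1)) with hs
  -- Only the vertices passed by the word give a nonzero contribution.
  rw [sum_apply, Finset.sum_eq_single (vert q)]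
  · have : (fun j => compress (vert q) j (s j)) = s := by
      funext j
      induction j using Fin.cases with
      | zero =>
        obtain ⟨p, hp, h⟩ := fullSeq_mul_vert (k := k) q 0
        rw [Fin.castSucc_zero] at h
        rw [compress_zero, hs, h, mul_vtx hp]
      | succ j =>
        obtain ⟨p, hp, h⟩ := vert_mul_fullSeq (k := k) q j
        induction j using Fin.lastCases with
        | last => rw [Fin.succ_last] at h ⊢; rw [compress_last, hs, h, vtx_mul hp]
        | cast j =>
          obtain ⟨p', hp', h'⟩ := fullSeq_mul_vert (k := k) q j.succ
          rw [← hs] at h h'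
          have e : j.succ.castSucc = j.castSucc.succ := rfl
          rw [compress, LinearMap.comp_apply, LinearMap.mulLeft_apply,
            LinearMap.mulRight_apply, Fin.cons_succ, ← e, Fin.snoc_castSucc, h', mul_vtx hp',
            ← h', e, h, vtx_mul hp]
    have hv : vert q 0 = q.path.1 := by rw [vert, Fin.val_zero, psum_zero, rest_zero]
    rw [hΛ, this, seqMap_apply, hs, fullSeq_zero, fullSeq_last, mid_fullSeq, hv, wordVal_pieces]
    exact hy q
  · intro x _ hx
    obtain ⟨i, hi⟩ := Function.ne_iff.1 hx
    obtain ⟨p, hp, h⟩ := fullSeq_mul_vert (k := k) q i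
    rw [← hs] at h
    rw [hΛ]
    refine MultilinearMap.map_coord_zero _ i.castSucc ?_
    obtain ⟨l, hl⟩ := compress_castSucc (k := k) (N := N) x i
    rw [hl, h, pa_mul_of_ne, mul_zero]
    rw [hp]; exact hi.symm
  · intro h; exact absurd (Finset.mem_univ _) h

end Free

/-- `Q_n` is the direct sum of the bimodules `A o(α_1) ⊗ t(α_n) A`, over the words of `n` paths of
positive length less than `N`. -/
theorem isFreeBy_barGen (n : ℕ) : IsFreeBy
    (fun q : BarWord V N n => idem k N q.path.1 q.path.2.1) (fun q => barGen k N q) where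
  span_eq_top := span_barGen n
  smul_eq q := by
    rw [idem, barGen, ten_smul_elemQ, vtx_mul_vtx, vtx_mul_vtx]
  exists_section := by
    refine exists_linearMap_Q (M := BarWord V N n →₀ Env k V N) n
      (fun q => Finsupp.single q (idem k N q.path.1 q.path.2.1)) fun q => ?_
    rw [Finsupp.smul_single, smul_eq_mul, idem_mul_idem]

end BarMaps

/-! ### The differential of the reduced bar resolution -/

section BarDifferential

variable {k : Type u} [Field k] {V : Type v} [Quiver.{w} V] [Fintype V] {N : ℕ}

section Contract

variable {A : Type*} [Mul A] {m : ℕ}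

/-- The sequence obtained by multiplying the entries with indices `i` and `i + 1`. -/
def contract (i : Fin (m + 1)) (s : Fin (m + 2) → A) : Fin (m + 1) → A :=
  Fin.contractNth i.castSucc (· * ·) s

theorem contract_apply (i : Fin (m + 1)) (s : Fin (m + 2) → A) (j : Fin (m + 1)) :
    contract i s j = if (j : ℕ) < i then s j.castSucc
      else if (j : ℕ) = i then s j.castSucc * s j.succ else s j.succ := rfl

/-- The contraction is linear in each entry of the sequence: changing the entry `j` changes one
entry of the contracted sequence. -/
theorem contract_update (i : Fin (m + 1)) (s : Fin (m + 2) → A) (j : Fin (m + 2)) (x : A) :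
    contract i (Function.update s j x) =
      if h : (j : ℕ) ≤ i then Function.update (contract i s) ⟨j, by omega⟩
        (if (j : ℕ) = i then x * s i.succ else x)
      else Function.update (contract i s) ⟨j - 1, by omega⟩
        (if (j : ℕ) = i + 1 then s i.castSucc * x else x) := by
  obtain ⟨i, hi⟩ := i
  obtain ⟨j, hj⟩ := j
  funext ⟨l, hl⟩
  simp only [contract_apply, Function.update_apply, Fin.ext_iff, Fin.val_castSucc, Fin.val_succ]
  split_ifs <;> simp_all [Function.update_apply, contract_apply] <;> grind

theorem contract_zero_cons [One A] (h : ∀ x : A, 1 * x = x) (s : Fin (m + 1) → A) :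
    contract 0 (Fin.cons 1 s : Fin (m + 2) → A) = s := by
  funext j
  rw [contract_apply]
  induction j using Fin.cases with
  | zero => exact h (s 0)
  | succ j => rfl

theorem contract_succ_cons (i : Fin (m + 1)) (x : A) (s : Fin (m + 2) → A) :
    contract i.succ (Fin.cons x s : Fin (m + 3) → A) = Fin.cons x (contract i s) := by
  funext j
  rw [contract_apply]
  induction j using Fin.cases with
  | zero => rfl
  | succ j =>
    have e : (j.succ.castSucc : Fin (m + 3)) = j.castSucc.succ := rfl
    simp only [e, Fin.cons_succ, contract_apply, Fin.val_succ, add_lt_add_iff_right, add_left_inj]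

end Contract

theorem coe_mulPlus (x y : Aplus k V N) : (mulPlus x y : TQA k V N) = x * y := rfl

theorem fullSeq_apply {n : ℕ} (α : TQA k V N) (a : Fin n → Aplus k V N) (β : TQA k V N)
    (j : Fin (n + 2)) : fullSeq α a β j =
      if (j : ℕ) = 0 then α else if h : (j : ℕ) - 1 < n then (a ⟨j - 1, h⟩ : TQA k V N) else β := by
  induction j using Fin.cases with
  | zero => simp [fullSeq_zero]
  | succ j =>
    induction j using Fin.lastCases with
    | last => rw [Fin.succ_last, fullSeq_last]; simp
    | cast j => rw [fullSeq_mid]; simp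

/-- The first contraction gives the first term of the bar differential. -/
theorem contract_fullSeq_zero {n : ℕ} (α : TQA k V N) (a : Fin (n + 1) → Aplus k V N)
    (β : TQA k V N) :
    contract 0 (fullSeq α a β) = fullSeq (α * (a 0 : TQA k V N)) (Fin.tail a) β := by
  funext ⟨j, hj⟩
  simp only [contract_apply, fullSeq_apply, Fin.val_castSucc, Fin.val_succ, Fin.tail]
  rcases j with _ | j
  · simp
  · simp

/-- The last contraction gives the last term of the bar differential. -/
theorem contract_fullSeq_last {n : ℕ} (α : TQA k V N) (a : Fin (n + 1) → Aplus k V N)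
    (β : TQA k V N) : contract (Fin.last (n + 1)) (fullSeq α a β) =
      fullSeq α (Fin.init a) ((a (Fin.last n) : TQA k V N) * β) := by
  funext ⟨j, hj⟩
  simp only [contract_apply, fullSeq_apply, Fin.val_succ, Fin.init,
    Fin.castSucc_mk, Fin.last]
  grind

/-- The other contractions multiply two neighbouring entries in `A_+`. -/
theorem contract_fullSeq_mid {n : ℕ} (α : TQA k V N) (a : Fin (n + 1) → Aplus k V N)
    (β : TQA k V N) (i : Fin n) : contract i.castSucc.succ (fullSeq α a β) =
      fullSeq α (Fin.contractNth i.castSucc mulPlus a) β := by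
  obtain ⟨i, hi⟩ := i
  funext ⟨j, hj⟩
  simp only [contract_apply, fullSeq_apply, Fin.contractNth,
    Fin.castSucc_mk, Fin.succ_mk]
  rcases j with _ | j
  · simp
  · rcases lt_trichotomy j i with h | rfl | h
    · grind
    · have h1 : j < n + 1 := by omega
      simp [hi, h1, coe_mulPlus]
    · grind

variable (k V N) in
/-- The multilinear map underlying the bar differential: the alternating sum of the contractions
of neighbouring entries. -/
def barSum (n : ℕ) : MultilinearMap k (fun _ : Fin (n + 3) => TQA k V N) (Q k V N n) :=
  MultilinearMap.mk'
    (fun s => ∑ i : Fin (n + 2), (-1 : ℤ) ^ (i : ℕ) • elemSeq k V N n (contract i s))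
    (fun s j x y => by
      rw [← Finset.sum_add_distrib]
      refine Finset.sum_congr rfl fun i _ => ?_
      rw [← smul_add]
      congr 1
      rw [contract_update, contract_update, contract_update]
      split_ifs <;> simp only [add_mul, mul_add, MultilinearMap.map_update_add])
    (fun s j c x => by
      rw [Finset.smul_sum]
      refine Finset.sum_congr rfl fun i _ => ?_
      rw [smul_comm]
      congr 1
      rw [contract_update, contract_update]
      split_ifs <;> simp only [smul_mul_assoc, mul_smul_comm, MultilinearMap.map_update_smul])

theorem barSum_apply (n : ℕ) (s : Fin (n + 3) → TQA k V N) : barSum k V N n s =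
    ∑ i : Fin (n + 2), (-1 : ℤ) ^ (i : ℕ) • elemSeq k V N n (contract i s) := rfl

theorem barSum_fullSeq (n : ℕ) (α : TQA k V N) (a : Fin (n + 1) → Aplus k V N) (β : TQA k V N) :
    barSum k V N n (fullSeq α a β) = bVal k N n α a β := by
  rw [barSum_apply, Fin.sum_univ_succ, Fin.sum_univ_castSucc, Fin.succ_last, contract_fullSeq_last,
    contract_fullSeq_zero, elemSeq_fullSeq, elemSeq_fullSeq, Fin.val_zero, pow_zero, one_smul,
    bVal, add_assoc, Fin.val_last]
  simp only [contract_fullSeq_mid, elemSeq_fullSeq, Fin.val_succ, Fin.val_castSucc]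

/-- Moving `c ∈ kΔ_0` across a bar does not change the value of `barSum`: the contraction at this
bar is unchanged, and for every other contraction the bar is still there. -/
theorem barSum_rel {n : ℕ} (s : Fin (n + 3) → TQA k V N) (p : Fin (n + 2)) {c : PathAlg k V}
    (hc : c ∈ gr k V 0) :
    barSum k V N n (Function.update s p.castSucc (s p.castSucc * toA k V N c)) =
      barSum k V N n (Function.update s p.succ (toA k V N c * s p.succ)) := by
  rw [barSum_apply, barSum_apply]
  refine Finset.sum_congr rfl fun i _ => ?_
  congr 1
  rw [contract_update, contract_update]
  obtain ⟨p, hp⟩ := p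
  obtain ⟨i, hi⟩ := i
  simp only [Fin.succ_mk, Fin.castSucc_mk]
  rcases lt_trichotomy p i with h | rfl | h
  · rw [dif_pos h.le, dif_pos (by omega), if_neg h.ne]
    have := elemSeq_rel (contract ⟨i, hi⟩ s) ⟨p, by omega⟩ hc
    simp only [Fin.succ_mk, Fin.castSucc_mk] at this
    rw [contract_apply, if_pos h] at this
    rcases eq_or_ne (p + 1) i with h1 | h1
    · subst h1
      rw [contract_apply, if_neg (lt_irrefl _), if_pos rfl, ← mul_assoc] at this
      rw [if_pos rfl]
      exact this
    · rw [contract_apply, if_pos (by simp only []; omega)] at this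
      rw [if_neg h1]
      exact this
  · simp [mul_assoc]
  · rw [dif_neg (by omega), dif_neg (by omega), if_neg (by omega : ¬ (p + 1 = i + 1))]
    obtain ⟨p, rfl⟩ : ∃ p', p = p' + 1 := ⟨p - 1, by omega⟩
    have := elemSeq_rel (contract ⟨i, hi⟩ s) ⟨p, by omega⟩ hc
    simp only [Fin.succ_mk, Fin.castSucc_mk] at this
    rw [contract_apply _ _ ⟨p + 1, _⟩, if_neg (by simp only []; omega),
      if_neg (by simp only []; omega)] at this
    rcases eq_or_ne p i with h1 | h1
    · subst h1
      rw [contract_apply, if_neg (lt_irrefl _), if_pos rfl, mul_assoc] at this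
      rw [if_pos rfl]
      exact this
    · rw [contract_apply, if_neg (by simp only []; omega), if_neg (by exact h1)] at this
      rw [if_neg (by omega)]
      exact this

variable (k V N) in
theorem exists_b (n : ℕ) : ∃ f : Q k V N (n + 1) →ₗ[Env k V N] Q k V N n,
    ∀ t : TQA k V N × (Fin (n + 1) → Aplus k V N) × TQA k V N,
      f (elemQ t.1 t.2.1 t.2.2) = bVal k N n t.1 t.2.1 t.2.2 := by
  have hbi : ∀ (α : TQA k V N) (a : Fin (n + 1) → Aplus k V N) (β : TQA k V N),
      ten α β • barSum k V N n (fullSeq 1 a 1) = barSum k V N n (fullSeq α a β) := by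
    intro α a β
    rw [barSum_fullSeq, barSum_fullSeq, bVal, bVal]
    have hz : ∀ (r : ℤ) (x : Q k V N n), ten α β • r • x = r • ten α β • x := fun r x =>
      smul_comm _ _ _
    simp only [smul_add, Finset.smul_sum, hz, ten_smul_elemQ, one_mul, mul_one]
  obtain ⟨f, hf⟩ := exists_linearMap_seq (barSum k V N n) hbi fun s i c hc => barSum_rel s i hc
  exact ⟨f, fun t => (hf _ _ _).trans (barSum_fullSeq _ _ _ _)⟩

theorem b_elemQ (n : ℕ) (α : TQA k V N) (a : Fin (n + 1) → Aplus k V N) (β : TQA k V N) :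
    b k V N n (elemQ α a β) = bVal k N n α a β := by
  have h := linExt_apply (R := Env k V N) (exists_b k V N n) (α, a, β)
  exact h

variable (k V N) in
theorem exists_epsQ : ∃ f : Q k V N 0 →ₗ[Env k V N] TQA k V N,
    ∀ t : TQA k V N × (Fin 0 → Aplus k V N) × TQA k V N,
      f (elemQ t.1 t.2.1 t.2.2) = t.1 * t.2.2 := by
  have := isScalarTower_A (k := k) (V := V) (N := N)
  let Λ : MultilinearMap k (fun _ : Fin 2 => TQA k V N) (TQA k V N) :=
    MultilinearMap.mkPiAlgebraFin k 2 (TQA k V N)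
  have hΛ : ∀ s, Λ s = s 0 * s 1 := fun s => by
    simp [Λ, MultilinearMap.mkPiAlgebraFin_apply]
  have hbi : ∀ (α : TQA k V N) (a : Fin 0 → Aplus k V N) (β : TQA k V N),
      ten α β • Λ (fullSeq 1 a 1) = Λ (fullSeq α a β) := by
    intro α a β
    rw [hΛ, hΛ]
    refine (ten_smul_A _ _ _).trans ?_
    change α * (1 * 1) * β = α * β
    rw [mul_one, mul_one]
  have hrel : ∀ (s : Fin 2 → TQA k V N) (i : Fin 1) (c : PathAlg k V), c ∈ gr k V 0 →
      Λ (Function.update s i.castSucc (s i.castSucc * toA k V N c)) =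
        Λ (Function.update s i.succ (toA k V N c * s i.succ)) := by
    intro s i c hc
    obtain rfl : i = 0 := Subsingleton.elim _ _
    rw [hΛ, hΛ]
    simp [mul_assoc]
  obtain ⟨f, hf⟩ := exists_linearMap_seq Λ hbi hrel
  exact ⟨f, fun t => by rw [hf, hΛ]; rfl⟩

theorem epsQ_elemQ (α : TQA k V N) (a : Fin 0 → Aplus k V N) (β : TQA k V N) :
    epsQ k V N (elemQ α a β) = α * β := by
  have h := linExt_apply (R := Env k V N) (exists_epsQ k V N) (α, a, β)
  exact h

/-! ### The contracting homotopy of the reduced bar resolution -/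

/-- The action of a pair of elements of `A` on a sequence. -/
def scaleSeq {n : ℕ} (x y : TQA k V N) (s : Fin (n + 2) → TQA k V N) : Fin (n + 2) → TQA k V N :=
  fun j => (if j = 0 then x else 1) * s j * (if j = Fin.last (n + 1) then y else 1)

theorem scaleSeq_fullSeq {n : ℕ} (x y α : TQA k V N) (a : Fin n → Aplus k V N) (β : TQA k V N) :
    scaleSeq x y (fullSeq α a β) = fullSeq (x * α) a (β * y) := by
  have h0 : (Fin.last (n + 1)) ≠ 0 := (Fin.last_pos).ne'
  funext j
  rw [scaleSeq]
  induction j using Fin.cases with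
  | zero => rw [if_pos rfl, if_neg h0.symm, mul_one, fullSeq_zero, fullSeq_zero]
  | succ j =>
    rw [if_neg (Fin.succ_ne_zero _), one_mul]
    induction j using Fin.lastCases with
    | last => rw [Fin.succ_last, fullSeq_last, fullSeq_last, if_pos rfl]
    | cast j =>
      rw [fullSeq_mid, fullSeq_mid, if_neg, mul_one]
      rw [← Fin.succ_last]
      exact fun h => (Fin.castSucc_lt_last j).ne (Fin.succ_injective _ h)

theorem scaleSeq_update_castSucc {n : ℕ} (x y c : TQA k V N) (s : Fin (n + 2) → TQA k V N)
    (i : Fin (n + 1)) : scaleSeq x y (Function.update s i.castSucc (s i.castSucc * c)) =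
      Function.update (scaleSeq x y s) i.castSucc (scaleSeq x y s i.castSucc * c) := by
  funext j
  by_cases h : j = i.castSucc
  · subst h
    rw [Function.update_self, scaleSeq, scaleSeq, Function.update_self,
      if_neg (Fin.castSucc_lt_last i).ne, mul_one, mul_one, mul_assoc]
  · rw [Function.update_of_ne h, scaleSeq, scaleSeq, Function.update_of_ne h]

theorem scaleSeq_update_succ {n : ℕ} (x y c : TQA k V N) (s : Fin (n + 2) → TQA k V N)
    (i : Fin (n + 1)) : scaleSeq x y (Function.update s i.succ (c * s i.succ)) =
      Function.update (scaleSeq x y s) i.succ (c * scaleSeq x y s i.succ) := by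
  funext j
  by_cases h : j = i.succ
  · subst h
    rw [Function.update_self, scaleSeq, scaleSeq, Function.update_self,
      if_neg (Fin.succ_ne_zero i), one_mul, one_mul, mul_assoc]
  · rw [Function.update_of_ne h, scaleSeq, scaleSeq, Function.update_of_ne h]

theorem fullSeq_eq_update_zero {n : ℕ} (α : TQA k V N) (a : Fin n → Aplus k V N) (β : TQA k V N) :
    fullSeq α a β = Function.update (fullSeq 1 a β) 0 α := by
  rw [fullSeq, fullSeq, Fin.update_cons_zero]

theorem fullSeq_eq_update_last {n : ℕ} (α : TQA k V N) (a : Fin n → Aplus k V N) (β : TQA k V N) :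
    fullSeq α a β = Function.update (fullSeq α a 1) (Fin.last (n + 1)) β := by
  rw [fullSeq, fullSeq, ← Fin.succ_last, ← Fin.cons_update, Fin.update_snoc_last]

section

variable {M : Type*} [AddCommGroup M] [Module k M] {n : ℕ}

/-- A multilinear map, as a bilinear map in the first and the last argument. -/
def splitSeq (Λ : MultilinearMap k (fun _ : Fin (n + 2) => TQA k V N) M) :
    TQA k V N →ₗ[k] TQA k V N →ₗ[k] MultilinearMap k (fun _ : Fin n => Aplus k V N) M :=
  LinearMap.mk₂ k
    (fun α β => MultilinearMap.mk' (fun a => Λ (fullSeq α a β))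
      (fun a i x y => by
        simp only [fullSeq_update, Submodule.coe_add, MultilinearMap.map_update_add])
      (fun a i c x => by
        simp only [fullSeq_update, Submodule.coe_smul, MultilinearMap.map_update_smul]))
    (fun α α' β => MultilinearMap.ext fun a => by
      have h := fun α => fullSeq_eq_update_zero (k := k) (N := N) α a β
      change Λ _ = Λ _ + Λ _
      rw [h, h α, h α', MultilinearMap.map_update_add])
    (fun c α β => MultilinearMap.ext fun a => by
      have h := fun α => fullSeq_eq_update_zero (k := k) (N := N) α a β
      change Λ _ = c • Λ _
      rw [h, h α, MultilinearMap.map_update_smul])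
    (fun α β β' => MultilinearMap.ext fun a => by
      have h := fun β => fullSeq_eq_update_last (k := k) (N := N) α a β
      change Λ _ = Λ _ + Λ _
      rw [h, h β, h β', MultilinearMap.map_update_add])
    (fun c α β => MultilinearMap.ext fun a => by
      have h := fun β => fullSeq_eq_update_last (k := k) (N := N) α a β
      change Λ _ = c • Λ _
      rw [h, h β, MultilinearMap.map_update_smul])

/-- The linear map on `TQ` defined by a multilinear map. -/
def liftSeq (Λ : MultilinearMap k (fun _ : Fin (n + 2) => TQA k V N) M) :
    Env k V N ⊗[k] (⨂[k] _ : Fin n, Aplus k V N) →ₗ[k] M :=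
  TensorProduct.lift ((PiTensorProduct.lift (R := k) (s := fun _ : Fin n => Aplus k V N)
      (E := M)).toLinearMap ∘ₗ
    TensorProduct.lift ((splitSeq Λ).compl₂ (MulOpposite.opLinearEquiv k).symm.toLinearMap))

theorem liftSeq_tmul (Λ : MultilinearMap k (fun _ : Fin (n + 2) => TQA k V N) M) (α β : TQA k V N)
    (a : Fin n → Aplus k V N) :
    liftSeq Λ (ten α β ⊗ₜ[k] PiTensorProduct.tprod k a) = Λ (fullSeq α a β) := by
  rw [liftSeq, TensorProduct.lift.tmul, LinearMap.comp_apply, ten, TensorProduct.lift.tmul]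
  exact PiTensorProduct.lift.tprod a

/-- A multilinear map which is compatible with moving elements of `kΔ_0` across the bars defines an
additive map on `Q_n`. -/
theorem exists_addMonoidHom_seq (Λ : MultilinearMap k (fun _ : Fin (n + 2) => TQA k V N) M)
    (hrel : ∀ (s : Fin (n + 2) → TQA k V N) (i : Fin (n + 1)) (c : PathAlg k V), c ∈ gr k V 0 →
      Λ (Function.update s i.castSucc (s i.castSucc * toA k V N c)) =
        Λ (Function.update s i.succ (toA k V N c * s i.succ))) :
    ∃ f : Q k V N n →+ M, ∀ (α : TQA k V N) (a : Fin n → Aplus k V N) (β : TQA k V N),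
      f (elemQ α a β) = Λ (fullSeq α a β) := by
  let σ : TQ k V N n →+ M := (liftSeq Λ).toAddMonoidHom
  have hσ : ∀ (α : TQA k V N) (a : Fin n → Aplus k V N) (β : TQA k V N),
      σ (tQ α a β) = Λ (fullSeq α a β) := fun α a β => liftSeq_tmul Λ α β a
  have hk : ∀ (c : k) (r : Env k V N) (t : TQ k V N n), σ ((c • r) • t) = c • σ (r • t) := by
    intro c r t
    have h : ∀ t : Env k V N ⊗[k] (⨂[k] _ : Fin n, Aplus k V N),
        liftSeq Λ ((c • r) • t) = c • liftSeq Λ (r • t) := fun t => by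
      rw [smul_assoc, map_smul]
    exact h t
  -- The map is not a bimodule map; but the relations are stable under the bimodule structure.
  have hz : ∀ t ∈ relQ k V N n, ∀ r : Env k V N, σ (r • t) = 0 := by
    intro t ht
    rw [relQ] at ht
    induction ht using Submodule.span_induction with
    | zero => intro r; rw [smul_zero, map_zero]
    | add x y _ _ hx hy => intro r; rw [smul_add, map_add, hx, hy, add_zero]
    | smul r' x _ hx => intro r; rw [← mul_smul]; exact hx _
    | mem t ht =>
      obtain ⟨α, α', β, β', a, a', s, i, c, hc, h1, h2, rfl⟩ := ht
      intro r
      have hr : r ∈ (⊤ : Submodule k (Env k V N)) := trivial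
      rw [← span_ten] at hr
      induction hr using Submodule.span_induction with
      | zero => rw [zero_smul_env, map_zero]
      | add x y _ _ hx hy => rw [add_smul, map_add, hx, hy, add_zero]
      | smul c r _ hr => rw [hk, hr, smul_zero]
      | mem r hr =>
        obtain ⟨p, q, rfl⟩ := hr
        rw [smul_sub, map_sub, smul_tQ, smul_tQ, hσ, hσ, ← scaleSeq_fullSeq, ← scaleSeq_fullSeq,
          h1, h2, scaleSeq_update_castSucc, scaleSeq_update_succ, hrel _ i c hc, sub_self]
  refine ⟨QuotientAddGroup.lift (relQ k V N n).toAddSubgroup σ fun t ht => ?_, hσ⟩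
  have := hz t ht 1
  rwa [one_smul] at this

end

variable (k V N) in
theorem exists_homotopyQ (n : ℕ) : ∃ f : Q k V N n →+ Q k V N (n + 1),
    ∀ (α : TQA k V N) (a : Fin n → Aplus k V N) (β : TQA k V N),
      f (elemQ α a β) = elemQ 1 (Fin.cons (plus k V N α) a : Fin (n + 1) → Aplus k V N) β := by
  obtain ⟨f, hf⟩ := exists_addMonoidHom_seq
    (Λ := (elemSeq k V N (n + 1)).curryLeft 1) fun s i c hc => by
      rw [MultilinearMap.curryLeft_apply, MultilinearMap.curryLeft_apply, Fin.cons_update,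
        Fin.cons_update]
      exact elemSeq_rel (Fin.cons 1 s) i.succ hc
  refine ⟨f, fun α a β => ?_⟩
  rw [hf, MultilinearMap.curryLeft_apply, elemSeq_apply]
  have h1 : (Fin.cons 1 (fullSeq α a β) : Fin (n + 3) → TQA k V N) (Fin.last (n + 2)) = β := by
    rw [← Fin.succ_last, Fin.cons_succ, fullSeq_last]
  have h2 : mid (Fin.cons 1 (fullSeq α a β) : Fin (n + 3) → TQA k V N) =
      Fin.cons (plus k V N α) a := by
    funext i
    rw [mid, Fin.cons_succ]
    induction i using Fin.cases with
    | zero => rfl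
    | succ i =>
      rw [Fin.cons_succ, ← Fin.succ_castSucc, fullSeq_mid, plus_coe]
  rw [h1, h2]; rfl

variable (k V N) in
/-- The contracting homotopy `α[a_1|…|a_n]β ↦ 1[α|a_1|…|a_n]β` of the bar resolution, where the
component of `α` in `kΔ_0` is dropped. -/
def homotopyQ (n : ℕ) : Q k V N n →+ Q k V N (n + 1) := (exists_homotopyQ k V N n).choose

theorem homotopyQ_elemQ {n : ℕ} (α : TQA k V N) (a : Fin n → Aplus k V N) (β : TQA k V N) :
    homotopyQ k V N n (elemQ α a β) =
      elemQ 1 (Fin.cons (plus k V N α) a : Fin (n + 1) → Aplus k V N) β :=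
  (exists_homotopyQ k V N n).choose_spec α a β

variable (k V N) in
/-- The contracting homotopy of the bar resolution in degree `-1`: it is `β ↦ 1[]β`. -/
def homotopyQAug : TQA k V N →+ Q k V N 0 where
  toFun β := elemQ 1 Fin.elim0 β
  map_zero' := by rw [elemQ_eq_smul, ten_zero_right, zero_smul_env]
  map_add' x y := by
    rw [elemQ_eq_smul, ten_add_right, add_smul, ← elemQ_eq_smul, ← elemQ_eq_smul]

end BarDifferential

/-! ### The reduced bar resolution is a projective resolution -/

section BarResolution

variable {k : Type u} [Field k] {V : Type v} [Quiver.{w} V] [Fintype V] {N : ℕ}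

theorem elemQ_sub_left {n : ℕ} (α α' : TQA k V N) (a : Fin n → Aplus k V N) (β : TQA k V N) :
    elemQ (α - α') a β = elemQ α a β - elemQ α' a β := by
  rw [elemQ_eq_smul, sub_eq_add_neg, ten_add_left, add_smul, ← elemQ_eq_smul]
  have : ten (-α') β = -ten α' β := TensorProduct.neg_tmul _ _
  rw [this, neg_smul, ← elemQ_eq_smul, sub_eq_add_neg]

theorem fullSeq_cons {n : ℕ} (α : TQA k V N) (x : Aplus k V N) (a : Fin n → Aplus k V N)
    (β : TQA k V N) : fullSeq α (Fin.cons x a : Fin (n + 1) → Aplus k V N) β =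
      Fin.cons α (fullSeq (x : TQA k V N) a β) := by
  have h : (fun i => ((Fin.cons x a : Fin (n + 1) → Aplus k V N) i : TQA k V N)) =
      Fin.cons (x : TQA k V N) fun i => (a i : TQA k V N) := by
    funext i
    induction i using Fin.cases <;> rfl
  rw [fullSeq, fullSeq, h, Fin.cons_snoc_eq_snoc_cons, Fin.cons_snoc_eq_snoc_cons,
    Fin.cons_snoc_eq_snoc_cons]

theorem homotopyQ_elemSeq {n : ℕ} (s : Fin (n + 2) → TQA k V N) :
    homotopyQ k V N n (elemSeq k V N n s) = elemSeq k V N (n + 1) (Fin.cons 1 s) := by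
  rw [elemSeq_apply, elemSeq_apply, homotopyQ_elemQ]
  congr 1
  funext i
  induction i using Fin.cases <;> rfl

/-- The contraction of the new entry `1` with its neighbour gives back the sequence, and the other
contractions commute with adding the entry `1`. -/
theorem barSum_cons {n : ℕ} (s : Fin (n + 3) → TQA k V N) :
    barSum k V N (n + 1) (Fin.cons 1 s) =
      elemSeq k V N (n + 1) s - homotopyQ k V N n (barSum k V N n s) := by
  rw [barSum_apply, barSum_apply, Fin.sum_univ_succ, contract_zero_cons one_mul, map_sum,
    sub_eq_add_neg, ← Finset.sum_neg_distrib, Fin.val_zero, pow_zero, one_smul]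
  congr 1
  refine Finset.sum_congr rfl fun i _ => ?_
  rw [contract_succ_cons, map_zsmul, homotopyQ_elemSeq, Fin.val_succ, pow_succ, mul_neg_one,
    neg_smul]

theorem b_homotopyQ_elemQ {n : ℕ} (α : TQA k V N) (a : Fin (n + 1) → Aplus k V N) (β : TQA k V N) :
    b k V N (n + 1) (homotopyQ k V N (n + 1) (elemQ α a β)) =
      elemQ (plus k V N α : TQA k V N) a β -
        homotopyQ k V N n (b k V N n (elemQ (plus k V N α : TQA k V N) a β)) := by
  rw [homotopyQ_elemQ, b_elemQ, ← barSum_fullSeq, fullSeq_cons, barSum_cons, elemSeq_fullSeq,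
    b_elemQ, barSum_fullSeq]

/-- An element `c` of `kΔ_0` in front can be moved to the first entry. -/
theorem elemQ_gr_zero {n : ℕ} {c : PathAlg k V} (hc : c ∈ gr k V 0) (a : Fin (n + 1) → Aplus k V N)
    (β : TQA k V N) : elemQ (toA k V N c) a β =
      elemQ 1 (Fin.cons (plus k V N (toA k V N c * (a 0 : TQA k V N))) (Fin.tail a) :
        Fin (n + 1) → Aplus k V N) β := by
  have h := elemSeq_rel (fullSeq 1 a β) 0 hc
  have h1 : fullSeq 1 a β (Fin.succ 0) = a 0 := rfl
  rw [Fin.castSucc_zero, fullSeq_zero, one_mul, ← fullSeq_eq_update_zero, elemSeq_fullSeq, h1] at h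
  rw [h, elemSeq_apply]
  have h2 := mid_update_mid (fullSeq 1 a β) 0 (toA k V N c * (a 0 : TQA k V N))
  have h3 : (Fin.castSucc 0 : Fin (n + 2)).succ = (Fin.succ 0 : Fin (n + 3)) := rfl
  rw [h3, mid_fullSeq] at h2
  rw [h2, Function.update_of_ne (Fin.succ_ne_zero _).symm, fullSeq_zero, Function.update_of_ne,
    fullSeq_last]
  · congr 1
    funext i
    induction i using Fin.cases with
    | zero => rw [Function.update_self]; rfl
    | succ i => rw [Function.update_of_ne (Fin.succ_ne_zero _)]; rfl
  · rw [← Fin.succ_last]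
    exact fun h => (Fin.last_pos (n := n)).ne' (Fin.succ_injective _ h)

theorem homotopyQ_zero_gr {n : ℕ} {c : PathAlg k V} (hc : c ∈ gr k V 0) (a : Fin n → Aplus k V N)
    (β : TQA k V N) : homotopyQ k V N n (elemQ (toA k V N c) a β) = 0 := by
  rw [homotopyQ_elemQ, plus_gr_zero hc, ← elemSeq_fullSeq]
  refine (elemSeq k V N (n + 1)).map_coord_zero (Fin.succ 0) ?_
  rfl

/-- Only the first term of `b(c[a_1|…]β)` survives under the homotopy, for `c ∈ kΔ_0`. -/
theorem homotopyQ_b_gr_zero {n : ℕ} {c : PathAlg k V} (hc : c ∈ gr k V 0)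
    (a : Fin (n + 1) → Aplus k V N) (β : TQA k V N) :
    homotopyQ k V N n (b k V N n (elemQ (toA k V N c) a β)) = elemQ (toA k V N c) a β := by
  rw [b_elemQ, bVal, map_add, map_add, map_sum, map_zsmul, homotopyQ_zero_gr hc, smul_zero,
    add_zero, Finset.sum_eq_zero, add_zero, homotopyQ_elemQ, elemQ_gr_zero hc]
  intro i _
  rw [map_zsmul, homotopyQ_zero_gr hc, smul_zero]

theorem b_homotopyQ_succ (n : ℕ) (x : Q k V N (n + 1)) :
    b k V N (n + 1) (homotopyQ k V N (n + 1) x) + homotopyQ k V N n (b k V N n x) = x := by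
  refine Q_induction (motive := fun x => b k V N (n + 1) (homotopyQ k V N (n + 1) x) +
    homotopyQ k V N n (b k V N n x) = x) (fun α a β => ?_) (by simp) (fun x y hx hy => ?_) x
  · obtain ⟨c, hc, h⟩ := exists_eq_add_plus α
    have h1 : (plus k V N α : TQA k V N) = α - toA k V N c := by rw [eq_sub_iff_add_eq', ← h]
    -- The identity holds for the component of `α` in `A_+` by `barSum_cons`; on the component `c`
    -- in `kΔ_0`, the homotopy vanishes, and `homotopyQ_b_gr_zero` applies.
    rw [b_homotopyQ_elemQ, h1, elemQ_sub_left, map_sub, map_sub, homotopyQ_b_gr_zero hc]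
    abel
  · rw [map_add, map_add, map_add, map_add, add_add_add_comm, hx, hy]

theorem b_homotopyQ_zero (x : Q k V N 0) :
    b k V N 0 (homotopyQ k V N 0 x) + homotopyQAug k V N (epsQ k V N x) = x := by
  refine Q_induction (motive := fun x => b k V N 0 (homotopyQ k V N 0 x) +
    homotopyQAug k V N (epsQ k V N x) = x) (fun α a β => ?_) (by simp) (fun x y hx hy => ?_) x
  · obtain rfl : a = Fin.elim0 := Subsingleton.elim _ _
    have e1 : ∀ x y : TQA k V N, elemQ (n := 0) x Fin.elim0 y = elemSeq k V N 0 ![x, y] :=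
      fun x y => by
        rw [← elemSeq_fullSeq]
        congr 1
        funext i
        induction i using Fin.cases with
        | zero => rfl
        | succ i => obtain rfl : i = 0 := Subsingleton.elim _ _; rfl
    have e2 : ∀ x y : TQA k V N, homotopyQAug k V N (x * y) = elemQ (n := 0) 1 Fin.elim0 (x * y) :=
      fun _ _ => rfl
    obtain ⟨c, hc, h⟩ := exists_eq_add_plus α
    have h1 : (plus k V N α : TQA k V N) = α - toA k V N c := by rw [eq_sub_iff_add_eq', ← h]
    have h2 : elemQ (n := 0) (toA k V N c) Fin.elim0 β = elemQ 1 Fin.elim0 (toA k V N c * β) := by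
      have h := elemSeq_rel (![1, β] : Fin 2 → TQA k V N) 0 hc
      rw [e1, e1]
      convert h using 2
      · funext i; fin_cases i <;> simp
      · funext i; fin_cases i <;> simp
    have h3 : homotopyQAug k V N ((α - toA k V N c) * β) =
        homotopyQAug k V N (α * β) - homotopyQAug k V N (toA k V N c * β) := by
      rw [sub_mul, map_sub]
    rw [homotopyQ_elemQ, b_elemQ, epsQ_elemQ, bVal]
    simp only [Fin.cons_zero, one_mul, Finset.univ_eq_empty, Finset.sum_empty, add_zero, zero_add,
      pow_one, neg_smul, one_smul]
    have e3 : ∀ a : Fin 0 → Aplus k V N, a = Fin.elim0 := fun a => Subsingleton.elim _ _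
    have h4 : (Fin.cons (plus k V N α) Fin.elim0 : Fin 1 → Aplus k V N) (Fin.last 0) =
      plus k V N α := rfl
    rw [e3 (Fin.tail (Fin.cons (plus k V N α) Fin.elim0 : Fin 1 → Aplus k V N)),
      e3 (Fin.init (Fin.cons (plus k V N α) Fin.elim0 : Fin 1 → Aplus k V N)), h4, ← e2, h1, h3,
      e2 (toA k V N c), ← h2,
      elemQ_sub_left]
    abel
  · rw [map_add, map_add, map_add, map_add, add_add_add_comm, hx, hy]

theorem elemQ_one_eq_homotopyQ {n : ℕ} (a : Fin (n + 1) → Aplus k V N) :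
    elemQ 1 a 1 = homotopyQ k V N n (elemQ (a 0 : TQA k V N) (Fin.tail a) 1) := by
  rw [homotopyQ_elemQ, plus_coe, Fin.cons_self_tail]

/-- Bimodule maps on `Q_{n+1}` which agree on the image of the homotopy are equal. -/
theorem linearMap_ext_homotopyQ {M : Type*} [AddCommGroup M] [Module (Env k V N) M] {n : ℕ}
    {f f' : Q k V N (n + 1) →ₗ[Env k V N] M}
    (h : ∀ x, f (homotopyQ k V N n x) = f' (homotopyQ k V N n x)) : f = f' := by
  ext x
  refine Q_induction (motive := fun x => f x = f' x) (fun α a β => ?_) (by simp)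
    (fun x y hx hy => by rw [map_add, map_add, hx, hy]) x
  rw [elemQ_eq_smul, map_smul, map_smul, elemQ_one_eq_homotopyQ, h]

theorem epsQ_homotopyQAug (β : TQA k V N) : epsQ k V N (homotopyQAug k V N β) = β := by
  refine (epsQ_elemQ 1 Fin.elim0 β).trans (one_mul β)

theorem epsQ_b (x : Q k V N 1) : epsQ k V N (b k V N 0 x) = 0 := by
  have : epsQ k V N ∘ₗ b k V N 0 = 0 := linearMap_ext_homotopyQ fun x => by
    have h := congrArg (epsQ k V N) (b_homotopyQ_zero x)
    rw [map_add, epsQ_homotopyQAug] at h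
    exact add_eq_right.1 h
  exact LinearMap.congr_fun this x

theorem b_b (n : ℕ) (x : Q k V N (n + 2)) : b k V N n (b k V N (n + 1) x) = 0 := by
  induction n with
  | zero =>
    have : b k V N 0 ∘ₗ b k V N 1 = 0 := linearMap_ext_homotopyQ fun x => by
      have h := congrArg (b k V N 0) (b_homotopyQ_succ 0 x)
      have h2 := b_homotopyQ_zero (b k V N 0 x)
      rw [epsQ_b, map_zero, add_zero] at h2
      rw [map_add, h2] at h
      exact add_eq_right.1 h
    exact LinearMap.congr_fun this x
  | succ n ih =>
    have : b k V N (n + 1) ∘ₗ b k V N (n + 2) = 0 := linearMap_ext_homotopyQ fun x => by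
      have h := congrArg (b k V N (n + 1)) (b_homotopyQ_succ (n + 1) x)
      have h2 := b_homotopyQ_succ n (b k V N (n + 1) x)
      rw [ih, map_zero, add_zero] at h2
      rw [map_add, h2] at h
      exact add_eq_right.1 h
    exact LinearMap.congr_fun this x

variable (k V N) in
theorem isProjRes_Q : IsProjRes (Q k V N) (b k V N) (epsQ k V N) :=
  IsProjRes.of_homotopy (fun n => (isFreeBy_barGen n).projective) (homotopyQ k V N)
    (homotopyQAug k V N) epsQ_homotopyQAug b_homotopyQ_zero b_homotopyQ_succ epsQ_b b_b

end BarResolution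

/-! ### The map from the minimal resolution to the bar resolution -/

section MapF

variable {k : Type u} [Field k] {V : Type v} [Quiver.{w} V] [Fintype V] {N : ℕ}

variable (N) in
/-- The lengths of the paths `p_1, …, p_n` in the definition of `F_n`. -/
def partsSet (n : ℕ) : Finset (Fin n → ℕ) :=
  Fintype.piFinset fun i : Fin n => if Even (n + (i : ℕ)) then Finset.Ico 1 N else {1}

theorem mem_partsSet {n : ℕ} {c : Fin n → ℕ} : c ∈ partsSet N n ↔
    ∀ i : Fin n, c i ∈ if Even (n + (i : ℕ)) then Finset.Ico 1 N else {1} :=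
  Fintype.mem_piFinset

theorem cons_mem_partsSet {n : ℕ} {j : ℕ} {c : Fin n → ℕ} :
    (Fin.cons j c : Fin (n + 1) → ℕ) ∈ partsSet N (n + 1) ↔
      (j ∈ if Even (n + 1) then Finset.Ico 1 N else {1}) ∧ c ∈ partsSet N n := by
  rw [mem_partsSet, mem_partsSet, Fin.forall_fin_succ]
  have : ∀ i : ℕ, Even (n + 1 + (i + 1)) ↔ Even (n + i) := fun i => by
    rw [show n + 1 + (i + 1) = n + i + 2 by omega, Nat.even_add]; simp
  simp only [Fin.cons_zero, Fin.cons_succ, Fin.val_zero, add_zero, Fin.val_succ, this]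

/-- The paths `p_1, …, p_n` in the definition of `F_n` fit into a path of length `mdeg N n`. -/
theorem sum_le_mdeg {n : ℕ} {c : Fin n → ℕ} (h : c ∈ partsSet N n) : ∑ i, c i ≤ mdeg N n := by
  induction n with
  | zero => simp
  | succ n ih =>
    rw [← Fin.cons_self_tail c, cons_mem_partsSet] at h
    have h2 := ih h.2
    have h1 := h.1
    have h3 : ∑ i, c i = c 0 + ∑ i, Fin.tail c i := Fin.sum_univ_succ c
    by_cases hn : Even n
    · rw [if_neg (not_even_succ hn), Finset.mem_singleton] at h1
      rw [mdeg_succ_of_even hn]; omega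
    · rw [if_pos (even_succ hn), Finset.mem_Ico] at h1
      have := mdeg_succ_of_odd (N := N) hn
      omega

theorem sum_partsSet_succ {M : Type*} [AddCommMonoid M] {n : ℕ} (f : (Fin (n + 1) → ℕ) → M) :
    ∑ c ∈ partsSet N (n + 1), f c =
      ∑ j ∈ (if Even (n + 1) then Finset.Ico 1 N else {1}), ∑ c ∈ partsSet N n,
        f (Fin.cons j c) := by
  rw [← Finset.sum_product']
  refine Finset.sum_nbij' (fun c => (c 0, Fin.tail c)) (fun x => Fin.cons x.1 x.2) ?_ ?_ ?_ ?_ ?_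
  · intro c hc
    rw [← Fin.cons_self_tail c, cons_mem_partsSet] at hc
    exact Finset.mem_product.2 hc
  · intro x hx
    exact cons_mem_partsSet.2 (Finset.mem_product.1 hx)
  · intro c _; exact Fin.cons_self_tail c
  · intro x _; rfl
  · intro c _; exact congrArg f (Fin.cons_self_tail c).symm

variable (k N) in
/-- The element `1[p_1|…|p_n]p_{n+1}`, where `p = p_1 … p_{n+1}` and the lengths of `p_1, …, p_n`
are given by `c`. -/
def cutQ {n : ℕ} (p : Pth V) (c : Fin n → ℕ) : Q k V N n :=
  elemQ 1 (pieces k N p c) (pa k N (rest p (∑ i, c i)))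

/-- The tuples `(x_1, …, x_k)` correspond to the length sequences in `partsSet`. -/
theorem FVal_eq (n : ℕ) (p : Pth V) : FVal k N n p = ∑ c ∈ partsSet N n, cutQ k N p c := by
  rw [FVal]
  refine Finset.sum_nbij' (parts n) (fun c m => c ⟨2 * (m : ℕ) + n % 2, by have := m.2; omega⟩)
    ?_ ?_ ?_ ?_ ?_
  · intro x hx
    rw [mem_partsSet]
    intro i
    rw [parts]
    split_ifs
    · exact Fintype.mem_piFinset.1 hx _
    · exact Finset.mem_singleton_self 1
  · intro c hc
    rw [Fintype.mem_piFinset]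
    intro m
    have := mem_partsSet.1 hc ⟨2 * (m : ℕ) + n % 2, by have := m.2; omega⟩
    rwa [if_pos] at this
    rw [Nat.even_iff]; simp only []; omega
  · intro x _
    funext m
    rw [parts, dif_pos]
    · congr 1; ext; simp only []; omega
    · rw [Nat.even_iff]; simp only []; omega
  · intro c hc
    funext i
    rw [parts]
    split_ifs with h
    · congr 1; ext; rw [Nat.even_iff] at h; simp only []; omega
    · have := mem_partsSet.1 hc i
      rw [if_neg h, Finset.mem_singleton] at this
      exact this.symm
  · intro x _; rfl

theorem elemQ_vtx_left {n : ℕ} {a : Fin (n + 1) → Aplus k V N} (β : TQA k V N) {x : V}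
    (h : pa k N (vtx x) * (a 0 : TQA k V N) = a 0) : elemQ (pa k N (vtx x)) a β = elemQ 1 a β := by
  refine (elemQ_gr_zero (vtx_mem_gr x) a β).trans ?_
  have h' : toA k V N (ofPath k (vtx x)) * (a 0 : TQA k V N) = a 0 := h
  rw [h', plus_coe, Fin.cons_self_tail]

theorem vtx_mul_pathPlus {p : Pth V} {x : V} (h : p.1 = x) :
    pa k N (vtx x) * (pathPlus k N p : TQA k V N) = pathPlus k N p := by
  rw [← plus_pa]
  by_cases hp : 1 ≤ len p
  · rw [plus_pa, coe_pathPlus hp, vtx_mul h]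
  · rw [plus_pa, pathPlus, dif_neg hp]; exact mul_zero _

theorem elemQ_vtx_zero (x : V) (a : Fin 0 → Aplus k V N) (β : TQA k V N) :
    elemQ (pa k N (vtx x)) a β = elemQ 1 a (pa k N (vtx x) * β) := by
  have h := elemSeq_rel (fullSeq 1 a β) 0 (vtx_mem_gr x)
  have h1 : fullSeq 1 a β (Fin.succ 0) = β := rfl
  rw [Fin.castSucc_zero, fullSeq_zero, one_mul, ← fullSeq_eq_update_zero, elemSeq_fullSeq, h1] at h
  refine h.trans ?_
  rw [← elemSeq_fullSeq]
  congr 1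
  rw [fullSeq_eq_update_last 1 a β, fullSeq_eq_update_last 1 a (pa k N (vtx x) * β)]
  exact Function.update_idem (α := Fin 2) (a := 1) _ _ _

theorem idem_smul_cutQ {n : ℕ} (p : Pth V) (c : Fin n → ℕ) :
    idem k N p.1 p.2.1 • cutQ k N p c = cutQ k N p c := by
  rw [idem, cutQ, ten_smul_elemQ, mul_one, mul_vtx (rest_tgt _ _)]
  cases n with
  | zero =>
    rw [elemQ_vtx_zero, vtx_mul]
    simp only [Finset.univ_eq_empty, Finset.sum_empty, rest_zero]
  | succ n =>
    refine elemQ_vtx_left _ ?_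
    rw [pieces_apply, Fin.val_zero, psum_zero]
    exact vtx_mul_pathPlus (seg_zero_src _ _)

theorem exists_F (n : ℕ) : ∃ f : P k V N n →ₗ[Env k V N] Q k V N n,
    ∀ p : {p : Pth V // len p = mdeg N n}, f (genP k V N n p) = FVal k N n p.1 :=
  exists_linearMap_P n _ fun p => by
    simp only [FVal_eq, Finset.smul_sum, idem_smul_cutQ]

theorem F_genP (n : ℕ) (p : {p : Pth V // len p = mdeg N n}) :
    F k V N n (genP k V N n p) = FVal k N n p.1 := by
  have h := linExt_apply (R := Env k V N) (exists_F (k := k) (V := V) (N := N) n) p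
  exact h

theorem cutP_eq_smul {n : ℕ} {w : Pth V} {j : ℕ} (h : j + mdeg N n ≤ len w) :
    cutP k N n w j = ten (pa k N (seg w 0 j)) (pa k N (rest w (j + mdeg N n))) •
      genP k V N n ⟨seg w j (mdeg N n), len_seg h⟩ := by
  rw [cutP, elemP_eq_smul, genP]

theorem cutQ_cons {n : ℕ} {w : Pth V} {j m : ℕ} (h : j + m ≤ len w) {c : Fin n → ℕ}
    (hc : ∑ i, c i ≤ m) : cutQ k N w (Fin.cons j c : Fin (n + 1) → ℕ) =
      elemQ 1 (Fin.cons (pathPlus k N (seg w 0 j)) (pieces k N (seg w j m) c) :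
        Fin (n + 1) → Aplus k V N)
        (pa k N (rest (seg w j m) (∑ i, c i)) * pa k N (rest w (j + m))) := by
  have e1 : pieces k N w (Fin.cons j c : Fin (n + 1) → ℕ) =
      Fin.cons (pathPlus k N (seg w 0 j)) (pieces k N (seg w j m) c) := by
    funext i
    rw [pieces_apply]
    induction i using Fin.cases with
    | zero => rw [Fin.val_zero, psum_zero]; rfl
    | succ i =>
      have := psum_add_le c i
      rw [Fin.val_succ, psum_cons, Fin.cons_succ, Fin.cons_succ, Fin.cons_zero, Fin.tail_cons,
        pieces_apply, seg_seg h (by omega)]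
  have e2 : ∑ i, (Fin.cons j c : Fin (n + 1) → ℕ) i = j + ∑ i, c i := Fin.sum_cons _ _
  have h3 : j + ∑ i, c i + (m - ∑ i, c i) = j + m := by omega
  have e3 := joinP_seg_rest (w := w) (i := j + ∑ i, c i) (l := m - ∑ i, c i) (by omega)
  rw [h3] at e3
  rw [cutQ, e1, e2, rest_seg h hc, pa_mul, e3]
  rw [seg_tgt (by omega), h3]

theorem homotopyQ_F_cutP {n : ℕ} {w : Pth V} {j : ℕ} (h : j + mdeg N n ≤ len w) :
    homotopyQ k V N n (F k V N n (cutP k N n w j)) =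
      ∑ c ∈ partsSet N n, cutQ k N w (Fin.cons j c : Fin (n + 1) → ℕ) := by
  rw [cutP_eq_smul h, map_smul, F_genP, FVal_eq, Finset.smul_sum, map_sum]
  refine Finset.sum_congr rfl fun c hc => ?_
  rw [cutQ, ten_smul_elemQ, mul_one, homotopyQ_elemQ, plus_pa, cutQ_cons h (sum_le_mdeg hc)]

/-- A vertex as first entry gives zero, since it is dropped in `A_+`. -/
theorem cutQ_cons_zero {n : ℕ} (w : Pth V) (c : Fin n → ℕ) :
    cutQ k N w (Fin.cons 0 c : Fin (n + 1) → ℕ) = 0 := by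
  rw [cutQ, ← elemSeq_fullSeq]
  refine (elemSeq k V N (n + 1)).map_coord_zero (Fin.castSucc 0).succ ?_
  rw [fullSeq_mid, pieces_apply, pathPlus, dif_neg]
  · rfl
  · rw [Fin.val_zero, psum_zero, Fin.cons_zero, seg_len_zero]
    simp [len, vtx]

theorem genP_eq_cutP (n : ℕ) (p : {p : Pth V // len p = mdeg N n}) :
    genP k V N n p = cutP k N n p.1 0 := by
  have h1 := elemP_vtx_left (k := k) (N := N) n 1 (pa k N (vtx p.1.2.1)) (p := p.1) rfl
  have h2 := elemP_vtx_right (k := k) (N := N) n 1 1 (p := p.1) rfl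
  rw [one_mul] at h1
  rw [mul_one] at h2
  rw [genP, cutP, seg_len_zero, zero_add, seg_full p.2, rest_len p.2, h1, h2]

/-- On the generators, `F` satisfies the recursion which is given by the contracting homotopy of
the bar resolution. -/
theorem F_genP_succ (n : ℕ) (p : {p : Pth V // len p = mdeg N (n + 1)}) :
    F k V N (n + 1) (genP k V N (n + 1) p) =
      homotopyQ k V N n (F k V N n (d k V N n (genP k V N (n + 1) p))) := by
  have hp := p.2
  rw [F_genP, FVal_eq, sum_partsSet_succ, genP_eq_cutP]
  by_cases hn : Even n
  · have hm := mdeg_succ_of_even (N := N) hn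
    -- `d` of the generator is `c_1 - c_0`; the second term gives only vertices as first entries.
    rw [d_cutP_of_even hn (by omega), map_sub, map_sub, homotopyQ_F_cutP (by omega),
      homotopyQ_F_cutP (by omega), Finset.sum_eq_zero fun c _ => cutQ_cons_zero _ c, sub_zero,
      if_neg (not_even_succ hn), Finset.sum_singleton]
  · have hm := mdeg_succ_of_odd (N := N) hn
    -- `d` of the generator is `c_0 + … + c_{N-1}`; the index `j` becomes the first length `x_1`,
    -- and `j = 0` does not contribute.
    rw [d_cutP_of_odd hn (by omega), map_sum, map_sum, if_pos (even_succ hn)]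
    have : ∀ i ∈ Finset.range N, homotopyQ k V N n (F k V N n (cutP k N n p.1 (0 + i))) =
        ∑ c ∈ partsSet N n, cutQ k N p.1 (Fin.cons i c : Fin (n + 1) → ℕ) := fun i hi => by
      rw [Finset.mem_range] at hi
      rw [zero_add, homotopyQ_F_cutP (by omega)]
    rw [Finset.sum_congr rfl this]
    refine Finset.sum_subset (fun i hi => ?_) fun i hi hi' => ?_
    · rw [Finset.mem_Ico] at hi; exact Finset.mem_range.2 hi.2
    · obtain rfl : i = 0 := by
        rw [Finset.mem_Ico] at hi'; rw [Finset.mem_range] at hi; omega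
      exact Finset.sum_eq_zero fun c _ => cutQ_cons_zero _ c

variable (k V N) in
theorem epsQ_comp_F : epsQ k V N ∘ₗ F k V N 0 = epsP k V N := by
  refine (isFreeBy_genP 0).linearMap_ext fun p => ?_
  have h1 : F k V N 0 (genP k V N 0 p) = elemQ 1 (pieces k N p.1 Fin.elim0) (pa k N p.1) := by
    have : partsSet N 0 = {Fin.elim0} := by
      ext c; simp [mem_partsSet, Subsingleton.elim c Fin.elim0]
    rw [F_genP, FVal_eq, this, Finset.sum_singleton, cutQ]
    simp only [Finset.univ_eq_empty, Finset.sum_empty, rest_zero]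
  rw [LinearMap.comp_apply, h1, epsQ_elemQ, genP, epsP_elemP, coe_inGr p.2, mul_one]
  rfl

end MapF

/-! ### The map from the bar resolution to the minimal resolution -/

section MapG

variable {k : Type u} [Field k] {V : Type v} [Quiver.{w} V] [Fintype V] {N : ℕ}

variable (N) in
/-- The condition on the lengths of the paths `α_1, …, α_n` which says that `α_i α_{i+1} = 0` for
all `i` with the same parity as `n + 1`. -/
def Overlong {n : ℕ} (c : Fin n → ℕ) : Prop :=
  ∀ (i : ℕ) (hi : i + 1 < n), i % 2 = n % 2 → N ≤ c ⟨i, by omega⟩ + c ⟨i + 1, hi⟩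

theorem psum_one {n : ℕ} (c : Fin (n + 1) → ℕ) : psum c 1 = c 0 := by
  have := psum_cons c 0
  rwa [psum_zero] at this

theorem overlong_succ_of_even {n : ℕ} (hn : Even n) {c : Fin (n + 1) → ℕ} :
    Overlong N c ↔ Overlong N (Fin.tail c) := by
  rw [Nat.even_iff] at hn
  constructor
  · intro h i hi hp
    exact h (i + 1) (by omega) (by omega)
  · intro h i hi hp
    obtain ⟨i, rfl⟩ : ∃ i', i = i' + 1 := ⟨i - 1, by omega⟩
    exact h i (by omega) (by omega)

theorem overlong_succ_of_odd {n : ℕ} (hn : ¬ Even n) {c : Fin (n + 1) → ℕ} :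
    Overlong N c ↔ Overlong N (Fin.tail c) ∧ N ≤ c 0 + psum (Fin.tail c) 1 := by
  rw [Nat.even_iff] at hn
  obtain ⟨n, rfl⟩ : ∃ m, n = m + 1 := ⟨n - 1, by omega⟩
  rw [psum_one]
  constructor
  · intro h
    exact ⟨fun i hi hp => h (i + 1) (by omega) (by omega), h 0 (by omega) (by omega)⟩
  · rintro ⟨h, h0⟩ i hi hp
    rcases i with _ | i
    · exact h0
    · exact h i (by omega) (by omega)

/-- If consecutive products vanish as in `Overlong`, then the elements `cutP` in the definition of
`G_n` are cut out of a path which is long enough. -/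
theorem Overlong.mdeg_le {n : ℕ} {c : Fin n → ℕ} (h : Overlong N c) :
    (Even n → mdeg N n ≤ ∑ i, c i) ∧ (¬ Even n → mdeg N n + psum c 1 ≤ (∑ i, c i) + 1) := by
  induction n with
  | zero => exact ⟨fun _ => by rw [mdeg_zero]; exact Nat.zero_le _, fun h => absurd Even.zero h⟩
  | succ n ih =>
    have h3 : ∑ i, c i = c 0 + ∑ i, Fin.tail c i := Fin.sum_univ_succ c
    by_cases hn : Even n
    · have hm := mdeg_succ_of_even (N := N) hn
      have := (ih ((overlong_succ_of_even hn).1 h)).1 hn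
      refine ⟨fun h => absurd h (not_even_succ hn), fun _ => ?_⟩
      rw [psum_one]; omega
    · have hm := mdeg_succ_of_odd (N := N) hn
      obtain ⟨h1, h2⟩ := (overlong_succ_of_odd hn).1 h
      have := (ih h1).2 hn
      exact ⟨fun _ => by omega, fun h => absurd (even_succ hn) h⟩

open Classical in
variable (k N) in
/-- The value of `G_n` on the word of paths with concatenation `w` and lengths `c`, in terms of the
elements `cutP`. -/
def wordG {n : ℕ} (w : Pth V) (c : Fin n → ℕ) : P k V N n :=
  if Overlong N c then
    if Even n then cutP k N n w 0 else ∑ j ∈ Finset.range (psum c 1), cutP k N n w j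
  else 0

/-- The product of two consecutive paths is zero in `A` if and only if the sum of their lengths is
at least `N`. -/
theorem pieces_mul_pieces_eq_zero {n : ℕ} (q : BarWord V N n) {i : ℕ} (hi : i + 1 < n) :
    (pieces k N q.path q.lens ⟨i, by omega⟩ : TQA k V N) *
        (pieces k N q.path q.lens ⟨i + 1, hi⟩ : TQA k V N) = 0 ↔
      N ≤ q.lens ⟨i, by omega⟩ + q.lens ⟨i + 1, hi⟩ := by
  have h1 := barWord_add_le q ⟨i, by omega⟩
  have h2 := barWord_add_le q ⟨i + 1, hi⟩
  have h3 := psum_succ q.lens ⟨i, by omega⟩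
  simp only [] at h1 h2 h3
  have h4 := joinP_seg_seg (w := q.path) (i := psum q.lens i) (l := q.lens ⟨i, by omega⟩)
    (l' := q.lens ⟨i + 1, hi⟩) (by omega)
  have h5 : (pieces k N q.path q.lens ⟨i, by omega⟩ : TQA k V N) *
        (pieces k N q.path q.lens ⟨i + 1, hi⟩ : TQA k V N) = pa k N (seg q.path (psum q.lens i)
        (q.lens ⟨i, by omega⟩ + q.lens ⟨i + 1, hi⟩)) := by
    rw [coe_pieces, coe_pieces, ← h4]
    simp only [h3]
    refine pa_mul ?_
    rw [seg_tgt h1, seg_src]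
  have h6 := len_seg (w := q.path) (i := psum q.lens i)
    (l := q.lens ⟨i, by omega⟩ + q.lens ⟨i + 1, hi⟩) (by omega)
  rw [h5]
  constructor
  · intro h
    by_contra hlt
    exact pa_ne_zero (by rw [h6]; omega) h
  · intro h
    exact pa_eq_zero (by rwa [h6])

theorem cutP_zero (n : ℕ) (w : Pth V) : cutP k N n w 0 =
    elemP n 1 (inGr k (mdeg N n) (seg w 0 (mdeg N n))) (pa k N (rest w (mdeg N n))) := by
  have h1 := elemP_vtx_left (k := k) (N := N) n 1 (pa k N (rest w (mdeg N n)))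
    (p := seg w 0 (mdeg N n)) (seg_zero_src _ _)
  rw [one_mul] at h1
  rw [cutP, seg_len_zero, zero_add, h1]

theorem GVal_eq {n : ℕ} (q : BarWord V N n) : GVal k N n q = wordG k N q.path q.lens := by
  have h : (∀ (i : ℕ) (hi : i + 1 < n), i % 2 = n % 2 →
      (pieces k N q.path q.lens ⟨i, by omega⟩ : TQA k V N) *
        (pieces k N q.path q.lens ⟨i + 1, hi⟩ : TQA k V N) = 0) ↔ Overlong N q.lens :=
    forall_congr' fun i => forall_congr' fun hi => imp_congr_right fun _ =>
      pieces_mul_pieces_eq_zero q hi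
  rw [GVal, wordG]
  by_cases h1 : Overlong N q.lens
  · rw [if_pos (h.2 h1), if_pos h1]
    by_cases hn : Even n
    · rw [dif_pos hn, if_pos hn, cutP_zero]
    · rw [dif_neg hn, if_neg hn]
      obtain ⟨n, rfl⟩ : ∃ m, n = m + 1 :=
        ⟨n - 1, (Nat.succ_pred_eq_of_ne_zero (by rintro rfl; exact hn Even.zero)).symm⟩
      rw [psum_one]
      rfl
  · rw [if_neg (h.not.2 h1), if_neg h1]

theorem idem_smul_cutP (n : ℕ) (w : Pth V) (j : ℕ) :
    idem k N w.1 w.2.1 • cutP k N n w j = cutP k N n w j := by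
  rw [idem, cutP, ten_smul_elemP, vtx_mul (seg_zero_src _ _), mul_vtx (rest_tgt _ _)]

theorem idem_smul_wordG {n : ℕ} (w : Pth V) (c : Fin n → ℕ) :
    idem k N w.1 w.2.1 • wordG k N w c = wordG k N w c := by
  rw [wordG]
  split_ifs
  · exact idem_smul_cutP _ _ _
  · rw [Finset.smul_sum]; exact Finset.sum_congr rfl fun _ _ => idem_smul_cutP _ _ _
  · exact smul_zero _

theorem exists_G (n : ℕ) : ∃ f : Q k V N n →ₗ[Env k V N] P k V N n,
    ∀ q : BarWord V N n, f (barGen k N q) = GVal k N n q :=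
  exists_linearMap_Q n _ fun q => by rw [GVal_eq, idem_smul_wordG]

theorem G_barGen {n : ℕ} (q : BarWord V N n) : G k V N n (barGen k N q) = GVal k N n q := by
  have h := linExt_apply (R := Env k V N) (exists_G (k := k) (V := V) (N := N) n) q
  exact h

theorem ten_smul_cutP_right {n : ℕ} {w r : Pth V} {j : ℕ} (h : w.2.1 = r.1)
    (hj : j + mdeg N n ≤ len w) :
    ten (1 : TQA k V N) (pa k N r) • cutP k N n w j = cutP k N n (joinP w r) j := by
  have h1 : (seg w 0 (j + mdeg N n)).2.1 = (rest w (j + mdeg N n)).1 := by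
    rw [seg_tgt (by omega), zero_add]
  have h2 := joinP_seg_rest (w := w) (i := 0) (l := j + mdeg N n) (by omega)
  rw [zero_add, rest_zero] at h2
  have h3 : rest (joinP w r) (j + mdeg N n) = joinP (rest w (j + mdeg N n)) r := by
    conv_lhs => rw [← h2]
    rw [joinP_assoc h1 h]
    have := rest_joinP (p := seg w 0 (j + mdeg N n)) (q := joinP (rest w (j + mdeg N n)) r)
      (by rw [joinP_src, h1])
    rwa [len_seg (by omega)] at this
  rw [cutP, cutP, ten_smul_elemP, one_mul, pa_mul (p := rest w _) h, seg_joinP_of_le h (by omega),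
    seg_joinP_of_le h hj, h3]

theorem ten_smul_cutP_left {n : ℕ} {w : Pth V} {i j : ℕ} (h : i + j + mdeg N n ≤ len w) :
    ten (pa k N (seg w 0 i)) (1 : TQA k V N) • cutP k N n (rest w i) j =
      cutP k N n w (i + j) := by
  have h1 : (seg w 0 i).2.1 = (rest w i).1 := by rw [seg_tgt (by omega), zero_add]
  have h2 := joinP_seg_seg (w := w) (i := 0) (l := i) (l' := j) (by omega)
  rw [zero_add] at h2
  rw [cutP, cutP, ten_smul_elemP, mul_one, seg_rest (by omega), seg_rest (by omega),
    rest_rest (by omega), add_zero, pa_mul, h2, add_assoc]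
  rw [h1, seg_src]

/-- The homotopy kills `c_0` in even degrees, and `c_j` for `j < N - 1` in odd degrees, where `c_j`
is `cutP k N n w j`; multiplication by `β` from the right only changes the end of the path `w`. -/
theorem homotopyP_ten_smul_cutP {n : ℕ} {w : Pth V} {j : ℕ} (hj : j + mdeg N n ≤ len w)
    (h : if Even n then j = 0 else j + 1 < N) (β : TQA k V N) :
    homotopyP k V N n (ten 1 β • cutP k N n w j) = 0 := by
  refine linear_pa_induction (motive := fun β => homotopyP k V N n (ten 1 β • cutP k N n w j) = 0)
    (fun r => ?_) ?_ ?_ ?_ β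
  · by_cases hr : w.2.1 = r.1
    · have hj' : j + mdeg N n ≤ len (joinP w r) := by rw [len_joinP hr]; omega
      rw [ten_smul_cutP_right hr hj]
      by_cases hn : Even n
      · rw [if_pos hn] at h
        subst h
        rcases Nat.eq_zero_or_pos N with rfl | hN
        · rw [cutP_eq_zero_left hj' (Nat.zero_le _), map_zero]
        · rw [homotopyP_of_even hn hj' hN, Finset.sum_range_zero]
      · rw [if_neg hn] at h
        rw [homotopyP_of_odd hn hj', if_neg h.ne]
    · rw [cutP, ten_smul_elemP, pa_mul_of_ne (by rwa [rest_tgt]), elemP_zero_right, map_zero]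
  · rw [ten_zero_right, zero_smul_env, map_zero]
  · intro x y hx hy
    rw [ten_add_right, add_smul, map_add, hx, hy, add_zero]
  · intro c x hx
    rw [ten_smul_right, smul_assoc, map_smul, hx, smul_zero]

/-- The contracting homotopy of the minimal resolution kills the values of `G` on the elements
`1[a_1|…|a_n]β`. -/
theorem homotopyP_G_elemQ_one {n : ℕ} (a : Fin n → Aplus k V N) (β : TQA k V N) :
    homotopyP k V N n (G k V N n (elemQ 1 a β)) = 0 := by
  have key : ∀ x ∈ Submodule.span k (Set.range fun q : BarWord V N n => barGen k N q),
      homotopyP k V N n (ten 1 β • G k V N n x) = 0 := by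
    intro x hx
    induction hx using Submodule.span_induction with
    | zero => rw [map_zero, smul_zero, map_zero]
    | add x y _ _ hx hy => rw [map_add, smul_add, map_add, hx, hy, add_zero]
    | smul c x _ hx =>
      have h1 : G k V N n (c • x) = c • G k V N n x := ((G k V N n).restrictScalars k).map_smul c x
      have h2 : SMulCommClass k (Env k V N) (P k V N n) := IsScalarTower.to_smulCommClass
      rw [h1, ← smul_comm, map_smul, hx, smul_zero]
    | mem x hx =>
      obtain ⟨q, rfl⟩ := hx
      dsimp only
      rw [G_barGen, GVal_eq, wordG]
      split_ifs with h hn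
      · refine homotopyP_ten_smul_cutP ?_ (by rw [if_pos hn]) β
        have := h.mdeg_le.1 hn
        rw [q.sum_eq] at this; omega
      · rw [Finset.smul_sum, map_sum]
        refine Finset.sum_eq_zero fun j hj => ?_
        have := h.mdeg_le.2 hn
        rw [q.sum_eq] at this
        rw [Finset.mem_range] at hj
        refine homotopyP_ten_smul_cutP (by omega) ?_ β
        rw [if_neg hn]
        obtain ⟨n, rfl⟩ : ∃ m, n = m + 1 :=
          ⟨n - 1, (Nat.succ_pred_eq_of_ne_zero (by rintro rfl; exact hn Even.zero)).symm⟩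
        rw [psum_one] at hj
        -- As `|α_1| < N`, the summands have `j < |α_1| ≤ N - 1`.
        have := q.lt 0
        omega
      · rw [smul_zero, map_zero]
  have h := key _ (elemQ_one_mem a)
  rwa [← map_smul, ← elemQ_eq_smul] at h

/-- The word of paths obtained by removing the first path. -/
def BarWord.tail {n : ℕ} (q : BarWord V N (n + 1)) : BarWord V N n where
  path := rest q.path (q.lens 0)
  lens := Fin.tail q.lens
  one_le i := q.one_le i.succ
  lt i := q.lt i.succ
  sum_eq := by
    have h := q.sum_eq
    rw [Fin.sum_univ_succ] at h
    rw [len_rest (by omega)]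
    have : ∑ i, Fin.tail q.lens i = ∑ i : Fin n, q.lens i.succ := rfl
    omega

theorem pieces_tail {n : ℕ} (q : BarWord V N (n + 1)) :
    Fin.tail (pieces k N q.path q.lens) = pieces k N q.tail.path q.tail.lens := by
  funext i
  have h := barWord_add_le q i.succ
  rw [Fin.val_succ, psum_cons] at h
  rw [Fin.tail, pieces_apply, pieces_apply, Fin.val_succ, psum_cons]
  change pathPlus k N (seg q.path _ (q.lens i.succ)) =
    pathPlus k N (seg (rest q.path (q.lens 0)) (psum (Fin.tail q.lens) i) (q.lens i.succ))
  rw [seg_rest h]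

theorem barGen_succ {n : ℕ} (q : BarWord V N (n + 1)) : barGen k N q =
    elemQ 1 (pieces k N q.path q.lens) (pa k N (vtx q.path.2.1)) := by
  rw [barGen]
  refine elemQ_vtx_left _ ?_
  rw [pieces_apply, Fin.val_zero, psum_zero]
  exact vtx_mul_pathPlus (seg_zero_src _ _)

/-- The first term of the bar differential of a word, in terms of the word without its first
path. -/
theorem ten_smul_barGen_tail {n : ℕ} (q : BarWord V N (n + 1)) :
    ten (pa k N (seg q.path 0 (q.lens 0))) (1 : TQA k V N) • barGen k N q.tail =
      elemQ (pieces k N q.path q.lens 0 : TQA k V N) (Fin.tail (pieces k N q.path q.lens))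
        (pa k N (vtx q.path.2.1)) := by
  have h := barWord_add_le q 0
  rw [Fin.val_zero, psum_zero] at h
  rw [barGen, ten_smul_elemQ, pieces_tail, coe_pieces, mul_vtx, mul_one, Fin.val_zero, psum_zero]
  · rfl
  · rw [seg_tgt h, zero_add]; rfl

/-- On the generators, `G` satisfies the recursion which is given by the contracting homotopy of
the minimal resolution. -/
theorem G_barGen_succ (n : ℕ) (q : BarWord V N (n + 1)) :
    G k V N (n + 1) (barGen k N q) =
      homotopyP k V N n (G k V N n (b k V N n (barGen k N q))) := by
  -- Only the first term of the bar differential contributes.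
  have h0 : homotopyP k V N n (G k V N n (b k V N n (barGen k N q))) =
      homotopyP k V N n (ten (pa k N (seg q.path 0 (q.lens 0))) 1 •
        wordG k N q.tail.path q.tail.lens) := by
    rw [barGen_succ, b_elemQ, bVal, one_mul, map_add, map_add, map_add, map_add, map_sum, map_sum,
      map_zsmul, map_zsmul, homotopyP_G_elemQ_one, smul_zero, add_zero, Finset.sum_eq_zero,
      add_zero, ← ten_smul_barGen_tail, map_smul, G_barGen, GVal_eq]
    intro i _
    rw [map_zsmul, map_zsmul, homotopyP_G_elemQ_one, smul_zero]
  have hs := q.tail.sum_eq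
  have hl : len q.tail.path = len q.path - q.lens 0 := by
    have h := barWord_add_le q 0
    rw [Fin.val_zero, psum_zero] at h
    exact len_rest (by omega)
  have hlt := q.lt 0
  have hle := barWord_add_le q 0
  rw [Fin.val_zero, psum_zero] at hle
  rw [h0, G_barGen, GVal_eq, wordG, wordG]
  have ht : q.tail.lens = Fin.tail q.lens := rfl
  by_cases h1 : Overlong N q.tail.lens
  · by_cases hn : Even n
    · have hm := h1.mdeg_le.1 hn
      have h2 : cutP k N n q.tail.path 0 = cutP k N n (rest q.path (q.lens 0)) 0 := rfl
      rw [if_pos h1, if_pos ((overlong_succ_of_even hn).2 h1), if_pos hn, if_neg (not_even_succ hn),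
        h2, ten_smul_cutP_left (by omega), homotopyP_of_even hn (by omega) (by omega), psum_one]
      rfl
    · have hm := h1.mdeg_le.2 hn
      have h2 : ∀ j ∈ Finset.range (psum q.tail.lens 1),
          homotopyP k V N n (ten (pa k N (seg q.path 0 (q.lens 0))) 1 •
            cutP k N n q.tail.path j) =
          if q.lens 0 + j + 1 = N then cutP k N (n + 1) q.path 0 else 0 := fun j hj => by
        rw [Finset.mem_range] at hj
        have h2 : cutP k N n q.tail.path j = cutP k N n (rest q.path (q.lens 0)) j := rfl
        rw [h2, ten_smul_cutP_left (by omega), homotopyP_of_odd hn (by omega)]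
      rw [if_pos h1, if_neg hn, if_pos (even_succ hn), Finset.smul_sum, map_sum,
        Finset.sum_congr rfl h2]
      -- The homotopy picks the index `|α_1| + j = N - 1`, which occurs in the sum over `j < |α_2|`
      -- if and only if `α_1 α_2 = 0`.
      by_cases h3 : N ≤ q.lens 0 + psum q.tail.lens 1
      · rw [if_pos ((overlong_succ_of_odd hn).2 ⟨h1, h3⟩), Finset.sum_eq_single (N - 1 - q.lens 0)]
        · rw [if_pos (by omega)]
        · intro j _ hj
          rw [if_neg (by omega)]
        · intro hj
          rw [Finset.mem_range] at hj; omega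
      · rw [if_neg fun h => h3 ((overlong_succ_of_odd hn).1 h).2]
        refine (Finset.sum_eq_zero fun j hj => ?_).symm
        rw [Finset.mem_range] at hj
        rw [if_neg (by omega)]
  · have h2 : ¬ Overlong N q.lens := fun h => h1 (by
      by_cases hn : Even n
      · exact (overlong_succ_of_even hn).1 h
      · exact ((overlong_succ_of_odd hn).1 h).1)
    rw [if_neg h1, if_neg h2, smul_zero, map_zero]

variable (k V N) in
theorem epsP_comp_G : epsP k V N ∘ₗ G k V N 0 = epsQ k V N := by
  refine (isFreeBy_barGen 0).linearMap_ext fun q => ?_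
  have hl : len q.path = 0 := by rw [← q.sum_eq]; rfl
  have hp := eq_vtx_of_len hl
  have h : Overlong N q.lens := fun i hi => absurd hi (by omega)
  have ht : q.path.2.1 = q.path.1 := by rw [hp]; rfl
  rw [LinearMap.comp_apply, G_barGen, GVal_eq, wordG, if_pos h, if_pos Even.zero,
    epsP_cutP (Nat.zero_le _), barGen, epsQ_elemQ, ht, vtx_mul_vtx]
  exact congrArg _ hp

end MapG

end TruncQuiver

end

open TruncQuiver in
theorem theorem4p1 (k : Type*) [Field k] (V : Type*) [Quiver V] [Fintype V] (N : ℕ) (hN : 1 ≤ N) :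
    -- the bimodules `P_n` and `Q_n` are generated by the elements on which the maps are defined
    (∀ n, Submodule.span (Env k V N)
        {x : P k V N n | ∃ p : Pth V, len p = mdeg N n ∧ x = elemP n 1 (inGr k _ p) 1} = ⊤) ∧
    (∀ n, Submodule.span (Env k V N)
        {x : Q k V N n | ∃ q : BarWord V N n, x = barGen k N q} = ⊤) ∧
    -- the differentials and the augmentations are well defined
    (∀ n (α : TQA k V N) (p : Pth V) (β : TQA k V N), len p = mdeg N (n + 1) →
        d k V N n (elemP (n + 1) α (inGr k _ p) β) = dVal k N n α p β) ∧
    (∀ (α : TQA k V N) (x : gr k V (mdeg N 0)) (β : TQA k V N),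
        epsP k V N (elemP 0 α x β) = α * toA k V N x * β) ∧
    (∀ n (α : TQA k V N) (a : Fin (n + 1) → Aplus k V N) (β : TQA k V N),
        b k V N n (elemQ α a β) = bVal k N n α a β) ∧
    (∀ (α : TQA k V N) (a : Fin 0 → Aplus k V N) (β : TQA k V N),
        epsQ k V N (elemQ α a β) = α * β) ∧
    -- the bimodule maps `F` and `G` are well defined
    (∀ n (p : Pth V), len p = mdeg N n →
        F k V N n (elemP n 1 (inGr k _ p) 1) = FVal k N n p) ∧
    (∀ n (q : BarWord V N n), G k V N n (barGen k N q) = GVal k N n q) ∧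
    -- `F` and `G` are comparison morphisms between projective resolutions of `A`
    IsComparison (d k V N) (epsP k V N) (b k V N) (epsQ k V N) (F k V N) ∧
    IsComparison (b k V N) (epsQ k V N) (d k V N) (epsP k V N) (G k V N) := by
  refine ⟨fun n => ?_, fun n => ?_, fun n α p β => d_elemP n α β, epsP_elemP, b_elemQ, epsQ_elemQ,
    fun n p hp => F_genP n ⟨p, hp⟩, fun n q => G_barGen q,
    ⟨isProjRes_P, isProjRes_Q k V N, ?_, epsQ_comp_F k V N⟩,
    ⟨isProjRes_Q k V N, isProjRes_P, ?_, epsP_comp_G k V N⟩⟩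
  · rw [← span_genP n]
    congr 1
    ext x
    exact ⟨fun ⟨p, hp, h⟩ => ⟨⟨p, hp⟩, h.symm⟩, fun ⟨p, h⟩ => ⟨p.1, p.2, h.symm⟩⟩
  · rw [← span_barGen n]
    congr 1
    ext x
    exact ⟨fun ⟨q, h⟩ => ⟨q, h.symm⟩, fun ⟨q, h⟩ => ⟨q, h.symm⟩⟩
  · exact comm_of_homotopy (homotopyQ k V N) (homotopyQAug k V N) b_homotopyQ_zero b_homotopyQ_succ
      epsP_d d_d (LinearMap.congr_fun (epsQ_comp_F k V N)) (g := fun n p => genP k V N n p)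
      span_genP F_genP_succ
  · exact comm_of_homotopy (fun n => (homotopyP k V N n).toAddMonoidHom)
      (homotopyPAug k V N).toAddMonoidHom d_homotopyP_zero d_homotopyP_succ epsQ_b b_b
      (LinearMap.congr_fun (epsP_comp_G k V N)) (g := fun n q => barGen k N q) span_barGen
      G_barGen_succ
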